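/- Let $q$ be a nonconstant rational function on $\mathbb{C}$. Definitions. (a) $q$ is a Halphen potential if it is bounded near infinity and if, for each $E\in\mathbb{C}$, the equation $y''+qy=Ey$ has a fundamental system of solutions that are meromorphic on $\mathbb{C}$. (b) For $g\in\mathbb{N}_0$, $q$ solves the $g$-th stationary (nonhomogeneous) KdV equation if there are rational functions $f_0,\dots,f_{g+1}$ with $f_0=1$, $f_{j+1}'=\tfrac14 f_j'''+q f_j'+\tfrac12 q' f_j$ for $0\le j\le g$ (so the integration constants are arbitrary), and $2f_{g+1}'=0$; $q$ is a rational KdV potential if it does so for some $g$. (c) With $F_g(E,z)=\sum_{j=0}^g f_{g-j}(z)E^j$, the expression $-\tfrac12 F_g''F_g+\tfrac14 (F_g')^2+(E-q)F_g^2$ is then a polynomial $R_{2g+1}(E)$ independent of $z$. If $g$ is minimal (that is, $q$ solves no $g'$-th stationary KdV equation with $g'<g$), $q$ is said to be associated with the curve $y^2=R_{2g+1}(E)$. (d) We say that $q$ has locus data $(M,(s_\ell),q_\infty,(\zeta_\ell))$ if $M\ge 1$ and $s_1,\dots,s_M\geq 1$ are integers, $q_\infty\in\mathbb{C}$, the points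 $\zeta_1,\dots,\zeta_M\in\mathbb{C}$ are pairwise distinct, $$q(z)=q_\infty-\sum_{\ell=1}^M s_\ell(s_\ell+1)(z-\zeta_\ell)^{-2},$$ and $$\sum_{\substack{\ell'=1\\ \ell'\ne\ell}}^M\frac{s_{\ell'}(s_{\ell'}+1)}{(\zeta_\ell-\zeta_{\ell'})^{2k+1}}=0\qquad\text{for } k=1,\dots,s_\ell \text{ and } \ell=1,\dots,M.$$ Then: 1. $q$ is a Halphen potential if and only if it has locus data. 2. $q$ is a rational KdV potential if and only if it has locus data. 3. For every $g\in\mathbb{N}_0$ and $q_\infty\in\mathbb{C}$, $q$ is associated with the curve $y^2=(E-q_\infty)^{2g+1}$ if and only if it has locus data with this $q_\infty$ and with $\sum_{\ell=1}^M s_\ell(s_\ell+1)=g(g+1)$. Moreover, whenever $q$ has locus data, $\sum_{\ell=1}^M s_\ell(s_\ell+1)=g(g+1)$ for some integer $g\ge1$. -/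

import Mathlib

open scoped Polynomial

noncomputable section

namespace HalphenKdV

/-- The value of the rational function `q` at `z` (with value `0` at the finitely many poles). -/
def val (q : RatFunc ℂ) (z : ℂ) : ℂ :=
  RatFunc.eval (RingHom.id ℂ) z q

/-- `q` is bounded near infinity. -/
def BoundedNearInfinity (q : RatFunc ℂ) : Prop :=
  ∃ R B : ℝ, ∀ z : ℂ, R ≤ ‖z‖ → ‖val q z‖ ≤ B

/-- `y` is a meromorphic function on `ℂ` satisfying `y'' + q y = E y` as an identity of meromorphic
functions, i.e. off a closed discrete set (which contains the poles of `q` and of `y`). -/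
def IsMeromorphicSolution (q : RatFunc ℂ) (E : ℂ) (y : ℂ → ℂ) : Prop :=
  Meromorphic y ∧
    ∀ᶠ z in Filter.codiscrete ℂ, deriv (deriv y) z + val q z * y z = E * y z

/-- `y'' + q y = E y` has a meromorphic fundamental system: two meromorphic solutions that are
linearly independent as meromorphic functions (functions that agree off a closed discrete set are
identified). -/
def HasMeromorphicFundamentalSystem (q : RatFunc ℂ) (E : ℂ) : Prop :=
  ∃ y₁ y₂ : ℂ → ℂ, IsMeromorphicSolution q E y₁ ∧ IsMeromorphicSolution q E y₂ ∧
    ∀ a b : ℂ, (∀ᶠ z in Filter.codiscrete ℂ, a * y₁ z + b * y₂ z = 0) → a = 0 ∧ b = 0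

/-- Halphen potentials. -/
def IsHalphenPotential (q : RatFunc ℂ) : Prop :=
  BoundedNearInfinity q ∧ ∀ E : ℂ, HasMeromorphicFundamentalSystem q E

/-- The derivative `d/dz` of a rational function, by the quotient rule. -/
def ratDeriv (f : RatFunc ℂ) : RatFunc ℂ :=
  algebraMap ℂ[X] (RatFunc ℂ)
      (Polynomial.derivative f.num * f.denom - f.num * Polynomial.derivative f.denom) /
    algebraMap ℂ[X] (RatFunc ℂ) (f.denom ^ 2)

/-- `f 0, …, f (g + 1)` solve the recursion
`f₀ = 1`, `f_{j+1}' = (1/4) f_j''' + q f_j' + (1/2) q' f_j`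
(integration constants are arbitrary), and `q` solves the corresponding `g`-th stationary
(nonhomogeneous) KdV equation `2 f_{g+1}' = 0`. -/
structure IsKdVSequence (q : RatFunc ℂ) (g : ℕ) (f : ℕ → RatFunc ℂ) : Prop where
  zero : f 0 = 1
  succ : ∀ j ≤ g, ratDeriv (f (j + 1)) =
    RatFunc.C (1 / 4) * ratDeriv (ratDeriv (ratDeriv (f j))) + q * ratDeriv (f j) +
      RatFunc.C (1 / 2) * ratDeriv q * f j
  kdv : 2 * ratDeriv (f (g + 1)) = 0

/-- `q` solves the `g`-th stationary KdV equation for some choice of the integration constants. -/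
def SolvesStationaryKdV (q : RatFunc ℂ) (g : ℕ) : Prop :=
  ∃ f : ℕ → RatFunc ℂ, IsKdVSequence q g f

/-- Rational (algebro-geometric) KdV potentials: solutions of one of the stationary KdV
equations. -/
def IsKdVPotential (q : RatFunc ℂ) : Prop :=
  ∃ g : ℕ, SolvesStationaryKdV q g

/-- The polynomial `F_g(E, ·) = ∑_{j ≤ g} f_{g-j} E^j` in the spectral parameter `E`. -/
def polyF (f : ℕ → RatFunc ℂ) (g : ℕ) : (RatFunc ℂ)[X] :=
  ∑ j ∈ Finset.range (g + 1), Polynomial.C (f (g - j)) * Polynomial.X ^ j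

/-- The polynomial `-(1/2) F_g'' F_g + (1/4) (F_g')² + (E - q) F_g²` in `E`, where `'` is `d/dz`,
taken coefficientwise. -/
def polyR (q : RatFunc ℂ) (f : ℕ → RatFunc ℂ) (g : ℕ) : (RatFunc ℂ)[X] :=
  -(Polynomial.C (RatFunc.C (1 / 2)) * polyF (fun j => ratDeriv (ratDeriv (f j))) g * polyF f g) +
    Polynomial.C (RatFunc.C (1 / 4)) * polyF (fun j => ratDeriv (f j)) g ^ 2 +
    (Polynomial.X - Polynomial.C q) * polyF f g ^ 2

/-- `q` is a KdV potential with spectral curve `y² = R(E)` of arithmetic genus `g`: `q` solves the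
`g`-th stationary KdV equation, the curve attached to that equation is `y² = R(E)`, and `g` is
minimal, that is, `q` solves no lower stationary KdV equation. Without minimality
no curve is attached to `q`: multiplying `F_g(E, ·)` by `E - c` gives a solution sequence
for `g + 1` and replaces `R(E)` by `(E - c)² R(E)`, for every constant `c`. -/
def HasSpectralCurve (q : RatFunc ℂ) (g : ℕ) (R : ℂ[X]) : Prop :=
  (∃ f : ℕ → RatFunc ℂ, IsKdVSequence q g f ∧ polyR q f g = R.map RatFunc.C) ∧
    ∀ g' < g, ¬ SolvesStationaryKdV q g'

/-- `q` is given by the data `q∞`, `s_ℓ ∈ {1, 2, …}` and pairwise distinct `ζ_ℓ`, and these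
satisfy the locus constraints. -/
structure IsLocusData (q : RatFunc ℂ) (qInf : ℂ) {M : ℕ} (s : Fin M → ℕ) (ζ : Fin M → ℂ) :
    Prop where
  pos : 1 ≤ M
  s_pos : ∀ l, 1 ≤ s l
  distinct : Function.Injective ζ
  eq : q = RatFunc.C qInf -
    ∑ l, RatFunc.C ((s l : ℂ) * (s l + 1)) / (RatFunc.X - RatFunc.C (ζ l)) ^ 2
  constraint : ∀ l, ∀ k ∈ Finset.Icc 1 (s l),
    ∑ l' ∈ Finset.univ.erase l, ((s l' : ℂ) * (s l' + 1)) / (ζ l - ζ l') ^ (2 * k + 1) = 0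

end HalphenKdV

end

open scoped LaurentSeries

/-!
Near a point of the locus `q` has leading term `-s (s + 1) t⁻²` and is even in `t` up to order
`2 s`. This local condition is forced by the stationary KdV equation, since a first odd coefficient
of `q` would survive in the odd part of the whole recursion, and by the existence of meromorphic
solutions for all `E`, since the same coefficient would obstruct the Frobenius recursion at the
resonance `2 s + 1` for some `E`.

Conversely, under the local conditions `y ↦ y'' + q y` preserves the quasi-invariant functions
`exp (k z) R(z)`. Filtered by the degree of `R`, these have bounded codimension, while
`y'' + q y - (k² + q∞) y` lowers the degree; counting dimensions, it has a kernel. The coefficients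
of the homogeneous KdV recursion have poles of order at most `2 s` and decay ever faster at
infinity, so the recursion terminates, and its leading coefficients at infinity can only vanish
if `∑ s (s + 1) = g (g + 1)`.
-/

noncomputable section

namespace HalphenKdV

-- `HahnSeries.powerSeriesAlgebra` gives a second, not definitionally equal, `R`-algebra structure.
local instance {R : Type*} [CommRing R] : Algebra R R⸨X⸩ := HahnSeries.instAlgebra

/-! ### Formal Laurent series -/

section LaurentSeries

variable {R : Type*} [CommRing R] {f g : R⸨X⸩} {m n : ℤ}

theorem coeff_single_one_mul_derivative (f : R⸨X⸩) (n : ℤ) :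
    (HahnSeries.single 1 1 * LaurentSeries.derivative R f).coeff n = n * f.coeff n := by
  simp [HahnSeries.coeff_single_mul]

theorem single_one_mul_derivative_mul (f g : R⸨X⸩) :
    HahnSeries.single 1 1 * LaurentSeries.derivative R (f * g) =
      f * (HahnSeries.single 1 1 * LaurentSeries.derivative R g) +
        g * (HahnSeries.single 1 1 * LaurentSeries.derivative R f) := by
  have support_subset (h : R⸨X⸩) :
      (HahnSeries.single 1 1 * LaurentSeries.derivative R h).support ⊆ h.support := fun i hi => by
    rw [HahnSeries.mem_support, coeff_single_one_mul_derivative] at hi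
    exact right_ne_zero_of_mul hi
  ext n
  rw [mul_comm g, HahnSeries.coeff_add, coeff_single_one_mul_derivative, HahnSeries.coeff_mul,
    HahnSeries.coeff_mul_right' g.isPWO_support (support_subset g),
    HahnSeries.coeff_mul_left' f.isPWO_support (support_subset f), Finset.mul_sum,
    ← Finset.sum_add_distrib]
  refine Finset.sum_congr rfl fun ij hij => ?_
  rw [Finset.mem_antidiagonal] at hij
  rw [coeff_single_one_mul_derivative, coeff_single_one_mul_derivative, ← hij.2.2]
  push_cast
  ring

/-- The derivative `d/dt` of formal Laurent series, as a derivation. -/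
def laurentDeriv (R : Type*) [CommRing R] : Derivation R R⸨X⸩ R⸨X⸩ :=
  Derivation.mk' (LaurentSeries.derivative R) fun f g => by
    have hunit : HahnSeries.single (-1) (1 : R) * HahnSeries.single 1 1 = 1 := by
      rw [HahnSeries.single_mul_single, neg_add_cancel, one_mul, HahnSeries.single_zero_one]
    have h := single_one_mul_derivative_mul f g
    rw [smul_eq_mul, smul_eq_mul]
    linear_combination HahnSeries.single (-1) (1 : R) * h +
      (f * LaurentSeries.derivative R g + g * LaurentSeries.derivative R f -
        LaurentSeries.derivative R (f * g)) * hunit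

theorem coeff_laurentDeriv (f : R⸨X⸩) (n : ℤ) :
    (laurentDeriv R f).coeff n = (n + 1) * f.coeff (n + 1) := by
  simp [laurentDeriv]

theorem coeff_laurentDeriv_sub_one (f : R⸨X⸩) (n : ℤ) :
    (laurentDeriv R f).coeff (n - 1) = n * f.coeff n := by
  rw [coeff_laurentDeriv, sub_add_cancel]
  push_cast
  ring

theorem coeff_eq_zero_of_coeff_laurentDeriv [NoZeroDivisors R] [CharZero R] (hn : n ≠ 0)
    (h : (laurentDeriv R f).coeff (n - 1) = 0) : f.coeff n = 0 := by
  rw [coeff_laurentDeriv_sub_one] at h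
  exact (mul_eq_zero.1 h).resolve_left (Int.cast_ne_zero.2 hn)

theorem exists_of_coeff_mul_ne_zero (h : (f * g).coeff n ≠ 0) :
    ∃ i j, f.coeff i ≠ 0 ∧ g.coeff j ≠ 0 ∧ i + j = n := by
  rw [HahnSeries.coeff_mul] at h
  obtain ⟨⟨i, j⟩, hij, -⟩ := Finset.exists_ne_zero_of_sum_ne_zero h
  obtain ⟨hi, hj, hadd⟩ := Finset.mem_antidiagonal.1 hij
  exact ⟨i, j, hi, hj, hadd⟩

/-- The series `f` has order at least `n`: its coefficients of index below `n` vanish. -/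
def OrdGE (n : ℤ) (f : R⸨X⸩) : Prop := ∀ i < n, f.coeff i = 0

theorem exists_ordGE_coeff_ne_zero (hf : f ≠ 0) : ∃ n, OrdGE n f ∧ f.coeff n ≠ 0 :=
  ⟨f.order, fun _ => HahnSeries.coeff_eq_zero_of_lt_order, mt HahnSeries.coeff_order_eq_zero.1 hf⟩

namespace OrdGE

theorem mono (hf : OrdGE n f) (h : m ≤ n) : OrdGE m f := fun i hi => hf i (hi.trans_le h)

theorem zero (n : ℤ) : OrdGE n (0 : R⸨X⸩) := fun _ _ => rfl

theorem add (hf : OrdGE n f) (hg : OrdGE n g) : OrdGE n (f + g) := fun i hi => by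
  rw [HahnSeries.coeff_add, hf i hi, hg i hi, add_zero]

theorem sub (hf : OrdGE n f) (hg : OrdGE n g) : OrdGE n (f - g) := fun i hi => by
  rw [HahnSeries.coeff_sub, hf i hi, hg i hi, sub_zero]

theorem smul (c : R) (hf : OrdGE n f) : OrdGE n (c • f) := fun i hi => by
  rw [HahnSeries.coeff_smul, hf i hi, smul_zero]

theorem neg (hf : OrdGE n f) : OrdGE n (-f) := by
  simpa using hf.smul (-1)

theorem sum {ι : Type*} (S : Finset ι) {f : ι → R⸨X⸩} (h : ∀ i ∈ S, OrdGE n (f i)) :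
    OrdGE n (∑ i ∈ S, f i) :=
  Finset.sum_induction _ (OrdGE n) (fun _ _ => add) (zero n) h

theorem mul (hf : OrdGE m f) (hg : OrdGE n g) : OrdGE (m + n) (f * g) := by
  intro i hi
  by_contra h
  obtain ⟨a, b, ha, hb, rfl⟩ := exists_of_coeff_mul_ne_zero h
  have ham : m ≤ a := not_lt.1 fun h => ha (hf a h)
  have hbn : n ≤ b := not_lt.1 fun h => hb (hg b h)
  omega

theorem single (n : ℤ) (c : R) : OrdGE n (HahnSeries.single n c) := fun _ hi =>
  HahnSeries.coeff_single_of_ne hi.ne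

theorem const (c : R) : OrdGE 0 (HahnSeries.C c) := single 0 c

theorem one : OrdGE 0 (1 : R⸨X⸩) := const 1

protected theorem laurentDeriv (hf : OrdGE n f) : OrdGE (n - 1) (laurentDeriv R f) := fun i hi => by
  rw [coeff_laurentDeriv, hf (i + 1) (by omega), mul_zero]

theorem laurentDeriv_of_zero (hf : OrdGE 0 f) : OrdGE 0 (laurentDeriv R f) := fun i hi => by
  rw [coeff_laurentDeriv]
  rcases eq_or_ne i (-1) with rfl | hi'
  · norm_num
  · rw [hf (i + 1) (by omega), mul_zero]

theorem of_laurentDeriv [NoZeroDivisors R] [CharZero R]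
    (h : OrdGE n (laurentDeriv R f)) (hn : n + 1 ≤ 0) : OrdGE (n + 1) f := fun i hi =>
  coeff_eq_zero_of_coeff_laurentDeriv (by omega) (h _ (by omega))

theorem coeff_mul_eq_sum_range (hf : OrdGE m f) (hg : OrdGE n g) (p : ℕ) :
    (f * g).coeff (m + n + p) =
      ∑ i ∈ Finset.range (p + 1), f.coeff (m + i) * g.coeff (n + (p - i : ℕ)) := by
  have support_subset {k : ℤ} {h : R⸨X⸩} (hh : OrdGE k h) : h.support ⊆ Set.Ici k :=
    fun i hi => not_lt.1 fun hik => hi (hh i hik)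
  have isPWO_Ici (k : ℤ) : (Set.Ici k).IsPWO := (BddBelow.isWF ⟨k, fun _ h => h⟩).isPWO
  have hzero {ij : ℤ × ℤ} (h : ¬(ij.1 ∈ f.support ∧ ij.2 ∈ g.support)) :
      f.coeff ij.1 * g.coeff ij.2 = 0 := by
    rw [HahnSeries.mem_support, HahnSeries.mem_support] at h
    by_contra h0
    exact h ⟨left_ne_zero_of_mul h0, right_ne_zero_of_mul h0⟩
  rw [HahnSeries.coeff_mul]
  refine (Finset.sum_subset
    (s₂ := Finset.antidiagonal (isPWO_Ici m) (isPWO_Ici n) (m + n + p)) ?_ ?_).trans ?_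
  · intro ij hij
    rw [Finset.mem_antidiagonal] at hij ⊢
    exact ⟨support_subset hf hij.1, support_subset hg hij.2.1, hij.2.2⟩
  · intro ij hij hij'
    rw [Finset.mem_antidiagonal] at hij hij'
    exact hzero fun h => hij' ⟨h.1, h.2, hij.2.2⟩
  · refine (Finset.sum_bij (fun (i : ℕ) _ => (m + (i : ℤ), n + ((p - i : ℕ) : ℤ)))
      ?_ ?_ ?_ fun _ _ => rfl).symm
    · intro i hi
      rw [Finset.mem_range] at hi
      simp only [Finset.mem_antidiagonal, Set.mem_Ici]
      omega
    · intro i _ j _ h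
      simpa using congrArg Prod.fst h
    · rintro ⟨a, b⟩ h
      simp only [Finset.mem_antidiagonal, Set.mem_Ici] at h
      exact ⟨(a - m).toNat, Finset.mem_range.2 (by omega),
        Prod.ext (by simp; omega) (by simp; omega)⟩

theorem coeff_mul (hf : OrdGE m f) (hg : OrdGE n g) :
    (f * g).coeff (m + n) = f.coeff m * g.coeff n := by
  simpa using hf.coeff_mul_eq_sum_range hg 0

theorem of_mul [NoZeroDivisors R] (hf : OrdGE m f) (hfm : f.coeff m ≠ 0)
    (h : OrdGE (m + n) (f * g)) : OrdGE n g := by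
  rcases eq_or_ne g 0 with rfl | hg
  · exact zero n
  obtain ⟨k, hk, hgk⟩ := exists_ordGE_coeff_ne_zero hg
  refine hk.mono (not_lt.1 fun hkn => mul_ne_zero hfm hgk ?_)
  rw [← hf.coeff_mul hk]
  exact h _ (by omega)

end OrdGE

/-- The exponents occurring in `f` are among `n, n + 2, n + 4, …`. -/
def ParityGE (n : ℤ) (f : R⸨X⸩) : Prop := ∀ i, f.coeff i ≠ 0 → ∃ k : ℕ, i = n + 2 * k

namespace ParityGE

theorem ordGE (hf : ParityGE n f) : OrdGE n f := fun i hi => by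
  by_contra h
  obtain ⟨k, hk⟩ := hf i h
  omega

theorem coeff_eq_zero (hf : ParityGE n f) {i : ℤ} (h : (i - n) % 2 ≠ 0) : f.coeff i = 0 := by
  by_contra h'
  obtain ⟨k, hk⟩ := hf i h'
  omega

theorem mono (hf : ParityGE n f) (h : m ≤ n) (h' : (n - m) % 2 = 0) : ParityGE m f := by
  intro i hi
  obtain ⟨k, hk⟩ := hf i hi
  exact ⟨((i - m) / 2).toNat, by omega⟩

theorem add_two (hf : ParityGE n f) (h : f.coeff n = 0) : ParityGE (n + 2) f := by
  intro i hi
  obtain ⟨k, rfl⟩ := hf i hi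
  have hk : k ≠ 0 := by
    rintro rfl
    exact hi (by simpa using h)
  exact ⟨k - 1, by omega⟩

theorem add (hf : ParityGE n f) (hg : ParityGE n g) : ParityGE n (f + g) := by
  intro i hi
  by_cases h : f.coeff i = 0
  · exact hg i (by simpa [h] using hi)
  · exact hf i h

theorem smul (c : R) (hf : ParityGE n f) : ParityGE n (c • f) := fun i hi => by
  rw [HahnSeries.coeff_smul] at hi
  exact hf i (right_ne_zero_of_smul hi)

theorem mul (hf : ParityGE m f) (hg : ParityGE n g) : ParityGE (m + n) (f * g) := by
  intro i hi
  obtain ⟨a, b, ha, hb, rfl⟩ := exists_of_coeff_mul_ne_zero hi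
  obtain ⟨k, rfl⟩ := hf a ha
  obtain ⟨l, rfl⟩ := hg b hb
  exact ⟨k + l, by push_cast; ring⟩

protected theorem laurentDeriv (hf : ParityGE n f) : ParityGE (n - 1) (laurentDeriv R f) := by
  intro i hi
  rw [coeff_laurentDeriv] at hi
  obtain ⟨k, hk⟩ := hf _ (right_ne_zero_of_mul hi)
  exact ⟨k, by omega⟩

end ParityGE

/-- The part of `f` with exponents congruent to `r` modulo `2`. -/
def parityPart (r : ℤ) (f : R⸨X⸩) : R⸨X⸩ where
  coeff i := if (i - r) % 2 = 0 then f.coeff i else 0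
  isPWO_support' := f.isPWO_support.mono fun _ hi => (ite_ne_right_iff.1 hi).2

theorem coeff_parityPart (r : ℤ) (f : R⸨X⸩) (i : ℤ) :
    (parityPart r f).coeff i = if (i - r) % 2 = 0 then f.coeff i else 0 := rfl

theorem parityGE_parityPart {r : ℤ} (h : ∀ i < r, (i - r) % 2 = 0 → f.coeff i = 0) :
    ParityGE r (parityPart r f) := by
  intro i hi
  obtain ⟨hir, hfi⟩ := ite_ne_right_iff.1 hi
  have : r ≤ i := not_lt.1 fun h' => hfi (h i h' hir)
  exact ⟨((i - r) / 2).toNat, by omega⟩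

theorem exists_parityGE_add_parityGE {a b : ℤ} (hab : (a - b) % 2 ≠ 0)
    (ha : ∀ i < a, (i - a) % 2 = 0 → f.coeff i = 0)
    (hb : ∀ i < b, (i - b) % 2 = 0 → f.coeff i = 0) :
    ∃ e u, f = e + u ∧ ParityGE a e ∧ ParityGE b u ∧ e.coeff a = f.coeff a ∧
      u.coeff b = f.coeff b := by
  refine ⟨parityPart a f, parityPart b f, ?_, parityGE_parityPart ha, parityGE_parityPart hb,
    by simp [coeff_parityPart], by simp [coeff_parityPart]⟩
  ext i
  rw [HahnSeries.coeff_add, coeff_parityPart, coeff_parityPart]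
  by_cases h : (i - a) % 2 = 0
  · rw [if_pos h, if_neg (by omega), add_zero]
  · rw [if_neg h, if_pos (by omega), zero_add]

end LaurentSeries

/-! ### The operators of the KdV recursion -/

section KdVOperators

variable {K A B : Type*} [Field K] [CommRing A] [Algebra K A] [CommRing B] [Algebra K B]

/-- The part `f ↦ q f' + q' f / 2` of the KdV recursion operator that is bilinear in `q` and `f`. -/
def crossOp (D : Derivation K A A) (q f : A) : A := q * D f + (1 / 2 : K) • (D q * f)

/-- The third order operator `f ↦ f''' / 4 + q f' + q' f / 2` of the KdV recursion. -/
def kdvOp (D : Derivation K A A) (q f : A) : A := (1 / 4 : K) • D (D (D f)) + crossOp D q f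

/-- The stationary KdV recursion and equation of `IsKdVSequence` in an arbitrary differential
`K`-algebra. The general form lets local expansions, expansions at infinity and shifts of a
rational solution be treated alike. -/
structure IsStationaryKdV (D : Derivation K A A) (q : A) (g : ℕ) (f : ℕ → A) : Prop where
  zero : f 0 = 1
  succ : ∀ j ≤ g, D (f (j + 1)) = kdvOp D q (f j)
  kdv : D (f (g + 1)) = 0

variable {D : Derivation K A A} {D' : Derivation K B B}

theorem crossOp_add_left (p q f : A) : crossOp D (p + q) f = crossOp D p f + crossOp D q f := by
  simp only [crossOp, map_add, add_mul, smul_add]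
  ring

theorem crossOp_add_right (q f g : A) : crossOp D q (f + g) = crossOp D q f + crossOp D q g := by
  simp only [crossOp, map_add, mul_add, smul_add]
  ring

theorem kdvOp_add_right (q f g : A) : kdvOp D q (f + g) = kdvOp D q f + kdvOp D q g := by
  simp only [kdvOp, crossOp_add_right, map_add, smul_add]
  ring

theorem kdvOp_add_left (p q f : A) : kdvOp D (p + q) f = kdvOp D p f + crossOp D q f := by
  rw [kdvOp, kdvOp, crossOp_add_left, add_assoc]

theorem kdvOp_add_add (p q e u : A) :
    kdvOp D (p + q) (e + u) =
      (kdvOp D p e + crossOp D q u) + (kdvOp D p u + crossOp D q e) := by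
  rw [kdvOp_add_right, kdvOp_add_left, kdvOp_add_left]
  ring

theorem map_kdvOp (φ : A →ₐ[K] B) (hφ : ∀ a, φ (D a) = D' (φ a)) (q f : A) :
    φ (kdvOp D q f) = kdvOp D' (φ q) (φ f) := by
  simp only [kdvOp, crossOp, map_add, map_mul, map_smul, hφ]

theorem IsStationaryKdV.map {q : A} {g : ℕ} {f : ℕ → A} (h : IsStationaryKdV D q g f)
    (φ : A →ₐ[K] B) (hφ : ∀ a, φ (D a) = D' (φ a)) :
    IsStationaryKdV D' (φ q) g fun j => φ (f j) where
  zero := by rw [h.zero, map_one]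
  succ j hj := by rw [← hφ, h.succ j hj, map_kdvOp φ hφ]
  kdv := by rw [← hφ, h.kdv, map_zero]

end KdVOperators

/-! ### Leading coefficients of the KdV recursion -/

section LaurentKdVOp

variable {K : Type*} [Field K] {q f : K⸨X⸩} {m n : ℤ}

protected theorem OrdGE.crossOp (hq : OrdGE m q) (hf : OrdGE n f) :
    OrdGE (m + n - 1) (crossOp (laurentDeriv K) q f) :=
  ((hq.mul hf.laurentDeriv).mono (by omega)).add
    (((hq.laurentDeriv.mul hf).smul _).mono (by omega))

protected theorem ParityGE.crossOp (hq : ParityGE m q) (hf : ParityGE n f) :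
    ParityGE (m + n - 1) (crossOp (laurentDeriv K) q f) :=
  ((hq.mul hf.laurentDeriv).mono (by omega) (by omega)).add
    (((hq.laurentDeriv.mul hf).smul _).mono (by omega) (by omega))

protected theorem OrdGE.kdvOp (hq : OrdGE (-2) q) (hf : OrdGE n f) :
    OrdGE (n - 3) (kdvOp (laurentDeriv K) q f) :=
  ((hf.laurentDeriv.laurentDeriv.laurentDeriv.smul _).mono (by omega)).add
    ((hq.crossOp hf).mono (by omega))

protected theorem ParityGE.kdvOp (hq : ParityGE (-2) q) (hf : ParityGE n f) :
    ParityGE (n - 3) (kdvOp (laurentDeriv K) q f) :=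
  ((hf.laurentDeriv.laurentDeriv.laurentDeriv.smul _).mono (by omega) (by omega)).add
    ((hq.crossOp hf).mono (by omega) (by omega))

variable [CharZero K]

theorem OrdGE.coeff_crossOp (hq : OrdGE m q) (hf : OrdGE n f) :
    (crossOp (laurentDeriv K) q f).coeff (m + n - 1) =
      (n + m / 2) * (q.coeff m * f.coeff n) := by
  have h₁ := hq.coeff_mul hf.laurentDeriv
  have h₂ := hq.laurentDeriv.coeff_mul hf
  rw [coeff_laurentDeriv_sub_one] at h₁ h₂
  rw [crossOp, HahnSeries.coeff_add, HahnSeries.coeff_smul,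
    show m + n - 1 = m + (n - 1) by ring, h₁, show m + (n - 1) = m - 1 + n by ring, h₂,
    smul_eq_mul]
  ring

theorem OrdGE.coeff_kdvOp (hq : OrdGE (-2) q) (hf : OrdGE n f) :
    (kdvOp (laurentDeriv K) q f).coeff (n - 3) =
      ((n - 1) * (n * (n - 2) / 4 + q.coeff (-2))) * f.coeff n := by
  have h := hq.coeff_crossOp hf
  rw [kdvOp, HahnSeries.coeff_add, HahnSeries.coeff_smul, smul_eq_mul,
    show n - 3 = n - 1 - 1 - 1 by ring, coeff_laurentDeriv_sub_one, coeff_laurentDeriv_sub_one,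
    coeff_laurentDeriv_sub_one, show n - 1 - 1 - 1 = -2 + n - 1 by ring, h]
  push_cast
  ring

theorem exists_kdvOp_eq_add {k : ℕ} (hq : OrdGE (-2) q)
    (hqk : ∀ i < 2 * (k : ℤ) - 1, i % 2 = 1 → q.coeff i = 0) (hf : OrdGE n f)
    (hfk : ∀ i < n + 2 * k + 1, (i - n) % 2 = 1 → f.coeff i = 0) :
    ∃ e u, kdvOp (laurentDeriv K) q f = e + u ∧ ParityGE (n - 3) e ∧ ParityGE (n + 2 * k - 2) u ∧
      u.coeff (n + 2 * k - 2) =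
        (n + 2 * k) * ((n + 2 * k + 1) * (n + 2 * k - 1) / 4 + q.coeff (-2)) *
            f.coeff (n + 2 * k + 1) +
          (n + k - 1 / 2) * (q.coeff (2 * k - 1) * f.coeff n) := by
  obtain ⟨qe, qu, rfl, hqe, hqu, hqe', hqu'⟩ := exists_parityGE_add_parityGE (f := q) (a := -2)
    (b := 2 * k - 1) (by omega) (fun i hi _ => hq i hi) (fun i hi hi' => hqk i hi (by omega))
  obtain ⟨e, u, rfl, he, hu, he', hu'⟩ := exists_parityGE_add_parityGE (f := f) (a := n)
    (b := n + 2 * k + 1) (by omega) (fun i hi _ => hf i hi) (fun i hi hi' => hfk i hi (by omega))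
  refine ⟨_, _, kdvOp_add_add qe qu e u,
    (hqe.kdvOp he).add ((hqu.crossOp hu).mono (by omega) (by omega)),
    ((hqe.kdvOp hu).mono (by omega) (by omega)).add
      ((hqu.crossOp he).mono (by omega) (by omega)), ?_⟩
  have hqeu := hqe.ordGE.coeff_kdvOp hu.ordGE
  have hque := hqu.ordGE.coeff_crossOp he.ordGE
  rw [show n + 2 * (k : ℤ) + 1 - 3 = n + 2 * k - 2 by ring] at hqeu
  rw [show 2 * (k : ℤ) - 1 + n - 1 = n + 2 * k - 2 by ring] at hque
  rw [HahnSeries.coeff_add, hqeu, hque, ← he', ← hu', ← hqe', ← hqu']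
  push_cast
  ring

end LaurentKdVOp

/-! ### The local form of the locus conditions -/

section LocalCond

variable {K : Type*} [Field K] {q : K⸨X⸩} {s : ℕ}

/-- The local form of the locus conditions: the series starts with `-s (s + 1) t⁻²` and its
coefficients of index `-1, 1, …, 2 s - 1` vanish. -/
structure LocalCond (q : K⸨X⸩) (s : ℕ) : Prop where
  ordGE : OrdGE (-2) q
  lead : q.coeff (-2) = -((s : K) * (s + 1))
  odd : ∀ k : ℕ, k ≤ s → q.coeff (2 * k - 1) = 0

theorem LocalCond.coeff_eq_zero (h : LocalCond q s) {i : ℤ} (hi : i < 2 * s + 1)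
    (hi' : i % 2 = 1) : q.coeff i = 0 := by
  by_cases hi2 : i < -2
  · exact h.ordGE i hi2
  · obtain ⟨k, rfl⟩ : ∃ k : ℕ, i = 2 * k - 1 := ⟨((i + 1) / 2).toNat, by omega⟩
    exact h.odd k (by omega)

theorem LocalCond.exists_parts (h : LocalCond q s) :
    ∃ e u, q = e + u ∧ ParityGE (-2) e ∧ ParityGE (2 * s + 1) u ∧
      e.coeff (-2) = -((s : K) * (s + 1)) := by
  obtain ⟨e, u, hq, he, hu, hlead, -⟩ := exists_parityGE_add_parityGE (f := q) (a := -2)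
    (b := 2 * s + 1) (by omega) (fun i hi _ => h.ordGE i hi)
    (fun i hi hi' => h.coeff_eq_zero hi (by omega))
  exact ⟨e, u, hq, he, hu, hlead.trans h.lead⟩

/-- Quasi-invariance: `t ^ s * Y` is a power series that is even up to order `2 s`. -/
def QuasiInv (s : ℕ) (Y : K⸨X⸩) : Prop :=
  OrdGE (-s) Y ∧ ∀ i : ℕ, i < s → Y.coeff (-s + 1 + 2 * i) = 0

theorem QuasiInv.zero (s : ℕ) : QuasiInv s (0 : K⸨X⸩) :=
  ⟨OrdGE.zero _, fun _ _ => rfl⟩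

theorem QuasiInv.add {s : ℕ} {Y Z : K⸨X⸩} (hY : QuasiInv s Y) (hZ : QuasiInv s Z) :
    QuasiInv s (Y + Z) :=
  ⟨hY.1.add hZ.1, fun i hi => by rw [HahnSeries.coeff_add, hY.2 i hi, hZ.2 i hi, add_zero]⟩

theorem QuasiInv.smul {s : ℕ} {Y : K⸨X⸩} (c : K) (hY : QuasiInv s Y) : QuasiInv s (c • Y) :=
  ⟨hY.1.smul c, fun i hi => by rw [HahnSeries.coeff_smul, hY.2 i hi, smul_zero]⟩

theorem quasiInv_iff {Y : K⸨X⸩} :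
    QuasiInv s Y ↔ ∃ e u, Y = e + u ∧ ParityGE (-s) e ∧ ParityGE (s + 1) u := by
  constructor
  · rintro ⟨hord, hodd⟩
    obtain ⟨e, u, hY, he, hu, -, -⟩ := exists_parityGE_add_parityGE (f := Y) (a := -s) (b := s + 1)
      (by omega) (fun i hi _ => hord i hi) (by
        intro i hi hi'
        by_cases his : i < -s
        · exact hord i his
        · obtain ⟨k, rfl⟩ : ∃ k : ℕ, i = -s + 1 + 2 * k := ⟨((i + s - 1) / 2).toNat, by omega⟩
          exact hodd k (by omega))
    exact ⟨e, u, hY, he, hu⟩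
  · rintro ⟨e, u, rfl, he, hu⟩
    refine ⟨he.ordGE.add (hu.ordGE.mono (by omega)), fun i hi => ?_⟩
    rw [HahnSeries.coeff_add, he.coeff_eq_zero (by omega), hu.ordGE _ (by omega), add_zero]

/-- The indicial polynomial of `Y'' + q Y` vanishes at `n`, so no exponent `n - 2` appears. -/
theorem ParityGE.secondDeriv_add_mul {f : K⸨X⸩} {n : ℤ} (hq : ParityGE (-2) q)
    (hf : ParityGE n f) (hn : n * (n - 1) + q.coeff (-2) = 0) :
    ParityGE n (laurentDeriv K (laurentDeriv K f) + q * f) := by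
  have hsub : ParityGE (n - 2) (laurentDeriv K (laurentDeriv K f) + q * f) :=
    (hf.laurentDeriv.laurentDeriv.mono (by omega) (by omega)).add
      ((hq.mul hf).mono (by omega) (by omega))
  have hcoeff : (laurentDeriv K (laurentDeriv K f) + q * f).coeff (n - 2) = 0 := by
    rw [HahnSeries.coeff_add, show n - 2 = n - 1 - 1 by ring, coeff_laurentDeriv_sub_one,
      coeff_laurentDeriv_sub_one, show n - 1 - 1 = -2 + n by ring, hq.ordGE.coeff_mul hf.ordGE]
    push_cast
    linear_combination f.coeff n * hn
  simpa using hsub.add_two hcoeff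

theorem LocalCond.quasiInv (h : LocalCond q s) {Y : K⸨X⸩} (hY : QuasiInv s Y) :
    QuasiInv s (laurentDeriv K (laurentDeriv K Y) + q * Y) := by
  obtain ⟨qe, qu, rfl, hqe, hqu, hlead⟩ := h.exists_parts
  obtain ⟨e, u, rfl, he, hu⟩ := quasiInv_iff.1 hY
  refine quasiInv_iff.2 ⟨(laurentDeriv K (laurentDeriv K e) + qe * e) + qu * u,
    (laurentDeriv K (laurentDeriv K u) + qe * u) + qu * e, ?_, ?_, ?_⟩
  · simp only [map_add]
    ring
  · exact (hqe.secondDeriv_add_mul he (by rw [hlead]; push_cast; ring)).add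
      ((hqu.mul hu).mono (by omega) (by omega))
  · exact (hqe.secondDeriv_add_mul hu (by rw [hlead]; push_cast; ring)).add
      ((hqu.mul he).mono (by omega) (by omega))

/-- The pole type of the KdV coefficients at a point of the locus: order at least `-2 s`, and no
odd negative exponents. -/
def EvenPole (s : ℕ) (f : K⸨X⸩) : Prop :=
  OrdGE (-(2 * s)) f ∧ ∀ i : ℤ, i < 0 → i % 2 = 1 → f.coeff i = 0

theorem LocalCond.evenPole [CharZero K] (h : LocalCond q s) {f g : K⸨X⸩} (hf : EvenPole s f)
    (hg : laurentDeriv K g = kdvOp (laurentDeriv K) q f) : EvenPole s g := by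
  obtain ⟨e, u, heu, he, hu, hcoeff⟩ := exists_kdvOp_eq_add (k := s) h.ordGE
    (fun i hi hi' => h.coeff_eq_zero (by omega) hi') hf.1
    (fun i hi hi' => hf.2 i (by omega) (by omega))
  rw [← hg] at heu
  have hu0 : u.coeff (-(2 * s) + 2 * s - 2) = 0 := by
    rw [hcoeff, h.odd s le_rfl]
    push_cast
    ring
  have he0 : e.coeff (-(2 * s) - 3) = 0 := by
    have hlead := h.ordGE.coeff_kdvOp hf.1
    rw [← hg, heu, HahnSeries.coeff_add, hu.coeff_eq_zero (by omega), add_zero, h.lead] at hlead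
    rw [hlead]
    push_cast
    ring
  have he' := he.add_two he0
  have hu' := hu.add_two hu0
  refine ⟨fun i hi => coeff_eq_zero_of_coeff_laurentDeriv (by omega) ?_,
    fun i hi hi' => coeff_eq_zero_of_coeff_laurentDeriv (by omega) ?_⟩
  · rw [heu, HahnSeries.coeff_add, he'.ordGE _ (by omega), hu'.ordGE _ (by omega), add_zero]
  · rw [heu, HahnSeries.coeff_add, he'.coeff_eq_zero (by omega), hu'.ordGE _ (by omega), add_zero]

end LocalCond

/-! ### Stationary KdV potentials satisfy the local conditions -/

section HasSign

variable {K : Type*} [Field K] {j : ℕ} {c : ℚ} {x y : K}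

/-- `x` is a nonzero rational number of sign `(-1) ^ j`. -/
def HasSign (j : ℕ) (x : K) : Prop := ∃ r : ℚ, 0 < r ∧ x = (-1) ^ j * r

namespace HasSign

theorem one : HasSign 0 (1 : K) := ⟨1, one_pos, by simp⟩

theorem neg (hx : HasSign j x) : HasSign (j + 1) (-x) := by
  obtain ⟨r, hr, rfl⟩ := hx
  exact ⟨r, hr, by ring⟩

variable [CharZero K]

theorem ne_zero (hx : HasSign j x) : x ≠ 0 := by
  obtain ⟨r, hr, rfl⟩ := hx
  exact mul_ne_zero (pow_ne_zero _ (neg_ne_zero.2 one_ne_zero)) (Rat.cast_ne_zero.2 hr.ne')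

theorem add (hx : HasSign j x) (hy : HasSign j y) : HasSign j (x + y) := by
  obtain ⟨r, hr, rfl⟩ := hx
  obtain ⟨r', hr', rfl⟩ := hy
  exact ⟨r + r', add_pos hr hr', by push_cast; ring⟩

theorem ratCast_mul (hc : 0 < c) (hx : HasSign j x) : HasSign j (c * x) := by
  obtain ⟨r, hr, rfl⟩ := hx
  exact ⟨c * r, mul_pos hc hr, by push_cast; ring⟩

theorem of_ratCast_mul (hc : 0 < c) (hx : HasSign j (c * x)) : HasSign j x := by
  have hcK : (c : K) ≠ 0 := Rat.cast_ne_zero.2 hc.ne'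
  have hx' := hx.ratCast_mul (inv_pos.2 hc)
  rwa [Rat.cast_inv, inv_mul_cancel_left₀ hcK] at hx'

end HasSign

end HasSign

section KdVCoefficients

variable {K : Type*} [Field K] [CharZero K] {s m g : ℕ} {γ : K} {α b : ℕ → K}

theorem hasSign_of_lead_recursion (h0 : α 0 = 1)
    (hα : ∀ j < s, 2 * ((j : K) + 1) * α (j + 1) =
      (2 * j + 1) * (j * (j + 1) - s * (s + 1)) * α j) :
    ∀ j ≤ s, HasSign j (α j) := by
  intro j
  induction j with
  | zero => exact fun _ => h0 ▸ HasSign.one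
  | succ j ih =>
    intro hj
    have hjs : (j : ℚ) + 1 ≤ s := by exact_mod_cast hj
    have hfactor : (0 : ℚ) < (2 * j + 1) * (s * (s + 1) - j * (j + 1)) :=
      mul_pos (by positivity) (by nlinarith)
    have hsign := ((ih (by omega)).ratCast_mul hfactor).neg
    refine HasSign.of_ratCast_mul (c := 2 * (j + 1)) (by positivity) ?_
    convert hsign using 1
    have hrec := hα j hj
    push_cast
    linear_combination hrec

theorem eq_zero_of_lead_recursion
    (hα : ∀ j ≤ g, 2 * ((j : K) + 1) * α (j + 1) =
      (2 * j + 1) * (j * (j + 1) - s * (s + 1)) * α j) :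
    ∀ j > s, j ≤ g + 1 → α j = 0 := by
  intro j hj
  induction j, hj using Nat.le_induction with
  | base =>
    intro hsg
    have hrec := hα s (by omega)
    rw [sub_self, mul_zero, zero_mul] at hrec
    exact (mul_eq_zero.1 hrec).resolve_left (mul_ne_zero two_ne_zero s.cast_add_one_ne_zero)
  | succ j _ ih =>
    intro hjg
    have hrec := hα j (by omega)
    rw [ih (by omega), mul_zero] at hrec
    exact (mul_eq_zero.1 hrec).resolve_left (mul_ne_zero two_ne_zero j.cast_add_one_ne_zero)

theorem hasSign_of_odd_recursion (hγ : γ ≠ 0) (hα : ∀ j ≤ s, HasSign j (α j))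
    (hb : ∀ j ≤ s, (2 * ((m : K) - j) - 1) * b (j + 1) =
      2 * (m - j) * ((m - j) ^ 2 - (s + 1 / 2) ^ 2) * b j + γ * α j * (m - 1 / 2 - 2 * j)) :
    ∀ j ≥ m, j ≤ s → HasSign j (b (j + 1) / γ) := by
  intro j hj
  induction j, hj using Nat.le_induction with
  | base =>
    intro hms
    convert (hα m hms).ratCast_mul (c := m + 1 / 2) (by positivity) using 1
    have hrec := hb m hms
    field_simp
    push_cast
    linear_combination -hrec
  | succ j hj ih =>
    intro hjs
    have hmj : (m : ℚ) ≤ j := by exact_mod_cast hj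
    have hjs' : (j : ℚ) + 1 ≤ s := by exact_mod_cast hjs
    have : (0 : ℚ) ≤ m := by positivity
    have hfactor : (0 : ℚ) < 2 * (j + 1 - m) * ((s + 1 / 2) ^ 2 - (j + 1 - m) ^ 2) :=
      mul_pos (by linarith) (by nlinarith)
    have hfactor' : (0 : ℚ) < 2 * (j + 1) + 1 / 2 - m := by linarith
    refine HasSign.of_ratCast_mul (c := 2 * (j + 1 - m) + 1) (by linarith) ?_
    convert ((ih (by omega)).ratCast_mul hfactor).neg.add ((hα (j + 1) hjs).ratCast_mul hfactor')
      using 1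
    have hrec := hb (j + 1) hjs
    field_simp
    push_cast at hrec ⊢
    linear_combination -hrec

theorem ne_zero_of_odd_recursion (hms : m ≤ s) (hs : b (s + 1) ≠ 0)
    (hα : ∀ j > s, j ≤ g → α j = 0)
    (hb : ∀ j ≤ g, (2 * ((m : K) - j) - 1) * b (j + 1) =
      2 * (m - j) * ((m - j) ^ 2 - (s + 1 / 2) ^ 2) * b j + γ * α j * (m - 1 / 2 - 2 * j)) :
    ∀ j ≥ s, j ≤ g → b (j + 1) ≠ 0 := by
  intro j hj
  induction j, hj using Nat.le_induction with
  | base => exact fun _ => hs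
  | succ j hj ih =>
    intro hjg hbj
    have hrec := hb (j + 1) hjg
    rw [hbj, hα (j + 1) (by omega) (by omega)] at hrec
    have hfactor : 2 * ((m : ℤ) - (j + 1 : ℕ)) *
        ((2 * (m - (j + 1 : ℕ)) - (2 * s + 1)) * (2 * (m - (j + 1 : ℕ)) + (2 * s + 1))) ≠ 0 :=
      mul_ne_zero (by omega) (mul_ne_zero (by omega) (by omega))
    refine mul_ne_zero (Int.cast_ne_zero (α := K).2 hfactor) (ih (by omega)) ?_
    push_cast at hrec ⊢
    linear_combination -4 * hrec

end KdVCoefficients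

namespace IsStationaryKdV

variable {K : Type*} [Field K] [CharZero K] {q : K⸨X⸩} {g : ℕ} {f : ℕ → K⸨X⸩}

theorem coeff_last_eq_zero (h : IsStationaryKdV (laurentDeriv K) q g f) {n : ℤ} (hn : n ≠ 0) :
    (f (g + 1)).coeff n = 0 :=
  coeff_eq_zero_of_coeff_laurentDeriv hn (by rw [h.kdv, HahnSeries.coeff_zero])

/-- With a pole of order `p ≥ 3`, the term `q f'` dominates the recursion, so that `f j` has a pole
of order exactly `p j`. -/
theorem ordGE_and_coeff_ne_zero (h : IsStationaryKdV (laurentDeriv K) q g f) {p : ℕ} (hp : 3 ≤ p)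
    (hq : OrdGE (-p) q) (hqp : q.coeff (-p) ≠ 0) :
    ∀ j ≤ g + 1, OrdGE (-(p * j)) (f j) ∧ (f j).coeff (-(p * j)) ≠ 0 := by
  intro j
  induction j with
  | zero =>
    intro _
    rw [h.zero]
    exact ⟨by simpa using OrdGE.one, by simp⟩
  | succ j ih =>
    intro hj
    obtain ⟨hord, hlead⟩ := ih (by omega)
    have hthird := hord.laurentDeriv.laurentDeriv.laurentDeriv.smul (1 / 4)
    have hrec := h.succ j (by omega)
    have hindex : -((p : ℤ) * (j + 1 : ℕ)) = -p + -(p * j) := by push_cast; ring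
    have hderiv : OrdGE (-p + -(p * j) - 1 : ℤ) (laurentDeriv K (f (j + 1))) := by
      rw [hrec]
      exact (hthird.mono (by omega)).add (hq.crossOp hord)
    rw [hindex]
    have hpj : 0 ≤ (p : ℤ) * j := by positivity
    refine ⟨by simpa using hderiv.of_laurentDeriv (by omega), fun hzero => ?_⟩
    have hcoeff := coeff_laurentDeriv_sub_one (f (j + 1)) (-p + -(p * j))
    rw [hzero, mul_zero, hrec, kdvOp, HahnSeries.coeff_add, hthird _ (by omega),
      hq.coeff_crossOp hord, zero_add] at hcoeff
    have hfactor : ((2 * (p * j) + p : ℕ) : K) ≠ 0 := Nat.cast_ne_zero.2 (by omega)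
    refine mul_ne_zero hfactor (mul_ne_zero hqp hlead) ?_
    push_cast at hcoeff ⊢
    linear_combination -2 * hcoeff

theorem ordGE_potential (h : IsStationaryKdV (laurentDeriv K) q g f) : OrdGE (-2) q := by
  by_contra hq2
  have hq0 : q ≠ 0 := by
    rintro rfl
    exact hq2 (OrdGE.zero _)
  obtain ⟨n, hn, hqn⟩ := exists_ordGE_coeff_ne_zero hq0
  have hn3 : n < -2 := not_le.1 fun hle => hq2 (hn.mono hle)
  obtain ⟨p, rfl⟩ : ∃ p : ℕ, n = -p := ⟨n.natAbs, by omega⟩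
  obtain ⟨-, hlast⟩ := h.ordGE_and_coeff_ne_zero (by omega) hn hqn (g + 1) le_rfl
  refine hlast (h.coeff_last_eq_zero ?_)
  have : (0 : ℤ) < p * (g + 1 : ℕ) := mul_pos (by omega) (by omega)
  omega

theorem ordGE (h : IsStationaryKdV (laurentDeriv K) q g f) :
    ∀ j ≤ g + 1, OrdGE (-(2 * j)) (f j) := by
  intro j
  induction j with
  | zero => simpa [h.zero] using OrdGE.one
  | succ j ih =>
    intro hj
    have hderiv := h.ordGE_potential.kdvOp (ih (by omega))
    rw [← h.succ j (by omega)] at hderiv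
    exact (hderiv.of_laurentDeriv (by omega)).mono (by omega)

theorem lead_recursion (h : IsStationaryKdV (laurentDeriv K) q g f) {j : ℕ} (hj : j ≤ g) :
    2 * ((j : K) + 1) * (f (j + 1)).coeff (-(2 * (j + 1 : ℕ))) =
      (2 * j + 1) * (j * (j + 1) + q.coeff (-2)) * (f j).coeff (-(2 * j)) := by
  have hcoeff := h.ordGE_potential.coeff_kdvOp (h.ordGE j (by omega))
  rw [← h.succ j hj, show -(2 * (j : ℤ)) - 3 = -(2 * (j + 1 : ℕ)) - 1 by push_cast; ring,
    coeff_laurentDeriv_sub_one] at hcoeff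
  push_cast at hcoeff ⊢
  linear_combination -hcoeff

theorem exists_coeff_neg_two_eq (h : IsStationaryKdV (laurentDeriv K) q g f) :
    ∃ s ≤ g, q.coeff (-2) = -((s : K) * (s + 1)) := by
  by_contra! hlead
  have hne : ∀ j ≤ g + 1, (f j).coeff (-(2 * j)) ≠ 0 := by
    intro j
    induction j with
    | zero => simp [h.zero]
    | succ j ih =>
      intro hj hzero
      have hrec := h.lead_recursion (Nat.le_of_succ_le_succ hj)
      rw [hzero, mul_zero] at hrec
      refine mul_ne_zero (mul_ne_zero ?_ fun hfactor => ?_) (ih (by omega)) hrec.symm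
      · exact_mod_cast (by omega : 2 * j + 1 ≠ 0)
      · exact hlead j (by omega) (by linear_combination hfactor)
  exact hne (g + 1) le_rfl (h.coeff_last_eq_zero (by omega))

section OddCoefficients

variable {m : ℕ}

theorem odd_coeff_eq_zero (h : IsStationaryKdV (laurentDeriv K) q g f)
    (hqm : ∀ i < 2 * (m : ℤ) - 1, i % 2 = 1 → q.coeff i = 0) :
    ∀ j ≤ g + 1, ∀ i < -(2 * j) + 2 * (m : ℤ) + 1, (i - -(2 * j)) % 2 = 1 → (f j).coeff i = 0 := by
  intro j
  induction j with
  | zero =>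
    intro _ i _ hi
    rw [h.zero, HahnSeries.coeff_one, if_neg (by omega)]
  | succ j ih =>
    intro hj i hi hi'
    obtain ⟨e, u, heu, he, hu, -⟩ := exists_kdvOp_eq_add h.ordGE_potential hqm
      (h.ordGE j (by omega)) (ih (by omega))
    refine coeff_eq_zero_of_coeff_laurentDeriv (by omega) ?_
    rw [h.succ j (by omega), heu, HahnSeries.coeff_add, he.coeff_eq_zero (by omega),
      hu.ordGE _ (by omega), add_zero]

theorem odd_recursion (h : IsStationaryKdV (laurentDeriv K) q g f)
    (hqm : ∀ i < 2 * (m : ℤ) - 1, i % 2 = 1 → q.coeff i = 0) {j : ℕ} (hj : j ≤ g) :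
    (2 * ((m : K) - j) - 1) * (f (j + 1)).coeff (-(2 * (j + 1 : ℕ)) + 2 * m + 1) =
      2 * (m - j) * ((m - j) ^ 2 - 1 / 4 + q.coeff (-2)) *
          (f j).coeff (-(2 * j) + 2 * m + 1) +
        q.coeff (2 * m - 1) * (f j).coeff (-(2 * j)) * (m - 1 / 2 - 2 * j) := by
  obtain ⟨e, u, heu, he, -, hcoeff⟩ := exists_kdvOp_eq_add h.ordGE_potential hqm
    (h.ordGE j (by omega)) (h.odd_coeff_eq_zero hqm j (by omega))
  have hderiv := coeff_laurentDeriv_sub_one (f (j + 1)) (-(2 * (j + 1 : ℕ)) + 2 * m + 1)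
  rw [h.succ j hj, heu, HahnSeries.coeff_add, he.coeff_eq_zero (by omega), zero_add,
    show -(2 * ((j + 1 : ℕ) : ℤ)) + 2 * m + 1 - 1 = -(2 * j) + 2 * m - 2 by push_cast; ring,
    hcoeff] at hderiv
  push_cast at hderiv ⊢
  linear_combination -hderiv

end OddCoefficients

/-- If `q` had a first odd coefficient `γ ≠ 0` of index `2 m - 1 < 2 s`, then the odd parts of the
`f j` would be nonzero multiples of `γ` for all `j > s`, so the recursion would never terminate. -/
theorem exists_localCond (h : IsStationaryKdV (laurentDeriv K) q g f) : ∃ s, LocalCond q s := by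
  obtain ⟨s, hsg, hlead⟩ := h.exists_coeff_neg_two_eq
  refine ⟨s, h.ordGE_potential, hlead, fun m => ?_⟩
  induction m using Nat.strong_induction_on with
  | _ m ih =>
    intro hms
    by_contra hγ
    have hqm : ∀ i < 2 * (m : ℤ) - 1, i % 2 = 1 → q.coeff i = 0 := by
      intro i hi hi'
      by_cases hi2 : i < -2
      · exact h.ordGE_potential i hi2
      · obtain ⟨k, rfl⟩ : ∃ k : ℕ, i = 2 * k - 1 := ⟨((i + 1) / 2).toNat, by omega⟩
        exact ih k (by omega) (by omega)
    set α : ℕ → K := fun j => (f j).coeff (-(2 * j)) with hα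
    have hα_rec : ∀ j ≤ g, 2 * ((j : K) + 1) * α (j + 1) =
        (2 * j + 1) * (j * (j + 1) - s * (s + 1)) * α j := by
      intro j hj
      rw [h.lead_recursion hj, hlead]
      ring
    have hα_sign := hasSign_of_lead_recursion (by simp [hα, h.zero])
      fun j hj => hα_rec j (by omega)
    set b : ℕ → K := fun j => (f j).coeff (-(2 * j) + 2 * m + 1)
    have hb_rec : ∀ j ≤ g, (2 * ((m : K) - j) - 1) * b (j + 1) =
        2 * (m - j) * ((m - j) ^ 2 - (s + 1 / 2) ^ 2) * b j +
          q.coeff (2 * m - 1) * α j * (m - 1 / 2 - 2 * j) := by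
      intro j hj
      rw [h.odd_recursion hqm hj, hlead]
      ring
    have hb_sign := hasSign_of_odd_recursion hγ hα_sign
      (fun j hj => hb_rec j (hj.trans hsg)) s hms le_rfl
    have hb_ne := ne_zero_of_odd_recursion hms (div_ne_zero_iff.1 hb_sign.ne_zero).1
      (fun j hj hjg => eq_zero_of_lead_recursion hα_rec j hj (by omega)) hb_rec g hsg le_rfl
    exact hb_ne (h.coeff_last_eq_zero (by omega))

end IsStationaryKdV

/-! ### Formal solutions for all energies force the local conditions -/

section IsFormalSolution

variable {K : Type*} [Field K] {q Y Z : K⸨X⸩} {E : K} {n : ℤ} {s : ℕ}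

/-- `Y` is a formal solution of `Y'' + q Y = E Y`. -/
def IsFormalSolution (q : K⸨X⸩) (E : K) (Y : K⸨X⸩) : Prop :=
  laurentDeriv K (laurentDeriv K Y) + q * Y = E • Y

namespace IsFormalSolution

theorem ordGE_neg_two (h : IsFormalSolution q E Y) (hY : Y ≠ 0) : OrdGE (-2) q := by
  by_contra hq2
  have hq0 : q ≠ 0 := by
    rintro rfl
    exact hq2 (OrdGE.zero _)
  obtain ⟨n, hn, hYn⟩ := exists_ordGE_coeff_ne_zero hY
  obtain ⟨p, hp, hqp⟩ := exists_ordGE_coeff_ne_zero hq0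
  have hp2 : p < -2 := not_le.1 fun hle => hq2 (hp.mono hle)
  have hcoeff := congrArg (HahnSeries.coeff · (p + n)) h
  simp only [HahnSeries.coeff_add, HahnSeries.coeff_smul] at hcoeff
  rw [hp.coeff_mul hn, hn.laurentDeriv.laurentDeriv (p + n) (by omega), hn (p + n) (by omega),
    smul_zero, zero_add] at hcoeff
  exact mul_ne_zero hqp hYn hcoeff

theorem indicial (h : IsFormalSolution q E Y) (hq : OrdGE (-2) q) (hn : OrdGE n Y)
    (hYn : Y.coeff n ≠ 0) : q.coeff (-2) = -((n : K) * (n - 1)) := by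
  have hcoeff := congrArg (HahnSeries.coeff · (-2 + n)) h
  simp only [HahnSeries.coeff_add, HahnSeries.coeff_smul] at hcoeff
  rw [hq.coeff_mul hn, hn (-2 + n) (by omega), smul_zero, show -2 + n = n - 1 - 1 by ring,
    coeff_laurentDeriv_sub_one, coeff_laurentDeriv_sub_one] at hcoeff
  push_cast at hcoeff
  refine mul_right_cancel₀ hYn ?_
  linear_combination hcoeff

theorem smul_add_smul (hY : IsFormalSolution q E Y) (hZ : IsFormalSolution q E Z) (a b : K) :
    IsFormalSolution q E (a • Y + b • Z) := by
  unfold IsFormalSolution at *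
  simp only [map_add, Derivation.map_smul, mul_add, mul_smul_comm]
  rw [add_add_add_comm, ← smul_add, ← smul_add, hY, hZ, smul_add, smul_comm E a, smul_comm E b]

theorem exists_normalized (h : IsFormalSolution q E Y) (hn : OrdGE n Y) (hYn : Y.coeff n ≠ 0)
    (hn0 : n ≤ 0) :
    ∃ (s : ℕ) (W : K⸨X⸩), IsFormalSolution q E W ∧ OrdGE (-s) W ∧ W.coeff (-s) = 1 := by
  obtain ⟨s, rfl⟩ : ∃ s : ℕ, n = -s := ⟨n.natAbs, by omega⟩
  refine ⟨s, (Y.coeff (-s))⁻¹ • Y, ?_, hn.smul _, ?_⟩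
  · simpa using h.smul_add_smul h (Y.coeff (-s))⁻¹ 0
  · rw [HahnSeries.coeff_smul, smul_eq_mul, inv_mul_cancel₀ hYn]

theorem exists_ordGE_ne (hY : IsFormalSolution q E Y) (hZ : IsFormalSolution q E Z)
    (hYZ : LinearIndependent K ![Y, Z]) (n : ℤ) :
    ∃ m W, IsFormalSolution q E W ∧ OrdGE m W ∧ W.coeff m ≠ 0 ∧ m ≠ n := by
  rw [LinearIndependent.pair_iff] at hYZ
  have hZ0 : Z ≠ 0 := by
    rintro rfl
    exact one_ne_zero (hYZ 0 1 (by simp)).2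
  obtain ⟨k, hk, hZk⟩ := exists_ordGE_coeff_ne_zero hZ0
  by_cases hkn : k = n
  · subst hkn
    have hW0 : Z.coeff k • Y + (-Y.coeff k) • Z ≠ 0 := fun h => hZk (hYZ _ _ h).1
    obtain ⟨m, hm, hWm⟩ := exists_ordGE_coeff_ne_zero hW0
    refine ⟨m, _, hY.smul_add_smul hZ _ _, hm, hWm, ?_⟩
    rintro rfl
    refine hWm ?_
    rw [HahnSeries.coeff_add, HahnSeries.coeff_smul, HahnSeries.coeff_smul, smul_eq_mul,
      smul_eq_mul]
    ring
  · exact ⟨k, Z, hZ, hk, hZk, hkn⟩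

theorem recursion (h : IsFormalSolution q E Y) (hq : OrdGE (-2) q)
    (hlead : q.coeff (-2) = -((s : K) * (s + 1))) (hY : OrdGE (-s) Y) (p : ℕ) :
    (p : K) * (p - 2 * s - 1) * Y.coeff (-s + p) +
      ∑ l ∈ Finset.range p, q.coeff (-2 + (l + 1 : ℕ)) * Y.coeff (-s + (p - 1 - l : ℕ)) =
        if 2 ≤ p then E * Y.coeff (-s + (p - 2 : ℕ)) else 0 := by
  have hcoeff := congrArg (HahnSeries.coeff · (-2 + -(s : ℤ) + p)) h
  simp only [HahnSeries.coeff_add, HahnSeries.coeff_smul, smul_eq_mul] at hcoeff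
  rw [hq.coeff_mul_eq_sum_range hY, Finset.sum_range_succ'] at hcoeff
  have hsecond : (laurentDeriv K (laurentDeriv K Y)).coeff (-2 + -s + p) =
      ((p : K) - s) * (p - s - 1) * Y.coeff (-s + p) := by
    rw [show -2 + -(s : ℤ) + p = (-s + p) - 1 - 1 by ring, coeff_laurentDeriv_sub_one,
      coeff_laurentDeriv_sub_one]
    push_cast
    ring
  have hright : E * Y.coeff (-2 + -(s : ℤ) + p) =
      if 2 ≤ p then E * Y.coeff (-s + (p - 2 : ℕ)) else 0 := by
    split_ifs
    · congr 2
      omega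
    · rw [hY _ (by omega), mul_zero]
  rw [hsecond, hright] at hcoeff
  simp only [Nat.cast_zero, add_zero, Nat.sub_zero, hlead, ← Nat.sub_sub, Nat.sub_right_comm p _ 1]
    at hcoeff ⊢
  rw [← hcoeff]
  ring

end IsFormalSolution

theorem exists_normalized_formalSolution [CharZero K] (hY : IsFormalSolution q E Y)
    (hZ : IsFormalSolution q E Z) (hYZ : LinearIndependent K ![Y, Z]) :
    OrdGE (-2) q ∧ ∃ (s : ℕ) (W : K⸨X⸩), q.coeff (-2) = -((s : K) * (s + 1)) ∧
      IsFormalSolution q E W ∧ OrdGE (-s) W ∧ W.coeff (-s) = 1 := by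
  have hY0 : Y ≠ 0 := hYZ.ne_zero 0
  have hq := hY.ordGE_neg_two hY0
  refine ⟨hq, ?_⟩
  suffices ∃ (s : ℕ) (W : K⸨X⸩), IsFormalSolution q E W ∧ OrdGE (-s) W ∧ W.coeff (-s) = 1 by
    obtain ⟨s, W, hW, hs, hWs⟩ := this
    refine ⟨s, W, ?_, hW, hs, hWs⟩
    rw [hW.indicial hq hs (hWs ▸ one_ne_zero)]
    push_cast
    ring
  obtain ⟨n, hn, hYn⟩ := exists_ordGE_coeff_ne_zero hY0
  obtain ⟨m, W, hW, hm, hWm, hmn⟩ := hY.exists_ordGE_ne hZ hYZ n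
  have hsum : m + n = 1 := by
    have hfactor : ((m : K) - n) * (m + n - 1) = 0 := by
      linear_combination hW.indicial hq hm hWm - hY.indicial hq hn hYn
    have hfactor' : (m - n) * (m + n - 1) = 0 := by exact_mod_cast hfactor
    rcases mul_eq_zero.1 hfactor' with h | h <;> omega
  rcases le_or_gt n 0 with h | h
  · exact hY.exists_normalized hn hYn h
  · exact hW.exists_normalized hm hWm (by omega)

end IsFormalSolution

section Frobenius

variable {K : Type*} [Field K] {q : K⸨X⸩} {s m : ℕ} {γ : ℕ → K} {P : ℕ → K[X]}

/-- The Frobenius recursion for the coefficients of a solution `t⁻ˢ (P 0 + P 1 t + ⋯)` of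
`Y'' + q Y = E Y` up to its resonance `p = 2 s + 1`, with the energy `E` as polynomial variable;
`γ i` is the coefficient of `q` of index `i - 2`. -/
structure IsFrobeniusFamily (s : ℕ) (γ : ℕ → K) (P : ℕ → K[X]) : Prop where
  zero : P 0 = 1
  recursion : ∀ p ≤ 2 * s + 1,
    Polynomial.C ((p : K) * (p - 2 * s - 1)) * P p +
      ∑ l ∈ Finset.range p, Polynomial.C (γ (l + 1)) * P (p - 1 - l) =
        if 2 ≤ p then Polynomial.X * P (p - 2) else 0

theorem frobenius_factor_ne_zero [CharZero K] {p : ℕ} (hp : p ≠ 0) (hps : p ≤ 2 * s) :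
    (p : K) * (p - 2 * s - 1) ≠ 0 := by
  have : (p : ℤ) * (p - 2 * s - 1) ≠ 0 := mul_ne_zero (by omega) (by omega)
  exact_mod_cast this

theorem exists_eval_eq_of_recursion [CharZero K] {y : K → ℕ → K} (h0 : ∀ E, y E 0 = 1)
    (hy : ∀ E (p : ℕ), (p : K) * (p - 2 * s - 1) * y E p +
      ∑ l ∈ Finset.range p, γ (l + 1) * y E (p - 1 - l) = if 2 ≤ p then E * y E (p - 2) else 0) :
    ∀ p ≤ 2 * s, ∃ P : K[X], ∀ E, P.eval E = y E p := by
  intro p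
  induction p using Nat.strong_induction_on with
  | _ p ih =>
    intro hps
    rcases eq_or_ne p 0 with rfl | hp
    · exact ⟨1, fun E => by rw [Polynomial.eval_one, h0]⟩
    choose! P hP using fun l (hl : l < p) => ih l hl (by omega)
    refine ⟨Polynomial.C ((p : K) * (p - 2 * s - 1))⁻¹ *
      ((if 2 ≤ p then Polynomial.X * P (p - 2) else 0) -
        ∑ l ∈ Finset.range p, Polynomial.C (γ (l + 1)) * P (p - 1 - l)), fun E => ?_⟩
    have hsum : ∑ l ∈ Finset.range p, (Polynomial.C (γ (l + 1)) * P (p - 1 - l)).eval E =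
        ∑ l ∈ Finset.range p, γ (l + 1) * y E (p - 1 - l) :=
      Finset.sum_congr rfl fun l _ => by
        rw [Polynomial.eval_mul, Polynomial.eval_C, hP _ (by omega)]
    have hite : (if 2 ≤ p then Polynomial.X * P (p - 2) else 0).eval E =
        if 2 ≤ p then E * y E (p - 2) else 0 := by
      split_ifs
      · rw [Polynomial.eval_mul, Polynomial.eval_X, hP _ (by omega)]
      · exact Polynomial.eval_zero
    rw [Polynomial.eval_mul, Polynomial.eval_C,
      inv_mul_eq_iff_eq_mul₀ (frobenius_factor_ne_zero hp hps), Polynomial.eval_sub,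
      Polynomial.eval_finsetSum, hsum, hite, sub_eq_iff_eq_add, hy]

theorem exists_isFrobeniusFamily [CharZero K] {y : K → ℕ → K} (h0 : ∀ E, y E 0 = 1)
    (hy : ∀ E (p : ℕ), (p : K) * (p - 2 * s - 1) * y E p +
      ∑ l ∈ Finset.range p, γ (l + 1) * y E (p - 1 - l) = if 2 ≤ p then E * y E (p - 2) else 0) :
    ∃ P, IsFrobeniusFamily s γ P := by
  choose! P hP using exists_eval_eq_of_recursion h0 hy
  refine ⟨P, Polynomial.funext fun E => by rw [hP 0 (by omega), h0, Polynomial.eval_one],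
    fun p hp => Polynomial.funext fun E => ?_⟩
  have hlead : (p : K) * (p - 2 * s - 1) * (P p).eval E = p * (p - 2 * s - 1) * y E p := by
    rcases hp.lt_or_eq with h | rfl
    · rw [hP p (by omega)]
    · push_cast
      ring
  have hsum : ∑ l ∈ Finset.range p, (Polynomial.C (γ (l + 1)) * P (p - 1 - l)).eval E =
      ∑ l ∈ Finset.range p, γ (l + 1) * y E (p - 1 - l) :=
    Finset.sum_congr rfl fun l hl => by
      rw [Finset.mem_range] at hl
      rw [Polynomial.eval_mul, Polynomial.eval_C, hP _ (by omega)]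
  rw [Polynomial.eval_add, Polynomial.eval_finsetSum, hsum, Polynomial.eval_mul, Polynomial.eval_C,
    hlead, hy]
  split_ifs
  · rw [Polynomial.eval_mul, Polynomial.eval_X, hP _ (by omega)]
  · rw [Polynomial.eval_zero]

namespace IsFrobeniusFamily

theorem coeff_recursion (h : IsFrobeniusFamily s γ P) {p : ℕ} (hp : p ≤ 2 * s + 1) (k : ℕ) :
    (p : K) * (p - 2 * s - 1) * (P p).coeff k +
      ∑ l ∈ Finset.range p, γ (l + 1) * (P (p - 1 - l)).coeff k =
        if 2 ≤ p then (Polynomial.X * P (p - 2)).coeff k else 0 := by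
  have hcoeff := congrArg (Polynomial.coeff · k) (h.recursion p hp)
  simpa only [Polynomial.coeff_add, Polynomial.coeff_C_mul, Polynomial.finsetSum_coeff,
    apply_ite (Polynomial.coeff · k), Polynomial.coeff_zero] using hcoeff

variable [CharZero K]

/-- `P (2 i)` has degree at most `i`, and `P (2 m + 1 + 2 i)` has degree at most `i`, when `γ` has
no nonzero odd coefficient of index below `2 m + 1`. -/
theorem coeff_eq_zero (h : IsFrobeniusFamily s γ P) (hγ : ∀ i < m, γ (2 * i + 1) = 0) {k : ℕ} :
    ∀ p ≤ 2 * s, (p % 2 = 0 ∧ p < 2 * k ∨ p % 2 = 1 ∧ p < 2 * k + 2 * m + 1) →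
      (P p).coeff k = 0 := by
  intro p
  induction p using Nat.strong_induction_on generalizing k with
  | _ p ih =>
    intro hp hpk
    rcases eq_or_ne p 0 with rfl | hp0
    · rw [h.zero, Polynomial.coeff_one, if_neg (by omega)]
    have hsum : ∑ l ∈ Finset.range p, γ (l + 1) * (P (p - 1 - l)).coeff k = 0 := by
      refine Finset.sum_eq_zero fun l hl => ?_
      rw [Finset.mem_range] at hl
      by_cases hr : (p - 1 - l) % 2 = 0 ∧ 2 * k ≤ p - 1 - l
      · obtain ⟨i, rfl⟩ : ∃ i, l = 2 * i := ⟨l / 2, by omega⟩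
        rw [hγ i (by omega), zero_mul]
      · rw [ih _ (by omega) (by omega) (by omega), mul_zero]
    have hright : (if 2 ≤ p then (Polynomial.X * P (p - 2)).coeff k else 0) = 0 := by
      split_ifs
      · cases k with
        | zero => exact Polynomial.coeff_X_mul_zero _
        | succ k => rw [Polynomial.coeff_X_mul, ih _ (by omega) (by omega) (by omega)]
      · rfl
    have hrec := h.coeff_recursion (p := p) (by omega) k
    rw [hsum, hright, add_zero] at hrec
    exact (mul_eq_zero.1 hrec).resolve_left (frobenius_factor_ne_zero hp0 hp)

theorem hasSign_even (h : IsFrobeniusFamily s γ P) :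
    ∀ k ≤ s, HasSign k ((P (2 * k)).coeff k) := by
  intro k
  induction k with
  | zero =>
    intro _
    rw [Nat.mul_zero, h.zero, Polynomial.coeff_one_zero]
    exact HasSign.one
  | succ k ih =>
    intro hk
    have hrec := h.coeff_recursion (p := 2 * (k + 1)) (by omega) (k + 1)
    rw [Finset.sum_eq_zero fun l _ => by
        rw [h.coeff_eq_zero (m := 0) (by simp) _ (by omega) (by omega), mul_zero],
      if_pos (by omega), show 2 * (k + 1) - 2 = 2 * k by omega, Polynomial.coeff_X_mul] at hrec
    have hfactor : (0 : ℚ) < 2 * (k + 1) * (2 * s - 2 * k - 1) := by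
      have : (k : ℚ) + 1 ≤ s := mod_cast hk
      exact mul_pos (by positivity) (by linarith)
    refine HasSign.of_ratCast_mul hfactor ?_
    convert (ih (by omega)).neg using 1
    rw [← hrec]
    push_cast
    ring

theorem odd_recursion (h : IsFrobeniusFamily s γ P) (hγ : ∀ i < m, γ (2 * i + 1) = 0) {k : ℕ}
    (hk : k + m ≤ s) :
    (2 * (k : K) + 2 * m + 1) * (2 * k + 2 * m - 2 * s) * (P (2 * k + 2 * m + 1)).coeff k +
      γ (2 * m + 1) * (P (2 * k)).coeff k =
        (Polynomial.X * P (2 * (k - 1) + 2 * m + 1)).coeff k := by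
  have hrec := h.coeff_recursion (p := 2 * k + 2 * m + 1) (by omega) k
  rw [Finset.sum_eq_single (2 * m) ?_ (by simp)] at hrec
  · rw [show 2 * k + 2 * m + 1 - 1 - 2 * m = 2 * k by omega] at hrec
    have hright : (if 2 ≤ 2 * k + 2 * m + 1 then
        (Polynomial.X * P (2 * k + 2 * m + 1 - 2)).coeff k else 0) =
        (Polynomial.X * P (2 * (k - 1) + 2 * m + 1)).coeff k := by
      cases k with
      | zero => simp only [Polynomial.coeff_X_mul_zero, ite_self]
      | succ k =>
        rw [if_pos (by omega)]
        congr 3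
        omega
    rw [← hright, ← hrec]
    push_cast
    ring
  · intro l hl hlm
    rw [Finset.mem_range] at hl
    by_cases hr : (2 * k + 2 * m + 1 - 1 - l) % 2 = 0 ∧ 2 * k ≤ 2 * k + 2 * m + 1 - 1 - l
    · obtain ⟨i, rfl⟩ : ∃ i, l = 2 * i := ⟨l / 2, by omega⟩
      rw [hγ i (by omega), zero_mul]
    · rw [h.coeff_eq_zero hγ _ (by omega) (by omega), mul_zero]

theorem hasSign_odd (h : IsFrobeniusFamily s γ P) (hγ : ∀ i < m, γ (2 * i + 1) = 0)
    (hγm : γ (2 * m + 1) ≠ 0) {k : ℕ} (hk : k + m ≤ s) :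
    HasSign k (((2 * k + 2 * m + 1) * (2 * s - 2 * k - 2 * m) : ℚ) *
      ((P (2 * k + 2 * m + 1)).coeff k / γ (2 * m + 1))) := by
  have hrec := h.odd_recursion hγ hk
  induction k with
  | zero =>
    rw [Polynomial.coeff_X_mul_zero] at hrec
    convert h.hasSign_even 0 (by omega) using 1
    push_cast at hrec ⊢
    field_simp
    linear_combination -hrec
  | succ k ih =>
    have hfactor : (0 : ℚ) < (2 * k + 2 * m + 1) * (2 * s - 2 * k - 2 * m) := by
      have : (k : ℚ) + 1 + m ≤ s := mod_cast hk
      exact mul_pos (by positivity) (by linarith)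
    have hprev := (HasSign.of_ratCast_mul hfactor
      (ih (by omega) (h.odd_recursion hγ (by omega)))).neg
    convert (h.hasSign_even (k + 1) (by omega)).add hprev using 1
    rw [Polynomial.coeff_X_mul, Nat.add_sub_cancel] at hrec
    push_cast at hrec ⊢
    field_simp
    linear_combination -hrec

theorem odd_eq_zero (h : IsFrobeniusFamily s γ P) (hm : m ≤ s) : γ (2 * m + 1) = 0 := by
  induction m using Nat.strong_induction_on with
  | _ m ih =>
    by_contra hγm
    -- The resonance `2 s + 1` belongs to `k = s - m`, where the left side vanishes.
    refine (h.hasSign_odd (fun i hi => ih i hi (by omega)) hγm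
      (show s - m + m ≤ s by omega)).ne_zero ?_
    push_cast [Nat.cast_sub hm]
    ring

end IsFrobeniusFamily

theorem localCond_of_isFormalSolution [CharZero K]
    (hsol : ∀ E, ∃ Y Z, IsFormalSolution q E Y ∧ IsFormalSolution q E Z ∧
      LinearIndependent K ![Y, Z]) : ∃ s, LocalCond q s := by
  choose Y Z hY hZ hYZ using hsol
  choose hq r W hlead hW hWr hW1 using fun E =>
    exists_normalized_formalSolution (hY E) (hZ E) (hYZ E)
  have hr (E : K) : r E = r 0 := by
    have : (r E : K) * (r E + 1) = r 0 * (r 0 + 1) := neg_injective ((hlead E).symm.trans (hlead 0))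
    have : r E * (r E + 1) = r 0 * (r 0 + 1) := mod_cast this
    nlinarith
  have hrec (E : K) (p : ℕ) := (hW E).recursion (hq E) (hlead E) (hWr E) p
  simp only [hr] at hrec
  obtain ⟨P, hP⟩ := exists_isFrobeniusFamily (s := r 0) (γ := fun i => q.coeff (-2 + i))
    (y := fun E p => (W E).coeff (-r 0 + p)) (fun E => by simpa [hr] using hW1 E) hrec
  refine ⟨r 0, hq 0, hlead 0, fun m hm => ?_⟩
  have hodd := hP.odd_eq_zero hm
  convert hodd using 2
  push_cast
  ring

end Frobenius

/-! ### Laurent expansions of rational functions -/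

section Expansions

variable {K : Type*} [Field K]

theorem OrdGE.inv {f : K⸨X⸩} {n : ℤ} (hf : OrdGE n f) (hn : f.coeff n ≠ 0) :
    OrdGE (-n) f⁻¹ ∧ f⁻¹.coeff (-n) = (f.coeff n)⁻¹ := by
  have hf0 : f ≠ 0 := fun h => hn (by rw [h, HahnSeries.coeff_zero])
  have hmul : f * f⁻¹ = 1 := mul_inv_cancel₀ hf0
  have hinv : OrdGE (-n) f⁻¹ := hf.of_mul hn (by rw [hmul, add_neg_cancel]; exact OrdGE.one)
  refine ⟨hinv, eq_inv_of_mul_eq_one_right ?_⟩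
  rw [← hf.coeff_mul hinv, hmul, add_neg_cancel, HahnSeries.coeff_one, if_pos rfl]

theorem ordGE_ofPowerSeries (p : PowerSeries K) : OrdGE 0 (HahnSeries.ofPowerSeries ℤ K p) := by
  intro i hi
  rw [HahnSeries.ofPowerSeries_apply, HahnSeries.embDomain_of_notMem_range]
  rintro ⟨n, rfl⟩
  exact absurd hi (by simp)

theorem coeff_aeval_single {e : ℤ} (he : e ≠ 0) (p : K[X]) (i : ℕ) :
    (Polynomial.aeval (HahnSeries.single e (1 : K)) p).coeff (e * i) = p.coeff i := by
  induction p using Polynomial.induction_on' with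
  | add p q hp hq => rw [map_add, HahnSeries.coeff_add, hp, hq, Polynomial.coeff_add]
  | monomial n a =>
    rw [Polynomial.aeval_monomial, HahnSeries.single_pow, ← Algebra.smul_def,
      HahnSeries.coeff_smul, one_pow, Polynomial.coeff_monomial, nsmul_eq_mul, mul_comm (n : ℤ),
      HahnSeries.coeff_single]
    simp [mul_right_inj' he, eq_comm]

theorem coeff_aeval_single_of_ne {e n : ℤ} (p : K[X]) (hn : ∀ i : ℕ, n ≠ e * i) :
    (Polynomial.aeval (HahnSeries.single e (1 : K)) p).coeff n = 0 := by
  induction p using Polynomial.induction_on' with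
  | add p q hp hq => rw [map_add, HahnSeries.coeff_add, hp, hq, add_zero]
  | monomial i a =>
    rw [Polynomial.aeval_monomial, HahnSeries.single_pow, ← Algebra.smul_def,
      HahnSeries.coeff_smul, nsmul_eq_mul, mul_comm, HahnSeries.coeff_single_of_ne (hn i),
      smul_zero]

theorem aeval_single_injective {e : ℤ} (he : e ≠ 0) :
    Function.Injective (Polynomial.aeval (R := K) (HahnSeries.single e (1 : K))) :=
  (injective_iff_map_eq_zero _).2 fun p hp => Polynomial.ext fun i => by
    rw [← coeff_aeval_single he, hp, HahnSeries.coeff_zero, Polynomial.coeff_zero]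

theorem aeval_single_one_add_C (α : K) (p : K[X]) :
    Polynomial.aeval (HahnSeries.single 1 1 + HahnSeries.C α : K⸨X⸩) p =
      Polynomial.aeval (HahnSeries.single (1 : ℤ) (1 : K)) (Polynomial.taylor α p) := by
  rw [Polynomial.taylor_apply, Polynomial.aeval_comp, map_add, Polynomial.aeval_X,
    Polynomial.aeval_C]
  rfl

/-- The Laurent expansion of a rational function at `α`, in powers of `z - α`. -/
def laurentAt (α : K) : RatFunc K →ₐ[K] K⸨X⸩ :=
  RatFunc.liftAlgHom (Polynomial.aeval (HahnSeries.single 1 1 + HahnSeries.C α)) <|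
    nonZeroDivisors_le_comap_nonZeroDivisors_of_injective _ fun p p' h => by
      rw [aeval_single_one_add_C, aeval_single_one_add_C] at h
      exact Polynomial.taylor_injective α (aeval_single_injective one_ne_zero h)

/-- The Laurent expansion of a rational function at infinity, in powers of `1 / z`. -/
def laurentInfty : RatFunc K →ₐ[K] K⸨X⸩ :=
  RatFunc.liftAlgHom (Polynomial.aeval (HahnSeries.single (-1) 1)) <|
    nonZeroDivisors_le_comap_nonZeroDivisors_of_injective _ (aeval_single_injective (by norm_num))

theorem laurentAt_algebraMap (α : K) (p : K[X]) :
    laurentAt α (algebraMap K[X] (RatFunc K) p) =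
      Polynomial.aeval (HahnSeries.single 1 1 + HahnSeries.C α) p := by
  rw [laurentAt, RatFunc.liftAlgHom_apply, RatFunc.num_algebraMap, RatFunc.denom_algebraMap,
    map_one (Polynomial.aeval _), div_one]

theorem laurentInfty_algebraMap (p : K[X]) :
    laurentInfty (algebraMap K[X] (RatFunc K) p) =
      Polynomial.aeval (HahnSeries.single (-1) 1) p := by
  rw [laurentInfty, RatFunc.liftAlgHom_apply, RatFunc.num_algebraMap, RatFunc.denom_algebraMap,
    map_one (Polynomial.aeval _), div_one]

theorem laurentAt_C (α c : K) : laurentAt α (RatFunc.C c) = HahnSeries.C c :=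
  (laurentAt α).commutes c

theorem laurentInfty_C (c : K) : laurentInfty (RatFunc.C c) = HahnSeries.C c :=
  laurentInfty.commutes c

theorem laurentAt_X (α : K) :
    laurentAt α RatFunc.X = HahnSeries.single 1 1 + HahnSeries.C α := by
  rw [← RatFunc.algebraMap_X, laurentAt_algebraMap, Polynomial.aeval_X]

theorem laurentInfty_X : laurentInfty (RatFunc.X : RatFunc K) = HahnSeries.single (-1) 1 := by
  rw [← RatFunc.algebraMap_X, laurentInfty_algebraMap, Polynomial.aeval_X]

theorem coeff_laurentAt_algebraMap (α : K) (p : K[X]) (n : ℕ) :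
    (laurentAt α (algebraMap K[X] (RatFunc K) p)).coeff n = (Polynomial.taylor α p).coeff n := by
  rw [laurentAt_algebraMap, aeval_single_one_add_C, ← coeff_aeval_single one_ne_zero, one_mul]

theorem coeff_zero_laurentAt_algebraMap (α : K) (p : K[X]) :
    (laurentAt α (algebraMap K[X] (RatFunc K) p)).coeff 0 = p.eval α := by
  simpa using coeff_laurentAt_algebraMap α p 0

theorem ordGE_laurentAt_algebraMap (α : K) (p : K[X]) :
    OrdGE 0 (laurentAt α (algebraMap K[X] (RatFunc K) p)) := fun i hi => by
  rw [laurentAt_algebraMap, aeval_single_one_add_C, coeff_aeval_single_of_ne _ fun j => by omega]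

theorem coeff_laurentInfty_algebraMap (p : K[X]) (n : ℕ) :
    (laurentInfty (algebraMap K[X] (RatFunc K) p)).coeff (-n) = p.coeff n := by
  rw [laurentInfty_algebraMap, ← coeff_aeval_single (e := -1) (by norm_num), neg_one_mul]

theorem ordGE_laurentInfty_algebraMap {p : K[X]} {n : ℕ} (hp : p.natDegree ≤ n) :
    OrdGE (-n) (laurentInfty (algebraMap K[X] (RatFunc K) p)) := by
  intro i hi
  obtain ⟨j, rfl⟩ : ∃ j : ℕ, i = -j := ⟨(-i).toNat, by omega⟩
  rw [coeff_laurentInfty_algebraMap, Polynomial.coeff_eq_zero_of_natDegree_lt (by omega)]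

theorem ordGE_laurentAt_iff {f : RatFunc K} {α : K} :
    OrdGE 0 (laurentAt α f) ↔ f.denom.eval α ≠ 0 := by
  have hdenom : algebraMap K[X] (RatFunc K) f.denom ≠ 0 :=
    RatFunc.algebraMap_ne_zero f.denom_ne_zero
  constructor
  · intro h hα
    have hnum : f.num.eval α = 0 := by
      have hmul := h.coeff_mul (ordGE_laurentAt_algebraMap α f.denom)
      rwa [← map_mul, (eq_div_iff hdenom).1 (RatFunc.num_div_denom f).symm, add_zero,
        coeff_zero_laurentAt_algebraMap, coeff_zero_laurentAt_algebraMap, hα, mul_zero] at hmul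
    obtain ⟨a, b, hab⟩ := f.isCoprime_num_denom
    simpa [hnum, hα] using congrArg (Polynomial.eval α) hab
  · intro hα
    rw [← coeff_zero_laurentAt_algebraMap] at hα
    rw [← RatFunc.num_div_denom f, map_div₀, div_eq_mul_inv]
    simpa using (ordGE_laurentAt_algebraMap α f.num).mul
      ((ordGE_laurentAt_algebraMap α f.denom).inv hα).1

theorem exists_polynomial_of_ordGE [IsAlgClosed K] {f : RatFunc K}
    (h : ∀ α, OrdGE 0 (laurentAt α f)) : ∃ p : K[X], f = algebraMap K[X] (RatFunc K) p := by
  have hdegree : f.denom.degree = 0 := by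
    by_contra hne
    obtain ⟨α, hα⟩ := IsAlgClosed.exists_root f.denom hne
    exact ordGE_laurentAt_iff.1 (h α) hα
  refine ⟨f.num, ?_⟩
  conv_lhs => rw [← RatFunc.num_div_denom f, f.monic_denom.degree_le_zero_iff_eq_one.1 hdegree.le,
    map_one, div_one]

theorem laurentDeriv_laurentAt_X (α : K) : laurentDeriv K (laurentAt α RatFunc.X) = 1 := by
  rw [laurentAt_X, map_add, show HahnSeries.C α = algebraMap K K⸨X⸩ α from rfl,
    Derivation.map_algebraMap, add_zero]
  ext n
  rw [coeff_laurentDeriv, HahnSeries.coeff_one, HahnSeries.coeff_single]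
  by_cases hn : n = 0 <;> simp [hn]

end Expansions

/-! ### Rational functions as a differential algebra -/

section RatDerivation

/-- The derivation `d/dz` in the coordinate `t = 1 / z`. -/
def inftyDeriv (K : Type*) [Field K] : Derivation K K⸨X⸩ K⸨X⸩ :=
  (HahnSeries.single 2 (-1) : K⸨X⸩) • laurentDeriv K

theorem coeff_inftyDeriv {K : Type*} [Field K] (f : K⸨X⸩) (n : ℤ) :
    (inftyDeriv K f).coeff (n + 1) = -n * f.coeff n := by
  have hcoeff := HahnSeries.coeff_single_mul_add (r := (-1 : K)) (x := laurentDeriv K f)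
    (a := n - 1) (b := (2 : ℤ))
  rw [coeff_laurentDeriv_sub_one, show n - 1 + 2 = n + 1 by ring] at hcoeff
  rw [inftyDeriv, Derivation.smul_apply, smul_eq_mul, hcoeff, neg_one_mul, neg_mul]

protected theorem OrdGE.inftyDeriv {K : Type*} [Field K] {f : K⸨X⸩} {n : ℤ} (hf : OrdGE n f) :
    OrdGE (n + 1) (inftyDeriv K f) := fun i hi => by
  have hcoeff := coeff_inftyDeriv f (i - 1)
  rwa [sub_add_cancel, hf _ (by omega), mul_zero] at hcoeff

theorem map_ratDeriv_of_derivation {L : Type*} [Field L] [Algebra ℂ L]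
    (φ : RatFunc ℂ →ₐ[ℂ] L) (D : Derivation ℂ L L) (hX : D (φ RatFunc.X) = 1) (f : RatFunc ℂ) :
    φ (ratDeriv f) = D (φ f) := by
  have hpoly (p : ℂ[X]) : φ (algebraMap ℂ[X] (RatFunc ℂ) p) = Polynomial.aeval (φ RatFunc.X) p := by
    rw [Polynomial.aeval_algHom_apply, ← RatFunc.algebraMap_X, Polynomial.aeval_algebraMap_apply,
      Polynomial.aeval_X_left_apply]
  have hderiv (p : ℂ[X]) : D (Polynomial.aeval (φ RatFunc.X) p) =
      Polynomial.aeval (φ RatFunc.X) (Polynomial.derivative p) := by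
    rw [Derivation.map_aeval, hX, smul_eq_mul, mul_one]
  conv_rhs => rw [← RatFunc.num_div_denom f, map_div₀, hpoly, hpoly, Derivation.leibniz_div,
    hderiv, hderiv, smul_eq_mul, smul_eq_mul, smul_eq_mul]
  rw [ratDeriv, map_div₀, hpoly, hpoly, map_sub, map_mul, map_mul, map_pow]
  ring

theorem laurentAt_ratDeriv (α : ℂ) (f : RatFunc ℂ) :
    laurentAt α (ratDeriv f) = laurentDeriv ℂ (laurentAt α f) :=
  map_ratDeriv_of_derivation _ _ (laurentDeriv_laurentAt_X α) f

theorem laurentInfty_ratDeriv (f : RatFunc ℂ) :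
    laurentInfty (ratDeriv f) = inftyDeriv ℂ (laurentInfty f) := by
  refine map_ratDeriv_of_derivation _ _ ?_ f
  rw [laurentInfty_X]
  ext n
  obtain ⟨n, rfl⟩ : ∃ m, n = m + 1 := ⟨n - 1, by ring⟩
  rw [coeff_inftyDeriv, HahnSeries.coeff_one, HahnSeries.coeff_single]
  by_cases hn : n = -1
  · simp [hn]
  · rw [if_neg hn, if_neg (by omega), mul_zero]

theorem laurentAt_injective {K : Type*} [Field K] (α : K) : Function.Injective (laurentAt α) :=
  (laurentAt α).toRingHom.injective

/-- `ratDeriv` as a derivation. -/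
def ratDerivation : Derivation ℂ (RatFunc ℂ) (RatFunc ℂ) :=
  Derivation.mk'
    { toFun := ratDeriv
      map_add' := fun f g => laurentAt_injective 0 (by simp only [map_add, laurentAt_ratDeriv])
      map_smul' := fun c f => laurentAt_injective 0 (by
        rw [map_smul, laurentAt_ratDeriv, laurentAt_ratDeriv, map_smul, Derivation.map_smul]
        rfl) }
    fun f g => laurentAt_injective 0 (by
      simp only [LinearMap.coe_mk, AddHom.coe_mk, smul_eq_mul, map_add, map_mul,
        laurentAt_ratDeriv, Derivation.leibniz])

theorem laurentAt_ratDerivation (α : ℂ) (f : RatFunc ℂ) :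
    laurentAt α (ratDerivation f) = laurentDeriv ℂ (laurentAt α f) := laurentAt_ratDeriv α f

theorem laurentInfty_ratDerivation (f : RatFunc ℂ) :
    laurentInfty (ratDerivation f) = inftyDeriv ℂ (laurentInfty f) := laurentInfty_ratDeriv f

theorem exists_eq_C_of_ratDerivation_eq_zero {f : RatFunc ℂ} (h : ratDerivation f = 0) :
    ∃ c, f = RatFunc.C c := by
  refine ⟨(laurentAt 0 f).coeff 0, laurentAt_injective 0 (HahnSeries.ext (funext fun n => ?_))⟩
  rw [laurentAt_C]
  rcases eq_or_ne n 0 with rfl | hn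
  · exact (HahnSeries.coeff_single_same 0 _).symm
  · rw [HahnSeries.C_apply, HahnSeries.coeff_single_of_ne hn,
      coeff_eq_zero_of_coeff_laurentDeriv hn (by
        rw [← laurentAt_ratDerivation, h, map_zero, HahnSeries.coeff_zero])]

end RatDerivation

/-! ### Sums of double poles and the locus conditions -/

section DoublePole

variable {K : Type*} [Field K] {α ζ : K}

theorem laurentAt_X_sub_C (α ζ : K) :
    laurentAt α (RatFunc.X - RatFunc.C ζ) = HahnSeries.single 1 1 - HahnSeries.C (ζ - α) := by
  rw [map_sub, laurentAt_X, laurentAt_C, map_sub]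
  ring

theorem laurentAt_inv_sq_X_sub_C_self (ζ : K) :
    laurentAt ζ ((RatFunc.X - RatFunc.C ζ) ^ 2)⁻¹ = HahnSeries.single (-2) 1 := by
  rw [map_inv₀, map_pow, laurentAt_X_sub_C, sub_self, map_zero, sub_zero, HahnSeries.single_pow]
  refine inv_eq_of_mul_eq_one_right ?_
  rw [HahnSeries.single_mul_single]
  simp

theorem laurentAt_inv_X_sub_C (h : ζ ≠ α) :
    laurentAt α (RatFunc.X - RatFunc.C ζ)⁻¹ = -HahnSeries.ofPowerSeries ℤ K
      (PowerSeries.invUnitsSub (Units.mk0 (ζ - α) (sub_ne_zero.2 h))) := by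
  have hinv := congrArg (HahnSeries.ofPowerSeries ℤ K)
    (PowerSeries.invUnitsSub_mul_sub (Units.mk0 (ζ - α) (sub_ne_zero.2 h)))
  rw [map_mul, map_sub, HahnSeries.ofPowerSeries_C, HahnSeries.ofPowerSeries_X,
    map_one (HahnSeries.ofPowerSeries ℤ K), Units.val_mk0] at hinv
  rw [map_inv₀, laurentAt_X_sub_C]
  refine inv_eq_of_mul_eq_one_left ?_
  linear_combination hinv

theorem laurentAt_inv_sq_X_sub_C (α ζ : K) :
    laurentAt α ((RatFunc.X - RatFunc.C ζ) ^ 2)⁻¹ =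
      -laurentDeriv K (laurentAt α (RatFunc.X - RatFunc.C ζ)⁻¹) := by
  have hderiv : laurentDeriv K (laurentAt α (RatFunc.X - RatFunc.C ζ)) = 1 := by
    rw [map_sub, laurentAt_C, map_sub, show HahnSeries.C ζ = algebraMap K K⸨X⸩ ζ from rfl,
      Derivation.map_algebraMap, sub_zero, laurentDeriv_laurentAt_X]
  rw [map_inv₀, map_inv₀, Derivation.leibniz_inv, hderiv, map_pow, smul_eq_mul, mul_one, neg_neg,
    inv_pow]

theorem ordGE_laurentAt_inv_sq_X_sub_C (h : ζ ≠ α) :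
    OrdGE 0 (laurentAt α ((RatFunc.X - RatFunc.C ζ) ^ 2)⁻¹) := by
  have hinv : OrdGE 0 (laurentAt α (RatFunc.X - RatFunc.C ζ)⁻¹) := by
    rw [laurentAt_inv_X_sub_C h]
    exact (ordGE_ofPowerSeries _).neg
  rw [← inv_pow, map_pow, pow_two]
  exact hinv.mul hinv

theorem coeff_laurentAt_inv_sq_X_sub_C (h : ζ ≠ α) (n : ℕ) :
    (laurentAt α ((RatFunc.X - RatFunc.C ζ) ^ 2)⁻¹).coeff n = (n + 1) / (ζ - α) ^ (n + 2) := by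
  have hcoeff : (laurentAt α (RatFunc.X - RatFunc.C ζ)⁻¹).coeff ((n + 1 : ℕ) : ℤ) =
      -(1 / (ζ - α) ^ (n + 2)) := by
    rw [laurentAt_inv_X_sub_C h, HahnSeries.coeff_neg, HahnSeries.ofPowerSeries_apply_coeff,
      PowerSeries.coeff_invUnitsSub]
    simp [divp]
  rw [laurentAt_inv_sq_X_sub_C, HahnSeries.coeff_neg, coeff_laurentDeriv]
  push_cast at hcoeff ⊢
  rw [hcoeff]
  ring

theorem laurentInfty_inv_sq_X_sub_C (ζ : K) :
    OrdGE 2 (laurentInfty ((RatFunc.X - RatFunc.C ζ) ^ 2)⁻¹) ∧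
      (laurentInfty ((RatFunc.X - RatFunc.C ζ) ^ 2)⁻¹).coeff 2 = 1 := by
  have hord : OrdGE (-1) (laurentInfty (RatFunc.X - RatFunc.C ζ)) := by
    rw [map_sub, laurentInfty_X, laurentInfty_C]
    exact (OrdGE.single _ _).sub ((OrdGE.const ζ).mono (by norm_num))
  have hlead : (laurentInfty (RatFunc.X - RatFunc.C ζ)).coeff (-1) = 1 := by
    rw [map_sub, laurentInfty_X, laurentInfty_C, HahnSeries.coeff_sub,
      HahnSeries.coeff_single_same, OrdGE.const ζ _ (by norm_num), sub_zero]
  obtain ⟨hinv, hinv'⟩ := hord.inv (by rw [hlead]; exact one_ne_zero)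
  rw [hlead, inv_one] at hinv'
  rw [← inv_pow, map_pow, map_inv₀, pow_two]
  rw [neg_neg] at hinv hinv'
  exact ⟨hinv.mul hinv, (hinv.coeff_mul hinv).trans (by rw [hinv', mul_one])⟩

end DoublePole

section DoublePoles

variable {K ι : Type*} [Field K] {S : Finset ι} {w ζ : ι → K} {α : K}

/-- The rational function `c - ∑ w_ℓ (z - ζ_ℓ)⁻²`. -/
def doublePoles (S : Finset ι) (c : K) (w ζ : ι → K) : RatFunc K :=
  RatFunc.C c - ∑ l ∈ S, RatFunc.C (w l) / (RatFunc.X - RatFunc.C (ζ l)) ^ 2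

theorem map_doublePoles (φ : RatFunc K →ₐ[K] K⸨X⸩) (S : Finset ι) (c : K) (w ζ : ι → K) :
    φ (doublePoles S c w ζ) =
      HahnSeries.C c - ∑ l ∈ S, w l • φ ((RatFunc.X - RatFunc.C (ζ l)) ^ 2)⁻¹ := by
  have hC (a : K) : φ (RatFunc.C a) = algebraMap K K⸨X⸩ a := φ.commutes a
  simp only [doublePoles, map_sub, map_sum, div_eq_mul_inv, map_mul, hC, ← Algebra.smul_def]
  rfl

theorem ordGE_laurentAt_doublePoles (c : K) (w : ι → K) (h : ∀ l ∈ S, ζ l ≠ α) :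
    OrdGE 0 (laurentAt α (doublePoles S c w ζ)) := by
  rw [map_doublePoles]
  exact (OrdGE.const c).sub (OrdGE.sum _ fun l hl =>
    (ordGE_laurentAt_inv_sq_X_sub_C (h l hl)).smul _)

theorem coeff_laurentAt_doublePoles (c : K) (w : ι → K) (h : ∀ l ∈ S, ζ l ≠ α) {k : ℕ}
    (hk : 1 ≤ k) : (laurentAt α (doublePoles S c w ζ)).coeff (2 * k - 1) =
      2 * k * ∑ l ∈ S, w l / (α - ζ l) ^ (2 * k + 1) := by
  obtain ⟨n, rfl⟩ := Nat.exists_eq_add_of_le' hk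
  rw [map_doublePoles, HahnSeries.coeff_sub, HahnSeries.C_apply,
    HahnSeries.coeff_single_of_ne (by omega), HahnSeries.coeff_sum, zero_sub, Finset.mul_sum,
    ← Finset.sum_neg_distrib]
  refine Finset.sum_congr rfl fun l hl => ?_
  have hodd : (ζ l - α) ^ (2 * (n + 1) + 1) = -(α - ζ l) ^ (2 * (n + 1) + 1) := by
    rw [← neg_sub, Odd.neg_pow ⟨n + 1, rfl⟩]
  rw [HahnSeries.coeff_smul,
    show 2 * ((n + 1 : ℕ) : ℤ) - 1 = ((2 * n + 1 : ℕ) : ℤ) by push_cast; ring,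
    coeff_laurentAt_inv_sq_X_sub_C (h l hl), show 2 * n + 1 + 2 = 2 * (n + 1) + 1 by ring, hodd,
    smul_eq_mul, div_neg]
  push_cast
  ring

theorem laurentAt_doublePoles_self [DecidableEq ι] {l : ι} (hl : l ∈ S) (c : K) (w ζ : ι → K) :
    laurentAt (ζ l) (doublePoles S c w ζ) = HahnSeries.single (-2) (-w l) +
      laurentAt (ζ l) (doublePoles (S.erase l) c w ζ) := by
  have hsmul : w l • HahnSeries.single (-2 : ℤ) (1 : K) = HahnSeries.single (-2) (w l) := by
    rw [← HahnSeries.single_zero_mul_eq_smul, HahnSeries.single_mul_single, zero_add, mul_one]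
  rw [map_doublePoles, map_doublePoles, ← Finset.add_sum_erase _ _ hl,
    laurentAt_inv_sq_X_sub_C_self, hsmul, HahnSeries.single_neg]
  ring

theorem laurentInfty_doublePoles_sub_C (S : Finset ι) (c : K) (w ζ : ι → K) :
    OrdGE 2 (laurentInfty (doublePoles S c w ζ - RatFunc.C c)) ∧
      (laurentInfty (doublePoles S c w ζ - RatFunc.C c)).coeff 2 = -∑ l ∈ S, w l := by
  have hexp : laurentInfty (doublePoles S c w ζ - RatFunc.C c) =
      -∑ l ∈ S, w l • laurentInfty ((RatFunc.X - RatFunc.C (ζ l)) ^ 2)⁻¹ := by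
    rw [map_sub, map_doublePoles, laurentInfty_C]
    ring
  rw [hexp]
  refine ⟨(OrdGE.sum _ fun l _ => (laurentInfty_inv_sq_X_sub_C _).1.smul _).neg, ?_⟩
  simp only [HahnSeries.coeff_neg, HahnSeries.coeff_sum, HahnSeries.coeff_smul,
    (laurentInfty_inv_sq_X_sub_C _).2, smul_eq_mul, mul_one]

theorem localCond_laurentAt_doublePoles_iff [CharZero K] [DecidableEq ι] (c : K) (w : ι → K)
    (hζ : Function.Injective ζ) {l : ι} (hl : l ∈ S) (s : ℕ) :
    LocalCond (laurentAt (ζ l) (doublePoles S c w ζ)) s ↔ w l = s * (s + 1) ∧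
      ∀ k ∈ Finset.Icc 1 s, ∑ l' ∈ S.erase l, w l' / (ζ l - ζ l') ^ (2 * k + 1) = 0 := by
  have hne : ∀ l' ∈ S.erase l, ζ l' ≠ ζ l := fun l' hl' h => Finset.ne_of_mem_erase hl' (hζ h)
  have hreg := ordGE_laurentAt_doublePoles c w hne
  have hlead : (laurentAt (ζ l) (doublePoles S c w ζ)).coeff (-2) = -w l := by
    rw [laurentAt_doublePoles_self hl, HahnSeries.coeff_add, HahnSeries.coeff_single_same,
      hreg _ (by norm_num), add_zero]
  have hodd (k : ℕ) : (laurentAt (ζ l) (doublePoles S c w ζ)).coeff (2 * k - 1) =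
      2 * k * ∑ l' ∈ S.erase l, w l' / (ζ l - ζ l') ^ (2 * k + 1) := by
    rw [laurentAt_doublePoles_self hl, HahnSeries.coeff_add,
      HahnSeries.coeff_single_of_ne (by omega), zero_add]
    rcases Nat.eq_zero_or_pos k with rfl | hk
    · rw [hreg _ (by norm_num), Nat.cast_zero, mul_zero, zero_mul]
    · exact coeff_laurentAt_doublePoles c w hne hk
  constructor
  · intro h
    refine ⟨neg_injective (hlead.symm.trans h.lead), fun k hk => ?_⟩
    obtain ⟨hk1, hks⟩ := Finset.mem_Icc.1 hk
    refine (mul_eq_zero.1 ((hodd k).symm.trans (h.odd k hks))).resolve_left ?_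
    exact mul_ne_zero two_ne_zero (Nat.cast_ne_zero.2 (by omega))
  · rintro ⟨hw, hk⟩
    refine ⟨?_, by rw [hlead, hw], fun k hks => ?_⟩
    · rw [laurentAt_doublePoles_self hl]
      exact (OrdGE.single _ _).add (hreg.mono (by norm_num))
    · rw [hodd]
      rcases Nat.eq_zero_or_pos k with rfl | hk0
      · rw [Nat.cast_zero, mul_zero, zero_mul]
      · rw [hk k (Finset.mem_Icc.2 ⟨hk0, hks⟩), mul_zero]

theorem LocalCond.ordGE_sub {q : K⸨X⸩} {s : ℕ} (h : LocalCond q s) :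
    OrdGE 0 (q - HahnSeries.single (-2) (-((s : K) * (s + 1)))) := by
  intro i hi
  rw [HahnSeries.coeff_sub]
  rcases eq_or_ne i (-2) with rfl | hi2
  · rw [h.lead, HahnSeries.coeff_single_same, sub_self]
  · rw [HahnSeries.coeff_single_of_ne hi2, sub_zero]
    rcases eq_or_ne i (-1) with rfl | hi1
    · simpa using h.odd 0 (Nat.zero_le s)
    · exact h.ordGE i (by omega)

theorem exists_eq_C_of_ordGE [IsAlgClosed K] {f : RatFunc K} (h : ∀ α, OrdGE 0 (laurentAt α f))
    (hinfty : OrdGE 0 (laurentInfty f)) : ∃ c, f = RatFunc.C c := by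
  obtain ⟨p, rfl⟩ := exists_polynomial_of_ordGE h
  have hp : p.natDegree = 0 := Polynomial.natDegree_eq_zero_iff_degree_le_zero.2 <|
    Polynomial.degree_le_zero_iff.2 <| Polynomial.ext fun n => by
      rcases eq_or_ne n 0 with rfl | hn
      · rw [Polynomial.coeff_C_zero]
      · rw [Polynomial.coeff_C_of_ne_zero hn, ← coeff_laurentInfty_algebraMap, hinfty _ (by omega)]
  exact ⟨p.coeff 0, by rw [Polynomial.eq_C_of_natDegree_eq_zero hp, RatFunc.algebraMap_C,
    Polynomial.coeff_C_zero]⟩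

theorem exists_eq_doublePoles [IsAlgClosed K] {q : RatFunc K}
    (hζ : Function.Injective ζ) (hreg : ∀ α, (∀ l ∈ S, ζ l ≠ α) → OrdGE 0 (laurentAt α q))
    (hpole : ∀ l ∈ S, OrdGE 0 (laurentAt (ζ l) q - HahnSeries.single (-2) (-w l)))
    (hinfty : OrdGE 0 (laurentInfty q)) : ∃ c, q = doublePoles S c w ζ := by
  classical
  have hdiff (α : K) : OrdGE 0 (laurentAt α (q - doublePoles S 0 w ζ)) := by
    rw [map_sub]
    by_cases hα : ∀ l ∈ S, ζ l ≠ α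
    · exact (hreg α hα).sub (ordGE_laurentAt_doublePoles 0 w hα)
    · push Not at hα
      obtain ⟨l, hl, rfl⟩ := hα
      rw [laurentAt_doublePoles_self hl, ← sub_sub]
      exact (hpole l hl).sub (ordGE_laurentAt_doublePoles 0 w fun l' hl' h =>
        Finset.ne_of_mem_erase hl' (hζ h))
  have hdiff_infty : OrdGE 0 (laurentInfty (q - doublePoles S 0 w ζ)) := by
    have h := (laurentInfty_doublePoles_sub_C S 0 w ζ).1
    rw [map_zero, sub_zero] at h
    rw [map_sub]
    exact hinfty.sub (h.mono (by norm_num))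
  obtain ⟨c, hc⟩ := exists_eq_C_of_ordGE hdiff hdiff_infty
  refine ⟨c, (eq_add_of_sub_eq hc).trans ?_⟩
  rw [doublePoles, doublePoles, map_zero, zero_sub, ← sub_eq_add_neg]

end DoublePoles

section LocusData

variable {q : RatFunc ℂ} {qInf : ℂ} {M : ℕ} {s : Fin M → ℕ} {ζ : Fin M → ℂ}

theorem IsLocusData.eq_doublePoles (h : IsLocusData q qInf s ζ) :
    q = doublePoles Finset.univ qInf (fun l => (s l : ℂ) * (s l + 1)) ζ := h.eq

theorem IsLocusData.localCond (h : IsLocusData q qInf s ζ) (l : Fin M) :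
    LocalCond (laurentAt (ζ l) q) (s l) := by
  rw [h.eq_doublePoles]
  exact (localCond_laurentAt_doublePoles_iff _ _ h.distinct (Finset.mem_univ l) _).2
    ⟨rfl, h.constraint l⟩

theorem IsLocusData.ordGE_laurentAt (h : IsLocusData q qInf s ζ) {α : ℂ} (hα : ∀ l, ζ l ≠ α) :
    OrdGE 0 (laurentAt α q) := by
  rw [h.eq_doublePoles]
  exact ordGE_laurentAt_doublePoles _ _ fun l _ => hα l

theorem IsLocusData.laurentInfty_sub_C (h : IsLocusData q qInf s ζ) :
    OrdGE 2 (laurentInfty (q - RatFunc.C qInf)) ∧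
      (laurentInfty (q - RatFunc.C qInf)).coeff 2 = -((∑ l, s l * (s l + 1) : ℕ) : ℂ) := by
  have hexp := laurentInfty_doublePoles_sub_C Finset.univ qInf
    (fun l => (s l : ℂ) * (s l + 1)) ζ
  rw [← h.eq_doublePoles] at hexp
  exact ⟨hexp.1, by rw [hexp.2]; push_cast; rfl⟩

theorem exists_isLocusData_of_localCond (hq : ∀ c : ℂ, q ≠ RatFunc.C c)
    (hloc : ∀ α, ∃ s, LocalCond (laurentAt α q) s) (hinfty : OrdGE 0 (laurentInfty q)) :
    ∃ (M : ℕ) (s : Fin M → ℕ) (qInf : ℂ) (ζ : Fin M → ℂ), IsLocusData q qInf s ζ := by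
  choose s hs using hloc
  set poles := q.denom.roots.toFinset with hpoles
  have hmem (α : ℂ) : α ∈ poles ↔ ¬ OrdGE 0 (laurentAt α q) := by
    rw [ordGE_laurentAt_iff, not_not, hpoles, Multiset.mem_toFinset,
      Polynomial.mem_roots q.denom_ne_zero, Polynomial.IsRoot.def]
  let ζ : Fin poles.card → ℂ := fun l => poles.equivFin.symm l
  have hζ : Function.Injective ζ := Subtype.val_injective.comp poles.equivFin.symm.injective
  have hζ_mem (l : Fin poles.card) : ζ l ∈ poles := (poles.equivFin.symm l).2
  obtain ⟨c, hc⟩ := exists_eq_doublePoles (S := Finset.univ) hζ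
    (fun α hα => by
      by_contra hpole
      exact hα (poles.equivFin ⟨α, (hmem α).2 hpole⟩) (Finset.mem_univ _) (by simp [ζ]))
    (fun l _ => (hs (ζ l)).ordGE_sub) hinfty
  have hsum (l : Fin poles.card) := (localCond_laurentAt_doublePoles_iff c _ hζ (Finset.mem_univ l)
    (s (ζ l))).1 (hc ▸ hs (ζ l))
  refine ⟨poles.card, fun l => s (ζ l), c, ζ, ?_, fun l => ?_, hζ, hc, fun l => (hsum l).2⟩
  · refine Nat.one_le_iff_ne_zero.2 fun hcard => hq c ?_
    have : IsEmpty (Fin poles.card) := by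
      rw [hcard]
      infer_instance
    rw [hc, doublePoles, Finset.univ_eq_empty, Finset.sum_empty, sub_zero]
  · refine Nat.one_le_iff_ne_zero.2 fun hs0 => (hmem (ζ l)).1 (hζ_mem l) ?_
    simpa [hs0] using (hs (ζ l)).ordGE_sub

end LocusData

/-! ### The homogeneous KdV sequence -/

section KdVSeq

variable {K A B : Type*} [Field K] [CommRing A] [Algebra K A] [CommRing B] [Algebra K B]

/-- The bilinear form `½ a'' b - ¼ a' b' + q a b`. The curve attached to `F` is
`E F² - kdvForm D q F F`, and the homogeneous solution of the recursion is a formal solution of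
`F² = 1 + w kdvForm D q F F` in `w = 1 / E`. -/
def kdvForm (D : Derivation K A A) (q a b : A) : A :=
  (1 / 2 : K) • (D (D a) * b) - (1 / 4 : K) • (D a * D b) + q * (a * b)

theorem map_kdvForm {D : Derivation K A A} {D' : Derivation K B B} (φ : A →ₐ[K] B)
    (hφ : ∀ a, φ (D a) = D' (φ a)) (q a b : A) :
    φ (kdvForm D q a b) = kdvForm D' (φ q) (φ a) (φ b) := by
  simp only [kdvForm, map_add, map_sub, map_mul, map_smul, hφ]

theorem derivation_kdvForm_self [NeZero (2 : K)] (D : Derivation K A A) (q a : A) :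
    D (kdvForm D q a a) = 2 * a * kdvOp D q a := by
  have half : algebraMap K A (1 / 2) * 2 = 1 := by
    rw [← map_ofNat (algebraMap K A) 2, ← map_mul, one_div_mul_cancel two_ne_zero, map_one]
  have quarter : algebraMap K A (1 / 4) * 2 = algebraMap K A (1 / 2) := by
    rw [← map_ofNat (algebraMap K A) 2, ← map_mul, show (4 : K) = 2 * 2 by norm_num]
    field_simp
  simp only [kdvForm, kdvOp, crossOp, map_add, map_sub, D.map_smul, D.leibniz, smul_eq_mul]
  simp only [Algebra.smul_def]
  linear_combination (-(a * D (D (D a))) - D a * D (D a)) * quarter - a * D q * a * half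

/-- The sequence of coefficients of the formal series `F = 1 + f₁ w + f₂ w² + ⋯` with
`F² = 1 + w kdvForm D q F F`. -/
def kdvSeq (D : Derivation K A A) (q : A) : ℕ → A
  | 0 => 1
  | n + 1 => (1 / 2 : K) • (∑ i : Fin (n + 1), kdvForm D q (kdvSeq D q i) (kdvSeq D q (n - i)) -
      ∑ i : Fin n, kdvSeq D q (i + 1) * kdvSeq D q (n - i))
  termination_by n => n
  decreasing_by all_goals omega

variable (D : Derivation K A A) (q : A)

theorem kdvSeq_zero : kdvSeq D q 0 = 1 := by rw [kdvSeq]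

theorem kdvSeq_succ (n : ℕ) :
    kdvSeq D q (n + 1) = (1 / 2 : K) •
      (∑ i ∈ Finset.range (n + 1), kdvForm D q (kdvSeq D q i) (kdvSeq D q (n - i)) -
        ∑ i ∈ Finset.range n, kdvSeq D q (i + 1) * kdvSeq D q (n - i)) := by
  rw [kdvSeq, Finset.sum_range, Finset.sum_range]

theorem map_kdvSeq {D : Derivation K A A} {D' : Derivation K B B} (φ : A →ₐ[K] B)
    (hφ : ∀ a, φ (D a) = D' (φ a)) (q : A) (n : ℕ) :
    φ (kdvSeq D q n) = kdvSeq D' (φ q) n := by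
  induction n using Nat.strong_induction_on with
  | _ n ih =>
    rcases n with _ | n
    · rw [kdvSeq_zero, kdvSeq_zero, map_one]
    · rw [kdvSeq_succ, kdvSeq_succ, map_smul, map_sub, map_sum, map_sum]
      congr 2
      · refine Finset.sum_congr rfl fun i hi => ?_
        rw [Finset.mem_range] at hi
        rw [map_kdvForm φ hφ, ih i hi, ih (n - i) (by omega)]
      · refine Finset.sum_congr rfl fun i hi => ?_
        rw [Finset.mem_range] at hi
        rw [map_mul, ih (i + 1) (by omega), ih (n - i) (by omega)]

/-- The coefficientwise extension of a derivation to power series. -/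
def seriesDerivation : Derivation K (PowerSeries A) (PowerSeries A) :=
  Derivation.mk'
    { toFun F := PowerSeries.mk fun n => D (PowerSeries.coeff n F)
      map_add' F G := by ext n; simp only [PowerSeries.coeff_mk, map_add]
      map_smul' c F := by
        ext n
        simp only [PowerSeries.coeff_mk, PowerSeries.coeff_smul, D.map_smul, RingHom.id_apply] }
    fun F G => by
      ext n
      simp only [LinearMap.coe_mk, AddHom.coe_mk, PowerSeries.coeff_mk, smul_eq_mul,
        mul_comm G, map_add, PowerSeries.coeff_mul, map_sum, D.leibniz, Finset.sum_add_distrib,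
        mul_comm (D _)]

theorem coeff_seriesDerivation (F : PowerSeries A) (n : ℕ) :
    PowerSeries.coeff n (seriesDerivation D F) = D (PowerSeries.coeff n F) :=
  PowerSeries.coeff_mk n fun n => D (PowerSeries.coeff n F)

theorem coeff_kdvForm_seriesDerivation (F G : PowerSeries A) (n : ℕ) :
    PowerSeries.coeff n (kdvForm (seriesDerivation D) (PowerSeries.C q) F G) =
      ∑ p ∈ Finset.HasAntidiagonal.antidiagonal n,
        kdvForm D q (PowerSeries.coeff p.1 F) (PowerSeries.coeff p.2 G) := by
  rw [kdvForm, map_add, map_sub, PowerSeries.coeff_C_mul, PowerSeries.coeff_smul,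
    PowerSeries.coeff_smul]
  simp only [kdvForm, PowerSeries.coeff_mul, coeff_seriesDerivation, Finset.smul_sum,
    Finset.mul_sum, Finset.sum_add_distrib, Finset.sum_sub_distrib]

theorem coeff_kdvOp_seriesDerivation (F : PowerSeries A) (n : ℕ) :
    PowerSeries.coeff n (kdvOp (seriesDerivation D) (PowerSeries.C q) F) =
      kdvOp D q (PowerSeries.coeff n F) := by
  have hq : seriesDerivation D (PowerSeries.C q) = PowerSeries.C (D q) := by
    ext k
    rw [coeff_seriesDerivation, PowerSeries.coeff_C, PowerSeries.coeff_C, apply_ite D, map_zero]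
  simp only [kdvOp, crossOp, hq, map_add, PowerSeries.coeff_smul, PowerSeries.coeff_C_mul,
    coeff_seriesDerivation]

theorem mk_kdvSeq_sq [NeZero (2 : K)] :
    PowerSeries.mk (kdvSeq D q) ^ 2 = 1 + PowerSeries.X *
      kdvForm (seriesDerivation D) (PowerSeries.C q) (.mk (kdvSeq D q)) (.mk (kdvSeq D q)) := by
  ext n
  rw [sq, PowerSeries.coeff_mul, map_add]
  simp only [PowerSeries.coeff_mk]
  rcases n with _ | n
  · simp [kdvSeq_zero]
  · rw [PowerSeries.coeff_succ_X_mul, coeff_kdvForm_seriesDerivation, PowerSeries.coeff_one,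
      if_neg n.succ_ne_zero, zero_add]
    simp only [PowerSeries.coeff_mk]
    rw [Finset.Nat.sum_antidiagonal_eq_sum_range_succ fun i j => kdvSeq D q i * kdvSeq D q j,
      Finset.Nat.sum_antidiagonal_eq_sum_range_succ
        fun i j => kdvForm D q (kdvSeq D q i) (kdvSeq D q j),
      Finset.sum_range_succ, Finset.sum_range_succ']
    simp only [Nat.add_sub_add_right, Nat.sub_self, Nat.sub_zero, kdvSeq_zero, one_mul, mul_one]
    have hsucc : (2 : K) • kdvSeq D q (n + 1) = _ := congrArg _ (kdvSeq_succ D q n)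
    rw [smul_smul, mul_one_div_cancel two_ne_zero, one_smul, two_smul] at hsucc
    linear_combination hsucc

theorem derivation_kdvSeq_succ [NeZero (2 : K)] (n : ℕ) :
    D (kdvSeq D q (n + 1)) = kdvOp D q (kdvSeq D q n) := by
  set F := PowerSeries.mk (kdvSeq D q) with hF
  have hunit : IsUnit (2 * F) := by
    rw [PowerSeries.isUnit_iff_constantCoeff, map_mul, map_ofNat, hF,
      ← PowerSeries.coeff_zero_eq_constantCoeff_apply, PowerSeries.coeff_mk, kdvSeq_zero, mul_one,
      ← map_ofNat (algebraMap K A) 2]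
    exact (isUnit_iff_ne_zero.2 two_ne_zero).map _
  have hX : seriesDerivation D PowerSeries.X = 0 := by
    ext k
    rw [coeff_seriesDerivation, PowerSeries.coeff_X, apply_ite D, D.map_one_eq_zero, map_zero,
      ite_self, map_zero]
  have hderiv : seriesDerivation D F =
      PowerSeries.X * kdvOp (seriesDerivation D) (PowerSeries.C q) F := by
    have h := congrArg (seriesDerivation D) (mk_kdvSeq_sq D q)
    rw [← hF, map_add, Derivation.map_one_eq_zero, zero_add, Derivation.leibniz, hX, smul_zero,
      add_zero, derivation_kdvForm_self, sq, Derivation.leibniz] at h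
    refine hunit.mul_left_cancel ?_
    simp only [smul_eq_mul] at h
    linear_combination h
  have h := congrArg (PowerSeries.coeff (n + 1)) hderiv
  rwa [PowerSeries.coeff_succ_X_mul, coeff_seriesDerivation, coeff_kdvOp_seriesDerivation, hF,
    PowerSeries.coeff_mk, PowerSeries.coeff_mk] at h

theorem isStationaryKdV_kdvSeq [NeZero (2 : K)] {D : Derivation K A A} {q : A} {g : ℕ}
    (h : kdvSeq D q (g + 1) = 0) : IsStationaryKdV D q g (kdvSeq D q) where
  zero := kdvSeq_zero D q
  succ j _ := derivation_kdvSeq_succ D q j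
  kdv := by rw [h, map_zero]

end KdVSeq

/-! ### The KdV recursion at infinity -/

section Infinity

variable {K : Type*} [Field K] {q f : K⸨X⸩} {m n : ℤ}

theorem OrdGE.crossOp_infty (hq : OrdGE m q) (hf : OrdGE n f) :
    OrdGE (m + n + 1) (crossOp (inftyDeriv K) q f) :=
  ((hq.mul hf.inftyDeriv).mono (by omega)).add
    (((hq.inftyDeriv.mul hf).smul _).mono (by omega))

theorem OrdGE.kdvForm_infty {a b : K⸨X⸩} (hq : OrdGE 2 q) (ha : OrdGE m a) (hb : OrdGE n b) :
    OrdGE (m + n + 2) (kdvForm (inftyDeriv K) q a b) :=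
  ((((ha.inftyDeriv.inftyDeriv.mul hb).smul _).mono (by omega)).sub
    (((ha.inftyDeriv.mul hb.inftyDeriv).smul _).mono (by omega))).add
    ((hq.mul (ha.mul hb)).mono (by omega))

theorem ordGE_kdvSeq_infty (hq : OrdGE 2 q) (n : ℕ) :
    OrdGE (2 * n) (kdvSeq (inftyDeriv K) q n) := by
  induction n using Nat.strong_induction_on with
  | _ n ih =>
    rcases n with _ | n
    · rw [kdvSeq_zero]
      exact OrdGE.one
    · rw [kdvSeq_succ]
      refine ((OrdGE.sum _ fun i hi => ?_).sub (OrdGE.sum _ fun i hi => ?_)).smul _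
      · rw [Finset.mem_range] at hi
        exact (hq.kdvForm_infty (ih i hi) (ih (n - i) (by omega))).mono (by omega)
      · rw [Finset.mem_range] at hi
        exact ((ih (i + 1) (by omega)).mul (ih (n - i) (by omega))).mono (by omega)

variable [CharZero K]

theorem OrdGE.of_inftyDeriv (h : OrdGE (n + 1) (inftyDeriv K f)) (hn : n ≤ 0) : OrdGE n f := by
  intro i hi
  have hcoeff := coeff_inftyDeriv f i
  rw [h _ (by omega)] at hcoeff
  refine (mul_eq_zero.1 hcoeff.symm).resolve_left ?_
  exact_mod_cast (by omega : -i ≠ 0)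

theorem OrdGE.coeff_crossOp_infty (hq : OrdGE m q) (hf : OrdGE n f) :
    (crossOp (inftyDeriv K) q f).coeff (m + n + 1) =
      -(n + m / 2) * (q.coeff m * f.coeff n) := by
  have hqf := hq.coeff_mul hf.inftyDeriv
  have hfq := hq.inftyDeriv.coeff_mul hf
  rw [coeff_inftyDeriv] at hqf hfq
  rw [crossOp, HahnSeries.coeff_add, HahnSeries.coeff_smul, show m + n + 1 = m + (n + 1) by ring,
    hqf, show m + (n + 1) = m + 1 + n by ring, hfq, smul_eq_mul]
  ring

theorem OrdGE.coeff_kdvOp_infty (hq : OrdGE 2 q) (hf : OrdGE n f) :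
    (kdvOp (inftyDeriv K) q f).coeff (n + 3) =
      -((n + 1) * (n * (n + 2) / 4 + q.coeff 2)) * f.coeff n := by
  have hcross := hq.coeff_crossOp_infty hf
  rw [show 2 + n + 1 = n + 3 by ring] at hcross
  rw [kdvOp, HahnSeries.coeff_add, HahnSeries.coeff_smul, hcross,
    show n + 3 = n + 1 + 1 + 1 by ring, coeff_inftyDeriv, coeff_inftyDeriv, coeff_inftyDeriv,
    smul_eq_mul]
  push_cast
  ring

theorem IsStationaryKdV.coeff_ne_zero_of_neg {g : ℕ} {f : ℕ → K⸨X⸩}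
    (h : IsStationaryKdV (inftyDeriv K) q g f) (hm : OrdGE m q) (hlead : q.coeff m ≠ 0)
    (hneg : m < 0) {j : ℕ} (hj : j ≤ g + 1) :
    OrdGE (m * j) (f j) ∧ (f j).coeff (m * j) ≠ 0 := by
  induction j with
  | zero =>
    simp only [Nat.cast_zero, mul_zero, h.zero]
    exact ⟨OrdGE.one, by simp⟩
  | succ j ih =>
    obtain ⟨hord, hne⟩ := ih (by omega)
    have hnonpos : m * (j : ℤ) ≤ 0 := mul_nonpos_of_nonpos_of_nonneg hneg.le j.cast_nonneg
    have hderiv := hord.inftyDeriv.inftyDeriv.inftyDeriv.smul (1 / 4 : K)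
    have hsucc : inftyDeriv K (f (j + 1)) = _ := h.succ j (by omega)
    rw [kdvOp] at hsucc
    rw [show m * ((j + 1 : ℕ) : ℤ) = m + m * j by push_cast; ring]
    refine ⟨OrdGE.of_inftyDeriv ?_ (by omega), fun hzero => ?_⟩
    · rw [hsucc]
      exact (hderiv.mono (by omega)).add (hm.crossOp_infty hord)
    · have hcoeff := coeff_inftyDeriv (f (j + 1)) (m + m * j)
      rw [hzero, mul_zero, hsucc, HahnSeries.coeff_add, hderiv _ (by omega),
        hm.coeff_crossOp_infty hord, zero_add] at hcoeff
      refine mul_ne_zero (fun hfactor => ?_) (mul_ne_zero hlead hne) hcoeff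
      have hint : 2 * (m * (j : ℤ)) + m = 0 := by
        have : ((2 * (m * (j : ℤ)) + m : ℤ) : K) = 0 := by
          push_cast at hfactor ⊢
          linear_combination -2 * hfactor
        exact_mod_cast this
      omega

theorem IsStationaryKdV.ordGE_infty {g : ℕ} {f : ℕ → K⸨X⸩}
    (h : IsStationaryKdV (inftyDeriv K) q g f) : OrdGE 0 q := by
  by_contra hcon
  obtain ⟨m, hm, hlead⟩ := exists_ordGE_coeff_ne_zero (f := q) fun h0 => hcon (h0 ▸ OrdGE.zero _)
  have hneg : m < 0 := lt_of_not_ge fun h0 => hcon (hm.mono h0)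
  have hne := (h.coeff_ne_zero_of_neg hm hlead hneg le_rfl).2
  have hcoeff := coeff_inftyDeriv (f (g + 1)) (m * ((g + 1 : ℕ) : ℤ))
  rw [h.kdv, HahnSeries.coeff_zero] at hcoeff
  refine mul_ne_zero ?_ hne hcoeff.symm
  have : m * ((g + 1 : ℕ) : ℤ) < 0 := mul_neg_of_neg_of_pos hneg (by positivity)
  exact_mod_cast (by omega : -(m * ((g + 1 : ℕ) : ℤ)) ≠ 0)

theorem IsStationaryKdV.ordGE_zero_infty {g : ℕ} {f : ℕ → K⸨X⸩}
    (h : IsStationaryKdV (inftyDeriv K) q g f) (hq : OrdGE 0 q) {j : ℕ} (hj : j ≤ g + 1) :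
    OrdGE 0 (f j) := by
  induction j with
  | zero => rw [h.zero]; exact OrdGE.one
  | succ j ih =>
    refine OrdGE.of_inftyDeriv ?_ le_rfl
    have hfj := ih (by omega)
    rw [h.succ j (by omega)]
    exact ((hfj.inftyDeriv.inftyDeriv.inftyDeriv.smul _).mono (by norm_num)).add
      (hq.crossOp_infty hfj)

section Weight

variable {w : ℕ}

theorem OrdGE.coeff_kdvOp_infty_eq_zero_iff (hq : OrdGE 2 q) (hw : q.coeff 2 = -(w * (w + 1)))
    (hf : OrdGE n f) (hlead : f.coeff n ≠ 0) :
    (kdvOp (inftyDeriv K) q f).coeff (n + 3) = 0 ↔ n = -1 ∨ n = 2 * w ∨ n = -(2 * w + 2) := by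
  have hfactor : (n + 1 : K) * (n * (n + 2) / 4 + q.coeff 2) =
      (((n + 1) * ((n - 2 * w) * (n + (2 * w + 2))) : ℤ) : K) / 4 := by
    rw [hw]
    push_cast
    ring
  rw [hq.coeff_kdvOp_infty hf, mul_eq_zero, or_iff_left hlead, neg_eq_zero, hfactor,
    div_eq_zero_iff, or_iff_left (OfNat.ofNat_ne_zero 4), Int.cast_eq_zero, mul_eq_zero,
    mul_eq_zero, sub_eq_zero, add_eq_zero_iff_eq_neg, add_eq_zero_iff_eq_neg]

theorem OrdGE.of_kdvOp_infty (hq : OrdGE 2 q) (hw : q.coeff 2 = -(w * (w + 1))) (hf : OrdGE 0 f)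
    (hn : n ≤ 2 * w) (h : OrdGE (n + 3) (kdvOp (inftyDeriv K) q f)) : OrdGE n f := by
  by_cases hf0 : f = 0
  · exact hf0 ▸ OrdGE.zero _
  obtain ⟨k, hk, hlead⟩ := exists_ordGE_coeff_ne_zero hf0
  have hk0 : 0 ≤ k := le_of_not_gt fun hlt => hlead (hf k hlt)
  refine hk.mono (le_of_not_gt fun hlt => ?_)
  have := (hq.coeff_kdvOp_infty_eq_zero_iff hw hk hlead).1 (h _ (by omega))
  omega

theorem IsStationaryKdV.le_of_coeff_two {g : ℕ} {f : ℕ → K⸨X⸩}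
    (h : IsStationaryKdV (inftyDeriv K) q g f) (hq : OrdGE 2 q)
    (hw : q.coeff 2 = -(w * (w + 1))) : w ≤ g := by
  by_contra! hlt
  have hreg (j : ℕ) (hj : j ≤ g) : OrdGE 0 (f j) :=
    h.ordGE_zero_infty (hq.mono zero_le_two) (by omega)
  have hord (i : ℕ) (hi : i ≤ g) : OrdGE (2 * w - 2 * i) (f (g - i)) := by
    induction i with
    | zero =>
      refine OrdGE.of_kdvOp_infty hq hw (hreg _ (by omega)) (by omega) ?_
      rw [Nat.sub_zero, ← h.succ g le_rfl, h.kdv]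
      exact OrdGE.zero _
    | succ i ih =>
      refine OrdGE.of_kdvOp_infty hq hw (hreg _ (by omega)) (by omega) ?_
      rw [← h.succ _ (by omega), show g - (i + 1) + 1 = g - i by omega]
      exact (ih (by omega)).inftyDeriv.mono (by push_cast; omega)
  have hone := hord g le_rfl 0 (by omega)
  rw [Nat.sub_self, h.zero, HahnSeries.coeff_one, if_pos rfl] at hone
  exact one_ne_zero hone

theorem coeff_kdvSeq_succ_infty (hq : OrdGE 2 q) (n : ℕ) :
    2 * ((n : K) + 1) * (kdvSeq (inftyDeriv K) q (n + 1)).coeff (2 * ((n + 1 : ℕ) : ℤ)) =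
      (2 * n + 1) * (n * (n + 1) + q.coeff 2) * (kdvSeq (inftyDeriv K) q n).coeff (2 * n) := by
  have hop := hq.coeff_kdvOp_infty (ordGE_kdvSeq_infty hq n)
  rw [← derivation_kdvSeq_succ,
    show 2 * (n : ℤ) + 3 = 2 * ((n + 1 : ℕ) : ℤ) + 1 by push_cast; ring, coeff_inftyDeriv] at hop
  push_cast at hop ⊢
  linear_combination -hop

theorem kdvSeq_succ_ne_zero_infty (hq : OrdGE 2 q) (hw : q.coeff 2 = -(w * (w + 1))) {n : ℕ}
    (hwn : w < n) (hn : kdvSeq (inftyDeriv K) q n ≠ 0) : kdvSeq (inftyDeriv K) q (n + 1) ≠ 0 := by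
  intro hzero
  obtain ⟨k, hk, hlead⟩ := exists_ordGE_coeff_ne_zero hn
  have hnk : 2 * (n : ℤ) ≤ k := le_of_not_gt fun hlt => hlead (ordGE_kdvSeq_infty hq n k hlt)
  have := (hq.coeff_kdvOp_infty_eq_zero_iff hw hk hlead).1 (by
    rw [← derivation_kdvSeq_succ, hzero, map_zero, HahnSeries.coeff_zero])
  omega

theorem exists_coeff_two_eq_of_kdvSeq_eq_zero (hq : OrdGE 2 q) {N : ℕ}
    (hN : ∀ n, N < n → kdvSeq (inftyDeriv K) q n = 0) :
    ∃ g : ℕ, q.coeff 2 = -(g * (g + 1)) ∧ ∀ n, g < n → kdvSeq (inftyDeriv K) q n = 0 := by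
  set lead : ℕ → K := fun n => (kdvSeq (inftyDeriv K) q n).coeff (2 * n) with hlead
  have hzero : lead 0 ≠ 0 := by simp [hlead, kdvSeq_zero]
  obtain ⟨g, hg, hg'⟩ : ∃ g, lead g ≠ 0 ∧ lead (g + 1) = 0 := by
    by_contra! hcon
    have hne : ∀ n, lead n ≠ 0 := fun n => Nat.rec hzero (fun n => hcon n) n
    exact hne (N + 1) (by simp only [hlead, hN (N + 1) N.lt_succ_self, HahnSeries.coeff_zero])
  have hweight : q.coeff 2 = -(g * (g + 1)) := by
    have hrec := coeff_kdvSeq_succ_infty hq g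
    rw [show (kdvSeq (inftyDeriv K) q (g + 1)).coeff (2 * ((g + 1 : ℕ) : ℤ)) = 0 from hg',
      mul_zero, eq_comm, mul_eq_zero, or_iff_left hg, mul_eq_zero] at hrec
    have h2g : (2 * g + 1 : K) ≠ 0 := by exact_mod_cast (2 * g).succ_ne_zero
    linear_combination hrec.resolve_left h2g
  refine ⟨g, hweight, fun n hgn => ?_⟩
  by_contra hne
  have hall (k : ℕ) : kdvSeq (inftyDeriv K) q (n + k) ≠ 0 := by
    induction k with
    | zero => exact hne
    | succ k ih => exact kdvSeq_succ_ne_zero_infty hq hweight (hgn.trans_le (n.le_add_right k)) ih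
  exact hall (N + 1) (hN _ (by omega))

end Weight

end Infinity

/-! ### Rational KdV potentials and the locus -/

theorem ratFunc_C_mul {K : Type*} [Field K] (c : K) (f : RatFunc K) : RatFunc.C c * f = c • f := by
  rw [← RatFunc.algebraMap_eq_C, Algebra.smul_def]

section Potentials

variable {q : RatFunc ℂ} {qInf : ℂ} {g M : ℕ} {f : ℕ → RatFunc ℂ} {s : Fin M → ℕ} {ζ : Fin M → ℂ}

theorem isKdVSequence_iff : IsKdVSequence q g f ↔ IsStationaryKdV ratDerivation q g f := by
  have hop (a : RatFunc ℂ) : RatFunc.C (1 / 4) * ratDeriv (ratDeriv (ratDeriv a)) +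
      q * ratDeriv a + RatFunc.C (1 / 2) * ratDeriv q * a = kdvOp ratDerivation q a := by
    rw [ratFunc_C_mul, mul_assoc, ratFunc_C_mul, add_assoc]
    rfl
  constructor
  · intro h
    exact ⟨h.zero, fun j hj => (h.succ j hj).trans (hop _),
      (mul_eq_zero.1 h.kdv).resolve_left two_ne_zero⟩
  · intro h
    exact ⟨h.zero, fun j hj => (h.succ j hj).trans (hop _).symm, mul_eq_zero_of_right _ h.kdv⟩

theorem IsKdVPotential.exists_isLocusData (hq : ∀ c : ℂ, q ≠ RatFunc.C c)
    (h : IsKdVPotential q) :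
    ∃ (M : ℕ) (s : Fin M → ℕ) (qInf : ℂ) (ζ : Fin M → ℂ), IsLocusData q qInf s ζ := by
  obtain ⟨g, f, hf⟩ := h
  rw [isKdVSequence_iff] at hf
  exact exists_isLocusData_of_localCond hq
    (fun α => (hf.map (laurentAt α) (laurentAt_ratDerivation α)).exists_localCond)
    (hf.map laurentInfty laurentInfty_ratDerivation).ordGE_infty

theorem LocalCond.of_ordGE {K : Type*} [Field K] {q : K⸨X⸩} (hq : OrdGE 0 q) : LocalCond q 0 where
  ordGE := hq.mono (by norm_num)
  lead := by rw [hq _ (by norm_num)]; simp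
  odd m hm := hq _ (by omega)

theorem LocalCond.evenPole_kdvSeq {K : Type*} [Field K] [CharZero K] {q : K⸨X⸩} {s : ℕ}
    (h : LocalCond q s) (n : ℕ) : EvenPole s (kdvSeq (laurentDeriv K) q n) := by
  induction n with
  | zero =>
    rw [kdvSeq_zero]
    exact ⟨OrdGE.one.mono (by omega), fun i hi _ => OrdGE.one i hi⟩
  | succ n ih => exact h.evenPole ih (derivation_kdvSeq_succ _ _ n)

/-- The polynomial `∏ (z - ζ_ℓ) ^ s_ℓ`, whose square clears the poles of every
`kdvSeq ratDerivation q n`. -/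
def locusPoly {K : Type*} [Field K] {M : ℕ} (s : Fin M → ℕ) (ζ : Fin M → K) : K[X] :=
  ∏ l, (Polynomial.X - Polynomial.C (ζ l)) ^ s l

theorem monic_locusPoly {K : Type*} [Field K] {M : ℕ} (s : Fin M → ℕ) (ζ : Fin M → K) :
    (locusPoly s ζ).Monic :=
  Polynomial.monic_prod_of_monic _ _ fun l _ => (Polynomial.monic_X_sub_C (ζ l)).pow (s l)

theorem natDegree_locusPoly {K : Type*} [Field K] {M : ℕ} (s : Fin M → ℕ) (ζ : Fin M → K) :
    (locusPoly s ζ).natDegree = ∑ l, s l := by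
  rw [locusPoly, Polynomial.natDegree_prod_of_monic _ _
    fun l _ => (Polynomial.monic_X_sub_C (ζ l)).pow (s l)]
  simp only [Polynomial.natDegree_pow, Polynomial.natDegree_X_sub_C, mul_one]

theorem laurentAt_locusPoly {K : Type*} [Field K] {M : ℕ} (s : Fin M → ℕ) (ζ : Fin M → K)
    (l : Fin M) : laurentAt (ζ l) (algebraMap K[X] (RatFunc K) (locusPoly s ζ)) =
      HahnSeries.single (s l : ℤ) 1 * laurentAt (ζ l) (algebraMap K[X] (RatFunc K)
        (∏ l' ∈ Finset.univ.erase l, (Polynomial.X - Polynomial.C (ζ l')) ^ s l')) := by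
  rw [locusPoly, ← Finset.mul_prod_erase _ _ (Finset.mem_univ l), map_mul, map_mul, map_pow,
    map_pow, map_sub, RatFunc.algebraMap_X, RatFunc.algebraMap_C, laurentAt_X_sub_C, sub_self,
    map_zero, sub_zero, HahnSeries.single_pow, one_pow, nsmul_one]

theorem ordGE_laurentAt_locusPoly {K : Type*} [Field K] {M : ℕ} (s : Fin M → ℕ) (ζ : Fin M → K)
    (l : Fin M) : OrdGE (s l) (laurentAt (ζ l) (algebraMap K[X] (RatFunc K) (locusPoly s ζ))) := by
  rw [laurentAt_locusPoly]
  exact ((OrdGE.single (s l : ℤ) 1).mul (ordGE_laurentAt_algebraMap (ζ l) _)).mono (by simp)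

theorem IsLocusData.ordGE_laurentAt_mul_kdvSeq (h : IsLocusData q qInf s ζ) (α : ℂ) (n : ℕ) :
    OrdGE 0 (laurentAt α (algebraMap ℂ[X] (RatFunc ℂ) (locusPoly s ζ) ^ 2 *
      kdvSeq ratDerivation q n)) := by
  rw [map_mul, map_pow, sq, map_kdvSeq _ (laurentAt_ratDerivation α)]
  by_cases hα : ∃ l, ζ l = α
  · obtain ⟨l, rfl⟩ := hα
    have hQ := ordGE_laurentAt_locusPoly s ζ l
    exact ((hQ.mul hQ).mul ((h.localCond l).evenPole_kdvSeq n).1).mono (by omega)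
  · push Not at hα
    have hQ := ordGE_laurentAt_algebraMap α (locusPoly s ζ)
    exact ((hQ.mul hQ).mul
      ((LocalCond.of_ordGE (h.ordGE_laurentAt hα)).evenPole_kdvSeq n).1).mono (by norm_num)

theorem IsLocusData.kdvSeq_eq_zero_of_lt (h : IsLocusData q 0 s ζ) {n : ℕ} (hn : ∑ l, s l < n) :
    kdvSeq ratDerivation q n = 0 := by
  set Q := algebraMap ℂ[X] (RatFunc ℂ) (locusPoly s ζ)
  have hQ0 : Q ≠ 0 := RatFunc.algebraMap_ne_zero (monic_locusPoly s ζ).ne_zero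
  have hq : OrdGE 2 (laurentInfty q) := by simpa using h.laurentInfty_sub_C.1
  have hinfty : OrdGE 1 (laurentInfty (Q ^ 2 * kdvSeq ratDerivation q n)) := by
    rw [map_mul, map_pow, sq, map_kdvSeq _ laurentInfty_ratDerivation]
    have hQord := ordGE_laurentInfty_algebraMap (natDegree_locusPoly s ζ).le
    exact ((hQord.mul hQord).mul (ordGE_kdvSeq_infty hq n)).mono (by omega)
  obtain ⟨c, hc⟩ := exists_eq_C_of_ordGE (fun α => h.ordGE_laurentAt_mul_kdvSeq α n)
    (hinfty.mono zero_le_one)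
  rw [hc, laurentInfty_C] at hinfty
  have hc0 : c = 0 := by simpa using hinfty 0 zero_lt_one
  rw [hc0, map_zero] at hc
  exact (mul_eq_zero.1 hc).resolve_left (pow_ne_zero 2 hQ0)

theorem IsLocusData.sub_C (h : IsLocusData q qInf s ζ) :
    IsLocusData (q - RatFunc.C qInf) 0 s ζ where
  pos := h.pos
  s_pos := h.s_pos
  distinct := h.distinct
  eq := by rw [h.eq, map_zero]; ring
  constraint := h.constraint

theorem IsLocusData.exists_genus (h : IsLocusData q qInf s ζ) :
    ∃ g : ℕ, 1 ≤ g ∧ ∑ l, s l * (s l + 1) = g * (g + 1) ∧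
      ∀ n, g < n → kdvSeq ratDerivation (q - RatFunc.C qInf) n = 0 := by
  obtain ⟨hord, hcoeff⟩ := h.laurentInfty_sub_C
  have hmap (n : ℕ) : laurentInfty (kdvSeq ratDerivation (q - RatFunc.C qInf) n) =
      kdvSeq (inftyDeriv ℂ) (laurentInfty (q - RatFunc.C qInf)) n :=
    map_kdvSeq _ laurentInfty_ratDerivation _ n
  obtain ⟨g, hg, hzero⟩ := exists_coeff_two_eq_of_kdvSeq_eq_zero hord (N := ∑ l, s l)
    fun n hn => by rw [← hmap, h.sub_C.kdvSeq_eq_zero_of_lt hn, map_zero]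
  have hsum : ∑ l, s l * (s l + 1) = g * (g + 1) := by
    rw [hcoeff, neg_inj] at hg
    exact_mod_cast hg
  refine ⟨g, Nat.pos_of_ne_zero fun hg0 => ?_, hsum, fun n hn => ?_⟩
  · have l : Fin M := ⟨0, h.pos⟩
    rw [hg0, zero_mul, Finset.sum_eq_zero_iff] at hsum
    have := hsum l (Finset.mem_univ l)
    have := h.s_pos l
    simp_all
  · exact (map_eq_zero laurentInfty).1 ((hmap n).trans (hzero n hn))

end Potentials

/-! ### The spectral curve -/

section PolynomialRecursion

variable {K A : Type*} [Field K] [CommRing A] [Algebra K A] (D : Derivation K A A) (q : A)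

/-- The coefficientwise extension of a derivation to polynomials. -/
def polyDerivation : Derivation K A[X] A[X] :=
  PolynomialModule.equivPolynomialSelf.compDer D.mapCoeffs

theorem coeff_polyDerivation (F : A[X]) (n : ℕ) :
    (polyDerivation D F).coeff n = D (F.coeff n) := rfl

theorem polyDerivation_C (a : A) : polyDerivation D (Polynomial.C a) = Polynomial.C (D a) := by
  ext n
  rw [coeff_polyDerivation, Polynomial.coeff_C, Polynomial.coeff_C, apply_ite D, map_zero]

theorem polyDerivation_X : polyDerivation D Polynomial.X = 0 := by
  ext n
  rw [coeff_polyDerivation, Polynomial.coeff_X, apply_ite D, D.map_one_eq_zero, map_zero, ite_self,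
    Polynomial.coeff_zero]

theorem coeff_kdvOp_polyDerivation (F : A[X]) (n : ℕ) :
    (kdvOp (polyDerivation D) (Polynomial.C q) F).coeff n = kdvOp D q (F.coeff n) := by
  simp only [kdvOp, crossOp, polyDerivation_C, Polynomial.coeff_add, Polynomial.coeff_smul,
    Polynomial.coeff_C_mul, coeff_polyDerivation]

/-- The equation `F''' / 4 + (q - E) F' + q' F / 2 = 0` for a polynomial `F` in `E`; its monic
solutions of degree `g` are the generating polynomials of stationary KdV sequences. -/
def IsKdVPoly (F : A[X]) : Prop :=
  kdvOp (polyDerivation D) (Polynomial.C q) F = Polynomial.X * polyDerivation D F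

/-- The curve `E F² - kdvForm q F F` attached to `F`. -/
def polyCurve (F : A[X]) : A[X] :=
  Polynomial.X * F ^ 2 - kdvForm (polyDerivation D) (Polynomial.C q) F F

variable {D q} {F : A[X]}

theorem isKdVPoly_iff : IsKdVPoly D q F ↔
    kdvOp D q (F.coeff 0) = 0 ∧ ∀ n, kdvOp D q (F.coeff (n + 1)) = D (F.coeff n) := by
  constructor
  · intro h
    exact ⟨by rw [← coeff_kdvOp_polyDerivation, h, Polynomial.coeff_X_mul_zero],
      fun n => by rw [← coeff_kdvOp_polyDerivation, h, Polynomial.coeff_X_mul,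
        coeff_polyDerivation]⟩
  · rintro ⟨hzero, hsucc⟩
    refine Polynomial.ext fun n => ?_
    rw [coeff_kdvOp_polyDerivation]
    rcases n with _ | n
    · rw [hzero, Polynomial.coeff_X_mul_zero]
    · rw [hsucc, Polynomial.coeff_X_mul, coeff_polyDerivation]

/-- The shift `F(E) ↦ F(E - c)` of the spectral parameter. -/
def spectralShift (A : Type*) [CommRing A] [Algebra K A] (c : K) : A[X] →ₐ[K] A[X] :=
  (Polynomial.taylorAlgHom (-algebraMap K A c)).restrictScalars K

theorem spectralShift_apply (c : K) (F : A[X]) :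
    spectralShift A c F = F.comp (Polynomial.X - Polynomial.C (algebraMap K A c)) := by
  rw [sub_eq_add_neg, ← map_neg]
  rfl

theorem spectralShift_polyDerivation (c : K) (F : A[X]) :
    spectralShift A c (polyDerivation D F) = polyDerivation D (spectralShift A c F) := by
  induction F using Polynomial.induction_on' with
  | add F G hF hG => simp only [map_add, hF, hG]
  | monomial n a =>
    have hX : polyDerivation D (Polynomial.X - Polynomial.C (algebraMap K A c)) = 0 := by
      rw [map_sub, polyDerivation_X, polyDerivation_C, D.map_algebraMap, map_zero, sub_zero]
    have hmonomial (b : A) : spectralShift A c (Polynomial.monomial n b) =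
        Polynomial.C b * (Polynomial.X - Polynomial.C (algebraMap K A c)) ^ n := by
      rw [spectralShift_apply, Polynomial.monomial_comp]
    have hderiv : polyDerivation D (Polynomial.monomial n a) = Polynomial.monomial n (D a) := by
      ext k
      rw [coeff_polyDerivation, Polynomial.coeff_monomial, Polynomial.coeff_monomial, apply_ite D,
        map_zero]
    rw [hderiv, hmonomial, hmonomial, Derivation.leibniz, Derivation.leibniz_pow, hX, smul_zero,
      smul_zero, smul_zero, zero_add, polyDerivation_C, smul_eq_mul, mul_comm]

theorem spectralShift_X (c : K) :
    spectralShift A c Polynomial.X = Polynomial.X - Polynomial.C (algebraMap K A c) := by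
  rw [spectralShift_apply, Polynomial.X_comp]

theorem spectralShift_C (c : K) (a : A) :
    spectralShift A c (Polynomial.C a) = Polynomial.C a := by
  rw [spectralShift_apply, Polynomial.C_comp]

theorem IsKdVPoly.spectralShift (h : IsKdVPoly D q F) (c : K) :
    IsKdVPoly D (q + algebraMap K A c) (spectralShift A c F) := by
  have hF := congrArg (HalphenKdV.spectralShift A c) h
  rw [map_kdvOp _ (spectralShift_polyDerivation c), spectralShift_C, map_mul, spectralShift_X,
    spectralShift_polyDerivation] at hF
  rw [IsKdVPoly, map_add, kdvOp_add_left, hF, crossOp, polyDerivation_C, D.map_algebraMap, map_zero,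
    zero_mul, smul_zero]
  ring

theorem polyCurve_spectralShift (c : K) (q : A) (F : A[X]) :
    polyCurve D (q + algebraMap K A c) (spectralShift A c F) =
      spectralShift A c (polyCurve D q F) := by
  rw [polyCurve, polyCurve, map_sub, map_kdvForm _ (spectralShift_polyDerivation c),
    spectralShift_C, map_mul, map_pow, spectralShift_X, kdvForm, kdvForm, map_add]
  ring

theorem eval_polyCurve (e : K) :
    (polyCurve D q F).eval (algebraMap K A e) =
      -kdvForm D (q - algebraMap K A e) (F.eval (algebraMap K A e))
        (F.eval (algebraMap K A e)) := by
  have heval (P : A[X]) : P.eval (algebraMap K A e) = (spectralShift A (-e) P).coeff 0 := by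
    rw [spectralShift_apply, map_neg, map_neg, sub_neg_eq_add, ← Polynomial.taylor_apply,
      Polynomial.taylor_coeff_zero]
  rw [heval, heval, ← polyCurve_spectralShift, map_neg, ← sub_eq_add_neg, polyCurve,
    Polynomial.coeff_sub, mul_comm, Polynomial.coeff_mul_X_zero, zero_sub, kdvForm, kdvForm]
  simp only [Polynomial.coeff_add, Polynomial.coeff_sub, Polynomial.coeff_smul,
    Polynomial.mul_coeff_zero, Polynomial.coeff_C_zero, coeff_polyDerivation]

theorem IsKdVPoly.polyDerivation_polyCurve [NeZero (2 : K)] (h : IsKdVPoly D q F) :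
    polyDerivation D (polyCurve D q F) = 0 := by
  rw [polyCurve, map_sub, derivation_kdvForm_self, h, Derivation.leibniz, polyDerivation_X,
    Derivation.leibniz_pow]
  simp only [smul_eq_mul, nsmul_eq_mul]
  push_cast
  ring

end PolynomialRecursion

section SpectralCurve

variable {q : RatFunc ℂ} {qInf : ℂ} {g : ℕ} {f : ℕ → RatFunc ℂ} {F : (RatFunc ℂ)[X]} {R : ℂ[X]}

theorem coeff_polyF (f : ℕ → RatFunc ℂ) (g i : ℕ) :
    (polyF f g).coeff i = if i ≤ g then f (g - i) else 0 := by
  simp only [polyF, Polynomial.finsetSum_coeff, Polynomial.coeff_C_mul_X_pow, Finset.sum_ite_eq,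
    Finset.mem_range, Nat.lt_succ_iff]

theorem polyF_ratDeriv (f : ℕ → RatFunc ℂ) (g : ℕ) :
    polyF (fun j => ratDeriv (f j)) g = polyDerivation ratDerivation (polyF f g) := by
  ext1 i
  rw [coeff_polyDerivation, coeff_polyF, coeff_polyF, apply_ite ratDerivation, map_zero]
  rfl

theorem polyR_eq_polyCurve (q : RatFunc ℂ) (f : ℕ → RatFunc ℂ) (g : ℕ) :
    polyR q f g = polyCurve ratDerivation q (polyF f g) := by
  have hsmul (c : ℂ) (P : (RatFunc ℂ)[X]) : Polynomial.C (RatFunc.C c) * P = c • P := by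
    ext1 i
    rw [Polynomial.coeff_C_mul, ratFunc_C_mul, Polynomial.coeff_smul]
  rw [polyR, polyF_ratDeriv, polyF_ratDeriv f, mul_assoc, hsmul, hsmul, polyCurve, kdvForm,
    sq (polyDerivation _ _)]
  ring

theorem natDegree_polyF (h : f 0 = 1) (g : ℕ) : (polyF f g).natDegree = g := by
  refine Polynomial.natDegree_eq_of_le_of_coeff_ne_zero ?_ (n := g) ?_
  · exact Polynomial.natDegree_le_iff_coeff_eq_zero.2 fun i hi => by
      rw [coeff_polyF, if_neg (by omega)]
  · rw [coeff_polyF, if_pos le_rfl, Nat.sub_self, h]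
    exact one_ne_zero

theorem monic_polyF (h : f 0 = 1) (g : ℕ) : (polyF f g).Monic := by
  rw [Polynomial.Monic, Polynomial.leadingCoeff, natDegree_polyF h, coeff_polyF, if_pos le_rfl,
    Nat.sub_self, h]

theorem IsKdVSequence.isKdVPoly (h : IsKdVSequence q g f) :
    IsKdVPoly ratDerivation q (polyF f g) := by
  have hf := isKdVSequence_iff.1 h
  refine isKdVPoly_iff.2 ⟨?_, fun n => ?_⟩
  · rw [coeff_polyF, if_pos g.zero_le, Nat.sub_zero, ← hf.succ g le_rfl, hf.kdv]
  · rw [coeff_polyF, coeff_polyF]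
    rcases lt_trichotomy n g with hn | rfl | hn
    · rw [if_pos (by omega), if_pos hn.le, ← hf.succ _ (by omega)]
      congr 2
      omega
    · rw [if_neg (by omega), if_pos le_rfl, Nat.sub_self, hf.zero, Derivation.map_one_eq_zero]
      simp only [kdvOp, crossOp, map_zero, mul_zero, smul_zero, add_zero]
    · rw [if_neg (by omega), if_neg (by omega), map_zero]
      simp only [kdvOp, crossOp, map_zero, mul_zero, smul_zero, add_zero]

theorem IsKdVPoly.exists_isKdVSequence (h : IsKdVPoly ratDerivation q F) (hF : F.Monic) :
    ∃ f, IsKdVSequence q F.natDegree f ∧ polyF f F.natDegree = F := by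
  obtain ⟨hzero, hsucc⟩ := isKdVPoly_iff.1 h
  set f : ℕ → RatFunc ℂ := fun j => if j ≤ F.natDegree then F.coeff (F.natDegree - j) else 0
  have hf {j : ℕ} (hj : j ≤ F.natDegree) : f j = F.coeff (F.natDegree - j) := if_pos hj
  have hlast : f (F.natDegree + 1) = 0 := if_neg (by omega)
  refine ⟨f, isKdVSequence_iff.2 ⟨?_, fun j hj => ?_, by rw [hlast, map_zero]⟩, ?_⟩
  · rw [hf (Nat.zero_le _), Nat.sub_zero, hF.coeff_natDegree]
  · rw [hf hj]
    rcases hj.lt_or_eq with hlt | rfl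
    · rw [hf hlt, ← hsucc, show F.natDegree - (j + 1) + 1 = F.natDegree - j by omega]
    · rw [hlast, Nat.sub_self, hzero, map_zero]
  · ext1 i
    rw [coeff_polyF]
    split_ifs with hi
    · rw [hf (Nat.sub_le _ _), Nat.sub_sub_self hi]
    · rw [Polynomial.coeff_eq_zero_of_natDegree_lt (by omega)]

theorem IsKdVSequence.exists_add_C (h : IsKdVSequence q g f) (c : ℂ) :
    ∃ f', IsKdVSequence (q + RatFunc.C c) g f' ∧
      polyR (q + RatFunc.C c) f' g =
        (polyR q f g).comp (Polynomial.X - Polynomial.C (RatFunc.C c)) := by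
  have hpoly := h.isKdVPoly.spectralShift c
  have hmonic : (spectralShift (RatFunc ℂ) c (polyF f g)).Monic := by
    rw [spectralShift_apply]
    exact (monic_polyF h.zero g).comp_X_sub_C _
  obtain ⟨f', hf', hF'⟩ := hpoly.exists_isKdVSequence hmonic
  have hdeg : (spectralShift (RatFunc ℂ) c (polyF f g)).natDegree = g := by
    rw [spectralShift_apply, Polynomial.natDegree_comp, Polynomial.natDegree_X_sub_C, mul_one,
      natDegree_polyF h.zero]
  rw [hdeg] at hf' hF'
  refine ⟨f', hf', ?_⟩
  rw [polyR_eq_polyCurve, polyR_eq_polyCurve, hF', ← RatFunc.algebraMap_eq_C,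
    polyCurve_spectralShift, spectralShift_apply]

theorem SolvesStationaryKdV.add_C (h : SolvesStationaryKdV q g) (c : ℂ) :
    SolvesStationaryKdV (q + RatFunc.C c) g := by
  obtain ⟨f, hf⟩ := h
  obtain ⟨f', hf', -⟩ := hf.exists_add_C c
  exact ⟨f', hf'⟩

theorem IsKdVSequence.exists_polyR_eq_map (h : IsKdVSequence q g f) :
    ∃ R : ℂ[X], polyR q f g = R.map RatFunc.C := by
  have hderiv := h.isKdVPoly.polyDerivation_polyCurve
  rw [← polyR_eq_polyCurve] at hderiv
  obtain ⟨R, hR⟩ := (Polynomial.lifts_iff_coeff_lifts (f := RatFunc.C) (polyR q f g)).2 fun n => by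
    obtain ⟨c, hc⟩ := exists_eq_C_of_ratDerivation_eq_zero (f := (polyR q f g).coeff n) (by
      rw [← coeff_polyDerivation, hderiv, Polynomial.coeff_zero])
    exact ⟨c, hc.symm⟩
  exact ⟨R, hR.symm⟩

theorem OrdGE.coeff_zero_kdvForm_infty {K : Type*} [Field K] {q f : K⸨X⸩} (hq : OrdGE 0 q)
    (hf : OrdGE 0 f) :
    (kdvForm (inftyDeriv K) q f f).coeff 0 = q.coeff 0 * f.coeff 0 ^ 2 := by
  have hsecond := (hf.inftyDeriv.inftyDeriv.mul hf).smul (1 / 2 : K)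
  have hfirst := (hf.inftyDeriv.mul hf.inftyDeriv).smul (1 / 4 : K)
  have hqff := hq.coeff_mul (hf.mul hf)
  rw [add_zero, add_zero] at hqff
  rw [kdvForm, HahnSeries.coeff_add, HahnSeries.coeff_sub, hsecond 0 (by norm_num),
    hfirst 0 (by norm_num), hqff, sub_zero, zero_add]
  have hff := hf.coeff_mul hf
  rw [add_zero] at hff
  rw [hff, sq]

/-- Only the term `(E - q) F²` of the curve survives at `z = ∞`. -/
theorem IsKdVSequence.eval_eq (h : IsKdVSequence q g f)
    (hR : polyR q f g = R.map RatFunc.C) (e : ℂ) :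
    R.eval e = (e - (laurentInfty q).coeff 0) *
      (∑ j ∈ Finset.range (g + 1), (laurentInfty (f (g - j))).coeff 0 * e ^ j) ^ 2 := by
  have hinfty := (isKdVSequence_iff.1 h).map laurentInfty laurentInfty_ratDerivation
  have hF : laurentInfty ((polyF f g).eval (algebraMap ℂ (RatFunc ℂ) e)) =
      ∑ j ∈ Finset.range (g + 1), e ^ j • laurentInfty (f (g - j)) := by
    simp only [polyF, Polynomial.eval_finsetSum, Polynomial.eval_mul, Polynomial.eval_C,
      Polynomial.eval_pow, Polynomial.eval_X, ← map_pow, ← Algebra.commutes, ← Algebra.smul_def,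
      map_sum, map_smul]
  have hF_ord : OrdGE 0 (laurentInfty ((polyF f g).eval (algebraMap ℂ (RatFunc ℂ) e))) := by
    rw [hF]
    exact OrdGE.sum _ fun j _ => (hinfty.ordGE_zero_infty hinfty.ordGE_infty (by omega)).smul _
  have heval := congrArg (fun P => (laurentInfty (P.eval (algebraMap ℂ (RatFunc ℂ) e))).coeff 0)
    ((polyR_eq_polyCurve q f g).symm.trans hR)
  have hq_ord : OrdGE 0 (laurentInfty q - HahnSeries.C e) := hinfty.ordGE_infty.sub (OrdGE.const e)
  simp only [eval_polyCurve, map_neg, map_kdvForm _ laurentInfty_ratDerivation, map_sub] at heval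
  simp only [RatFunc.algebraMap_eq_C, Polynomial.eval_map_apply, laurentInfty_C] at heval hF hF_ord
  rw [HahnSeries.coeff_neg, hq_ord.coeff_zero_kdvForm_infty hF_ord, hF, HahnSeries.coeff_sub,
    HahnSeries.C_apply, HahnSeries.C_apply, HahnSeries.coeff_single_same,
    HahnSeries.coeff_single_same, HahnSeries.coeff_sum] at heval
  simp only [HahnSeries.coeff_smul, smul_eq_mul] at heval
  simp only [mul_comm _ (e ^ _)]
  linear_combination -heval

theorem SolvesStationaryKdV.le_of_isLocusData {M : ℕ} {s : Fin M → ℕ} {ζ : Fin M → ℂ} {w : ℕ}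
    (h : SolvesStationaryKdV q g) (hl : IsLocusData q qInf s ζ)
    (hw : ∑ l, s l * (s l + 1) = w * (w + 1)) : w ≤ g := by
  obtain ⟨f, hf⟩ := h.add_C (-qInf)
  rw [map_neg, ← sub_eq_add_neg, isKdVSequence_iff] at hf
  obtain ⟨hord, hcoeff⟩ := hl.laurentInfty_sub_C
  refine (hf.map laurentInfty laurentInfty_ratDerivation).le_of_coeff_two hord ?_
  rw [hcoeff, neg_inj]
  exact_mod_cast hw

theorem polyR_kdvSeq (hq : OrdGE 2 (laurentInfty q)) (h : kdvSeq ratDerivation q (g + 1) = 0) :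
    polyR q (kdvSeq ratDerivation q) g = (Polynomial.X ^ (2 * g + 1)).map RatFunc.C := by
  have hseq : IsKdVSequence q g (kdvSeq ratDerivation q) :=
    isKdVSequence_iff.2 (isStationaryKdV_kdvSeq h)
  obtain ⟨R, hR⟩ := hseq.exists_polyR_eq_map
  have hcoeff (n : ℕ) :
      (laurentInfty (kdvSeq ratDerivation q n)).coeff 0 = if n = 0 then 1 else 0 := by
    rw [map_kdvSeq _ laurentInfty_ratDerivation]
    split_ifs with hn
    · rw [hn, kdvSeq_zero, HahnSeries.coeff_one, if_pos rfl]
    · exact ordGE_kdvSeq_infty hq n 0 (by omega)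
  rw [hR, Polynomial.funext (p := R) (q := Polynomial.X ^ (2 * g + 1)) fun e => ?_]
  rw [hseq.eval_eq hR, hq 0 two_pos, Finset.sum_range_succ, Finset.sum_eq_zero fun j hj => ?_,
    hcoeff, Nat.sub_self, if_pos rfl, Polynomial.eval_pow, Polynomial.eval_X]
  · ring
  · rw [hcoeff, if_neg (Nat.sub_ne_zero_of_lt (Finset.mem_range.1 hj)), zero_mul]

theorem IsLocusData.exists_hasSpectralCurve {M : ℕ} {s : Fin M → ℕ} {ζ : Fin M → ℂ}
    (h : IsLocusData q qInf s ζ) :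
    ∃ g : ℕ, 1 ≤ g ∧ ∑ l, s l * (s l + 1) = g * (g + 1) ∧
      HasSpectralCurve q g ((Polynomial.X - Polynomial.C qInf) ^ (2 * g + 1)) := by
  obtain ⟨g, hpos, hg, hzero⟩ := h.exists_genus
  obtain ⟨f, hf, hR⟩ := (isKdVSequence_iff.2
    (isStationaryKdV_kdvSeq (hzero (g + 1) g.lt_succ_self))).exists_add_C qInf
  rw [polyR_kdvSeq h.laurentInfty_sub_C.1 (hzero (g + 1) g.lt_succ_self)] at hR
  rw [sub_add_cancel] at hf hR
  refine ⟨g, hpos, hg, ⟨f, hf, ?_⟩, fun g' hg' hsolves => ?_⟩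
  · rw [hR, ← Polynomial.map_X RatFunc.C, ← Polynomial.map_C, ← Polynomial.map_sub,
      ← Polynomial.map_comp, Polynomial.X_pow_comp]
  · exact hg'.not_ge (hsolves.le_of_isLocusData h hg)

theorem HasSpectralCurve.genus_unique {R' : ℂ[X]} {g' : ℕ} (h : HasSpectralCurve q g R)
    (h' : HasSpectralCurve q g' R') : g = g' := by
  obtain ⟨⟨f, hf, -⟩, hmin⟩ := h
  obtain ⟨⟨f', hf', -⟩, hmin'⟩ := h'
  exact le_antisymm (le_of_not_gt fun hlt => hmin g' hlt ⟨f', hf'⟩)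
    (le_of_not_gt fun hlt => hmin' g hlt ⟨f, hf⟩)

theorem HasSpectralCurve.eval_coeff_zero (h : HasSpectralCurve q g R) :
    R.eval ((laurentInfty q).coeff 0) = 0 := by
  obtain ⟨⟨f, hf, hR⟩, -⟩ := h
  rw [hf.eval_eq hR, sub_self, zero_mul]

theorem IsLocusData.coeff_zero_laurentInfty {M : ℕ} {s : Fin M → ℕ} {ζ : Fin M → ℂ}
    (h : IsLocusData q qInf s ζ) : (laurentInfty q).coeff 0 = qInf := by
  have hord := h.laurentInfty_sub_C.1 0 two_pos
  rwa [map_sub, laurentInfty_C, HahnSeries.coeff_sub, HahnSeries.C_apply,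
    HahnSeries.coeff_single_same, sub_eq_zero] at hord

theorem mul_self_succ_injective : Function.Injective fun n : ℕ => n * (n + 1) :=
  StrictMono.injective fun a b hab => Nat.mul_lt_mul_of_lt_of_le hab (by omega) (by omega)

theorem hasSpectralCurve_iff (hq : ∀ c : ℂ, q ≠ RatFunc.C c) (g : ℕ) (qInf : ℂ) :
    HasSpectralCurve q g ((Polynomial.X - Polynomial.C qInf) ^ (2 * g + 1)) ↔
      ∃ (M : ℕ) (s : Fin M → ℕ) (ζ : Fin M → ℂ),
        IsLocusData q qInf s ζ ∧ ∑ l, s l * (s l + 1) = g * (g + 1) := by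
  constructor
  · intro h
    obtain ⟨⟨f, hf, -⟩, -⟩ := id h
    obtain ⟨M, s, c, ζ, hl⟩ := IsKdVPotential.exists_isLocusData hq ⟨g, f, hf⟩
    obtain ⟨g', -, hsum, hcurve⟩ := hl.exists_hasSpectralCurve
    obtain rfl := h.genus_unique hcurve
    have hroot := h.eval_coeff_zero
    rw [hl.coeff_zero_laurentInfty, Polynomial.eval_pow, Polynomial.eval_sub, Polynomial.eval_X,
      Polynomial.eval_C] at hroot
    obtain rfl : c = qInf := sub_eq_zero.1 (eq_zero_of_pow_eq_zero hroot)
    exact ⟨M, s, ζ, hl, hsum⟩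
  · rintro ⟨M, s, ζ, hl, hsum⟩
    obtain ⟨g', -, hsum', hcurve⟩ := hl.exists_hasSpectralCurve
    rwa [mul_self_succ_injective (hsum.symm.trans hsum')]

end SpectralCurve

/-! ### Laurent series of meromorphic functions -/

section Taylor

open Filter Topology

/-- The Taylor series of `f` at `α`, as a formal Laurent series in powers of `z - α`. -/
def taylorSeries (α : ℂ) (f : ℂ → ℂ) : ℂ⸨X⸩ :=
  HahnSeries.ofPowerSeries ℤ ℂ (PowerSeries.mk fun n => iteratedDeriv n f α / n.factorial)

variable {α : ℂ} {f g : ℂ → ℂ}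

theorem coeff_taylorSeries (α : ℂ) (f : ℂ → ℂ) (n : ℕ) :
    (taylorSeries α f).coeff n = iteratedDeriv n f α / n.factorial := by
  rw [taylorSeries, HahnSeries.ofPowerSeries_apply_coeff, PowerSeries.coeff_mk]

theorem ordGE_taylorSeries (α : ℂ) (f : ℂ → ℂ) : OrdGE 0 (taylorSeries α f) :=
  ordGE_ofPowerSeries _

theorem taylorSeries_congr (h : f =ᶠ[𝓝 α] g) : taylorSeries α f = taylorSeries α g := by
  simp only [taylorSeries, fun n => h.iteratedDeriv_eq n]

theorem taylorSeries_add (hf : AnalyticAt ℂ f α) (hg : AnalyticAt ℂ g α) :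
    taylorSeries α (fun z => f z + g z) = taylorSeries α f + taylorSeries α g := by
  rw [taylorSeries, taylorSeries, taylorSeries, ← map_add]
  congr 1
  ext n
  rw [map_add, PowerSeries.coeff_mk, PowerSeries.coeff_mk, PowerSeries.coeff_mk,
    iteratedDeriv_fun_add hf.contDiffAt hg.contDiffAt, add_div]

theorem taylorSeries_mul (hf : AnalyticAt ℂ f α) (hg : AnalyticAt ℂ g α) :
    taylorSeries α (fun z => f z * g z) = taylorSeries α f * taylorSeries α g := by
  rw [taylorSeries, taylorSeries, taylorSeries, ← map_mul]
  congr 1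
  ext n
  rw [PowerSeries.coeff_mul, PowerSeries.coeff_mk,
    iteratedDeriv_fun_mul hf.contDiffAt hg.contDiffAt,
    Finset.Nat.sum_antidiagonal_eq_sum_range_succ_mk, Finset.sum_div]
  refine Finset.sum_congr rfl fun i hi => ?_
  rw [PowerSeries.coeff_mk, PowerSeries.coeff_mk,
    Nat.cast_choose ℂ (Nat.lt_succ_iff.1 (Finset.mem_range.1 hi))]
  have hfactorial : (n.factorial : ℂ) ≠ 0 := by exact_mod_cast n.factorial_ne_zero
  field_simp

theorem taylorSeries_const (α c : ℂ) : taylorSeries α (fun _ => c) = HahnSeries.C c := by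
  rw [taylorSeries, ← HahnSeries.ofPowerSeries_C]
  congr 1
  ext n
  rw [PowerSeries.coeff_mk, iteratedDeriv_const, PowerSeries.coeff_C]
  split_ifs with hn <;> simp [hn]

theorem taylorSeries_deriv (α : ℂ) (f : ℂ → ℂ) :
    taylorSeries α (deriv f) = laurentDeriv ℂ (taylorSeries α f) := by
  ext i
  rcases lt_or_ge i 0 with hi | hi
  · rw [ordGE_taylorSeries α _ i hi, (ordGE_taylorSeries α f).laurentDeriv_of_zero i hi]
  · obtain ⟨n, rfl⟩ := Int.eq_ofNat_of_zero_le hi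
    have hcoeff := coeff_taylorSeries α f (n + 1)
    push_cast at hcoeff
    rw [coeff_taylorSeries, coeff_laurentDeriv, hcoeff, iteratedDeriv_succ', Nat.factorial_succ]
    have hn : ((n : ℂ) + 1) ≠ 0 := by exact_mod_cast n.succ_ne_zero
    push_cast
    field_simp

theorem taylorSeries_id (α : ℂ) : taylorSeries α (fun z => z) = laurentAt α RatFunc.X := by
  have hderiv : laurentDeriv ℂ (taylorSeries α fun z => z) =
      laurentDeriv ℂ (laurentAt α RatFunc.X) := by
    rw [← taylorSeries_deriv, deriv_id'', taylorSeries_const, laurentDeriv_laurentAt_X, map_one]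
  ext i
  rcases eq_or_ne i 0 with rfl | hi
  · have hcoeff := coeff_taylorSeries α (fun z => z) 0
    rw [Nat.cast_zero] at hcoeff
    rw [hcoeff, ← RatFunc.algebraMap_X, coeff_zero_laurentAt_algebraMap]
    simp
  · rw [← sub_eq_zero, ← HahnSeries.coeff_sub]
    refine coeff_eq_zero_of_coeff_laurentDeriv hi ?_
    rw [map_sub, hderiv, sub_self, HahnSeries.coeff_zero]

theorem analyticAt_eval (p : ℂ[X]) (α : ℂ) : AnalyticAt ℂ (fun z => p.eval z) α :=
  AnalyticOnNhd.eval_polynomial p α (Set.mem_univ α)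

theorem taylorSeries_eval (p : ℂ[X]) (α : ℂ) :
    taylorSeries α (fun z => p.eval z) = laurentAt α (algebraMap ℂ[X] (RatFunc ℂ) p) := by
  induction p using Polynomial.induction_on with
  | C a => simp only [Polynomial.eval_C, taylorSeries_const, RatFunc.algebraMap_C, laurentAt_C]
  | add p q hp hq =>
    simp only [Polynomial.eval_add]
    rw [taylorSeries_add (analyticAt_eval p α) (analyticAt_eval q α), hp, hq, map_add, map_add]
  | monomial n a ih =>
    rw [pow_succ, ← mul_assoc, map_mul, map_mul, ← ih, RatFunc.algebraMap_X]
    simp only [Polynomial.eval_mul_X]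
    have hid : AnalyticAt ℂ (fun z => z) α := analyticAt_id
    rw [taylorSeries_mul (analyticAt_eval _ α) hid, taylorSeries_id]

theorem taylorSeries_sub_pow (α : ℂ) (n : ℕ) :
    taylorSeries α (fun z => (z - α) ^ n) = HahnSeries.single 1 1 ^ n := by
  have h := taylorSeries_eval ((Polynomial.X - Polynomial.C α) ^ n) α
  simp only [Polynomial.eval_pow, Polynomial.eval_sub, Polynomial.eval_X, Polynomial.eval_C] at h
  rw [h, map_pow, map_pow, map_sub, map_sub, RatFunc.algebraMap_X, RatFunc.algebraMap_C,
    laurentAt_X, laurentAt_C, add_sub_cancel_right]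

theorem eventually_eq_zero_of_taylorSeries (hf : AnalyticAt ℂ f α) (h : taylorSeries α f = 0) :
    ∀ᶠ z in 𝓝 α, f z = 0 := by
  have hseries := hf.hasFPowerSeriesAt
  have hcoeff : (fun n : ℕ => iteratedDeriv n f α / (n.factorial : ℂ)) = 0 := by
    funext n
    rw [← coeff_taylorSeries, h]
    rfl
  rw [hcoeff, FormalMultilinearSeries.ofScalars_series_eq_zero_of_scalar_zero] at hseries
  exact hseries.eventually_eq_zero

end Taylor

section LaurentSeriesAt

open Filter Topology

/-- The function `f` is meromorphic at `α` and `F` is its Laurent series in powers of `z - α`; the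
value of `f` at `α` itself is irrelevant. -/
def HasLaurentSeriesAt (f : ℂ → ℂ) (α : ℂ) (F : ℂ⸨X⸩) : Prop :=
  ∃ (n : ℕ) (g : ℂ → ℂ), AnalyticAt ℂ g α ∧ (∀ᶠ z in 𝓝[≠] α, (z - α) ^ n * f z = g z) ∧
    HahnSeries.single 1 1 ^ n * F = taylorSeries α g

variable {α : ℂ} {f g : ℂ → ℂ} {F G : ℂ⸨X⸩}

theorem analyticAt_sub_pow (α : ℂ) (n : ℕ) (z : ℂ) : AnalyticAt ℂ (fun w => (w - α) ^ n) z :=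
  (analyticAt_id.sub analyticAt_const).pow n

theorem single_one_pow_ne_zero (n : ℕ) : (HahnSeries.single 1 1 ^ n : ℂ⸨X⸩) ≠ 0 :=
  pow_ne_zero n (by simp)

theorem hasLaurentSeriesAt_of_analyticAt (hf : AnalyticAt ℂ f α) :
    HasLaurentSeriesAt f α (taylorSeries α f) :=
  ⟨0, f, hf, by simp, by rw [pow_zero, one_mul]⟩

theorem exists_hasLaurentSeriesAt (hf : MeromorphicAt f α) : ∃ F, HasLaurentSeriesAt f α F := by
  obtain ⟨n, hn⟩ := hf
  refine ⟨(HahnSeries.single 1 1 ^ n)⁻¹ * taylorSeries α fun z => (z - α) ^ n * f z, n, _, hn, ?_,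
    mul_inv_cancel_left₀ (single_one_pow_ne_zero n) _⟩
  exact Eventually.of_forall fun z => rfl

theorem HasLaurentSeriesAt.meromorphicAt (hf : HasLaurentSeriesAt f α F) : MeromorphicAt f α := by
  obtain ⟨n, g, hg, hfg, -⟩ := hf
  refine (hg.meromorphicAt.div (analyticAt_sub_pow α n α).meromorphicAt).congr ?_
  filter_upwards [hfg, self_mem_nhdsWithin] with z hz hzα
  rw [Pi.div_apply, ← hz, mul_div_cancel_left₀ _ (pow_ne_zero n (sub_ne_zero.2 hzα))]

theorem HasLaurentSeriesAt.congr (hf : HasLaurentSeriesAt f α F)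
    (h : ∀ᶠ z in 𝓝[≠] α, f z = g z) : HasLaurentSeriesAt g α F := by
  obtain ⟨n, u, hu, hfu, hF⟩ := hf
  refine ⟨n, u, hu, ?_, hF⟩
  filter_upwards [hfu, h] with z hz hfg
  rw [← hfg, hz]

theorem HasLaurentSeriesAt.add (hf : HasLaurentSeriesAt f α F) (hg : HasLaurentSeriesAt g α G) :
    HasLaurentSeriesAt (fun z => f z + g z) α (F + G) := by
  obtain ⟨m, u, hu, hfu, hF⟩ := hf
  obtain ⟨n, v, hv, hgv, hG⟩ := hg
  have hnu := (analyticAt_sub_pow α n α).fun_mul hu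
  have hmv := (analyticAt_sub_pow α m α).fun_mul hv
  refine ⟨m + n, _, hnu.fun_add hmv, ?_, ?_⟩
  · filter_upwards [hfu, hgv] with z hfz hgz
    rw [← hfz, ← hgz]
    ring
  · rw [taylorSeries_add hnu hmv, taylorSeries_mul (analyticAt_sub_pow α n α) hu,
      taylorSeries_mul (analyticAt_sub_pow α m α) hv, taylorSeries_sub_pow, taylorSeries_sub_pow,
      ← hF, ← hG]
    ring

theorem HasLaurentSeriesAt.mul (hf : HasLaurentSeriesAt f α F) (hg : HasLaurentSeriesAt g α G) :
    HasLaurentSeriesAt (fun z => f z * g z) α (F * G) := by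
  obtain ⟨m, u, hu, hfu, hF⟩ := hf
  obtain ⟨n, v, hv, hgv, hG⟩ := hg
  refine ⟨m + n, _, hu.fun_mul hv, ?_, ?_⟩
  · filter_upwards [hfu, hgv] with z hfz hgz
    rw [← hfz, ← hgz]
    ring
  · rw [taylorSeries_mul hu hv, ← hF, ← hG]
    ring

theorem HasLaurentSeriesAt.const_mul (c : ℂ) (hf : HasLaurentSeriesAt f α F) :
    HasLaurentSeriesAt (fun z => c * f z) α (c • F) := by
  rw [← HahnSeries.C_mul_eq_smul, ← taylorSeries_const α c]
  exact (hasLaurentSeriesAt_of_analyticAt analyticAt_const).mul hf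

theorem laurentDeriv_single_one_pow_mul (n : ℕ) (F : ℂ⸨X⸩) :
    HahnSeries.single 1 1 * laurentDeriv ℂ (HahnSeries.single 1 1 ^ n * F) =
      (n : ℂ⸨X⸩) * (HahnSeries.single 1 1 ^ n * F) +
        HahnSeries.single 1 1 ^ (n + 1) * laurentDeriv ℂ F := by
  have hsingle : laurentDeriv ℂ (HahnSeries.single 1 1) = 1 := by
    simpa [laurentAt_X] using laurentDeriv_laurentAt_X (0 : ℂ)
  rcases n with _ | n
  · simp
  · rw [Derivation.leibniz, Derivation.leibniz_pow, hsingle, Nat.add_sub_cancel]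
    simp only [smul_eq_mul, nsmul_eq_mul]
    ring

theorem deriv_eq_of_eventually_pow_mul_eq {n : ℕ} {z : ℂ} (hz : z ≠ α) (hg : AnalyticAt ℂ g z)
    (h : ∀ᶠ w in 𝓝 z, (w - α) ^ n * f w = g w) :
    (z - α) ^ (n + 1) * deriv f z = (z - α) * deriv g z - n * g z := by
  have hf : f =ᶠ[𝓝 z] fun w => g w / (w - α) ^ n := by
    filter_upwards [h, eventually_ne_nhds hz] with w hw hwα
    rw [← hw, mul_div_cancel_left₀ _ (pow_ne_zero n (sub_ne_zero.2 hwα))]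
  have hzα : z - α ≠ 0 := sub_ne_zero.2 hz
  have hpow : HasDerivAt (fun w => (w - α) ^ n) (n * (z - α) ^ (n - 1) * 1) z :=
    ((hasDerivAt_id z).sub_const α).pow n
  rw [hf.deriv_eq, (hg.differentiableAt.hasDerivAt.fun_div hpow (pow_ne_zero n hzα)).deriv]
  rcases n with _ | n
  · simp
  · rw [Nat.add_sub_cancel]
    field_simp
    ring

protected theorem HasLaurentSeriesAt.deriv (hf : HasLaurentSeriesAt f α F) :
    HasLaurentSeriesAt (deriv f) α (laurentDeriv ℂ F) := by
  obtain ⟨n, g, hg, hfg, hF⟩ := hf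
  have hid := analyticAt_sub_pow α 1 α
  simp only [pow_one] at hid
  have hzg := hid.fun_mul hg.deriv
  have hng := (analyticAt_const (v := -(n : ℂ))).fun_mul hg
  refine ⟨n + 1, fun z => (z - α) * deriv g z + -(n : ℂ) * g z, hzg.fun_add hng, ?_, ?_⟩
  · filter_upwards [eventually_eventually_nhdsWithin.2 hfg, self_mem_nhdsWithin,
      hg.eventually_analyticAt.filter_mono nhdsWithin_le_nhds] with z hz hzα hgz
    rw [isOpen_compl_singleton.nhdsWithin_eq hzα] at hz
    rw [deriv_eq_of_eventually_pow_mul_eq hzα hgz hz, neg_mul, sub_eq_add_neg]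
  · have hsub : taylorSeries α (fun z => z - α) = HahnSeries.single 1 1 := by
      simpa using taylorSeries_sub_pow α 1
    rw [taylorSeries_add hzg hng, taylorSeries_mul hid hg.deriv,
      taylorSeries_mul analyticAt_const hg, taylorSeries_deriv, taylorSeries_const, hsub, ← hF,
      map_neg, map_natCast, laurentDeriv_single_one_pow_mul]
    ring

theorem HasLaurentSeriesAt.eventually_eq_zero_iff (hf : HasLaurentSeriesAt f α F) :
    (∀ᶠ z in 𝓝[≠] α, f z = 0) ↔ F = 0 := by
  obtain ⟨n, g, hg, hfg, hF⟩ := hf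
  constructor
  · intro hzero
    have hgzero : ∀ᶠ z in 𝓝 α, g z = 0 := by
      rw [← hg.frequently_zero_iff_eventually_zero]
      refine Eventually.frequently ?_
      filter_upwards [hfg, hzero] with z hz hfz
      rw [← hz, hfz, mul_zero]
    rw [taylorSeries_congr hgzero, taylorSeries_const, map_zero] at hF
    exact (mul_eq_zero.1 hF).resolve_left (single_one_pow_ne_zero n)
  · rintro rfl
    rw [mul_zero] at hF
    have hgzero := eventually_eq_zero_of_taylorSeries hg hF.symm
    filter_upwards [hfg, self_mem_nhdsWithin, hgzero.filter_mono nhdsWithin_le_nhds]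
      with z hz hzα hgz
    exact (mul_eq_zero.1 (hz.trans hgz)).resolve_left (pow_ne_zero n (sub_ne_zero.2 hzα))

theorem HasLaurentSeriesAt.unique (hF : HasLaurentSeriesAt f α F)
    (hG : HasLaurentSeriesAt f α G) : F = G := by
  have hzero := (hF.add (hG.const_mul (-1))).eventually_eq_zero_iff.1
    (Eventually.of_forall fun z => by ring)
  rwa [← HahnSeries.C_mul_eq_smul, map_neg, map_one, neg_one_mul, ← sub_eq_add_neg, sub_eq_zero]
    at hzero

theorem val_eq (q : RatFunc ℂ) (z : ℂ) : val q z = q.num.eval z / q.denom.eval z := by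
  simp only [val, RatFunc.eval, Polynomial.eval₂_id]

theorem hasLaurentSeriesAt_val (q : RatFunc ℂ) (α : ℂ) :
    HasLaurentSeriesAt (val q) α (laurentAt α q) := by
  have heval (p : ℂ[X]) := hasLaurentSeriesAt_of_analyticAt (analyticAt_eval p α)
  simp only [taylorSeries_eval] at heval
  have hmer : MeromorphicAt (val q) α :=
    ((analyticAt_eval q.num α).meromorphicAt.div (analyticAt_eval q.denom α).meromorphicAt).congr
      (Eventually.of_forall fun z => (val_eq q z).symm)
  obtain ⟨F, hF⟩ := exists_hasLaurentSeriesAt hmer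
  have hmul := ((heval q.denom).mul hF).congr (g := fun z => q.num.eval z) (by
    filter_upwards [(Polynomial.eventually_cofinite_not_isRoot q.denom_ne_zero).filter_mono
      (nhdsNE_le_cofinite α)] with z hz
    rw [val_eq, mul_div_cancel₀ _ hz])
  have hdenom : laurentAt α (algebraMap ℂ[X] (RatFunc ℂ) q.denom) ≠ 0 :=
    (map_ne_zero _).2 (RatFunc.algebraMap_ne_zero q.denom_ne_zero)
  convert hF
  conv_lhs => rw [← RatFunc.num_div_denom q, map_div₀, (heval q.num).unique hmul,
    mul_div_cancel_left₀ _ hdenom]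

end LaurentSeriesAt

section MeromorphicSolutions

open Filter Topology

variable {q : RatFunc ℂ}

theorem eventually_codiscrete_iff {p : ℂ → Prop} :
    (∀ᶠ z in codiscrete ℂ, p z) ↔ ∀ α, ∀ᶠ z in 𝓝[≠] α, p z := by
  simp only [Filter.Eventually, mem_codiscrete, disjoint_principal_right, compl_compl]

theorem eventually_codiscrete_eq_zero {f : ℂ → ℂ} (hf : Meromorphic f) {α : ℂ}
    (h : HasLaurentSeriesAt f α 0) : ∀ᶠ z in codiscrete ℂ, f z = 0 := by
  refine eventually_codiscrete_iff.2 fun β => ?_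
  rw [← meromorphicOrderAt_eq_top_iff]
  by_contra hβ
  exact hf.exists_meromorphicOrderAt_ne_top_iff_forall.1 ⟨β, hβ⟩ α
    (meromorphicOrderAt_eq_top_iff.2 (h.eventually_eq_zero_iff.2 rfl))

theorem HasLaurentSeriesAt.isFormalSolution_iff {E α : ℂ} {y : ℂ → ℂ} {Y : ℂ⸨X⸩}
    (hy : HasLaurentSeriesAt y α Y) :
    IsFormalSolution (laurentAt α q) E Y ↔
      ∀ᶠ z in 𝓝[≠] α, deriv (deriv y) z + val q z * y z = E * y z := by
  have hsum := (hy.deriv.deriv.add ((hasLaurentSeriesAt_val q α).mul hy)).add (hy.const_mul (-E))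
  rw [IsFormalSolution, ← sub_eq_zero, sub_eq_add_neg, ← neg_smul, ← hsum.eventually_eq_zero_iff]
  exact eventually_congr (Eventually.of_forall fun z => by
    rw [neg_mul, ← sub_eq_add_neg, sub_eq_zero])

theorem isMeromorphicSolution_iff {E : ℂ} {y : ℂ → ℂ} :
    IsMeromorphicSolution q E y ↔
      ∀ α, ∃ Y, HasLaurentSeriesAt y α Y ∧ IsFormalSolution (laurentAt α q) E Y := by
  constructor
  · rintro ⟨hmer, hsol⟩ α
    obtain ⟨Y, hY⟩ := exists_hasLaurentSeriesAt (hmer α)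
    exact ⟨Y, hY, hY.isFormalSolution_iff.2 (eventually_codiscrete_iff.1 hsol α)⟩
  · intro h
    refine ⟨fun α => (h α).choose_spec.1.meromorphicAt, eventually_codiscrete_iff.2 fun α => ?_⟩
    exact (h α).choose_spec.1.isFormalSolution_iff.1 (h α).choose_spec.2

theorem eventually_codiscrete_linearCombination_eq_zero_iff {y z : ℂ → ℂ} (hy : Meromorphic y)
    (hz : Meromorphic z) {α : ℂ} {Y Z : ℂ⸨X⸩} (hY : HasLaurentSeriesAt y α Y)
    (hZ : HasLaurentSeriesAt z α Z) (a b : ℂ) :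
    (∀ᶠ w in codiscrete ℂ, a * y w + b * z w = 0) ↔ a • Y + b • Z = 0 := by
  have hsum := (hY.const_mul a).add (hZ.const_mul b)
  refine ⟨fun h => hsum.eventually_eq_zero_iff.1 (eventually_codiscrete_iff.1 h α), fun h => ?_⟩
  refine eventually_codiscrete_eq_zero (fun w => ?_) (h ▸ hsum)
  exact ((MeromorphicAt.const a w).mul (hy w)).fun_add ((MeromorphicAt.const b w).mul (hz w))

theorem exists_localCond_of_hasMeromorphicFundamentalSystem
    (h : ∀ E, HasMeromorphicFundamentalSystem q E) (α : ℂ) : ∃ s, LocalCond (laurentAt α q) s := by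
  refine localCond_of_isFormalSolution fun E => ?_
  obtain ⟨y, z, hy, hz, hind⟩ := h E
  obtain ⟨Y, hY, hYsol⟩ := isMeromorphicSolution_iff.1 hy α
  obtain ⟨Z, hZ, hZsol⟩ := isMeromorphicSolution_iff.1 hz α
  refine ⟨Y, Z, hYsol, hZsol, LinearIndependent.pair_iff.2 fun a b hab => hind a b ?_⟩
  exact (eventually_codiscrete_linearCombination_eq_zero_iff hy.1 hz.1 hY hZ a b).2 hab

end MeromorphicSolutions

/-! ### Boundedness near infinity -/

section Infinity

open Filter Asymptotics Bornology

variable {q : RatFunc ℂ}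

theorem boundedNearInfinity_iff_isBoundedUnder :
    BoundedNearInfinity q ↔ IsBoundedUnder (· ≤ ·) (cobounded ℂ) fun z => ‖val q z‖ := by
  simp only [BoundedNearInfinity, IsBoundedUnder, Filter.IsBounded, eventually_map,
    Filter.atTop_basis.cobounded_of_norm.eventually_iff, true_and, Set.mem_preimage, Set.mem_Ici]
  exact exists_comm

theorem boundedNearInfinity_iff :
    BoundedNearInfinity q ↔ q.num.natDegree ≤ q.denom.natDegree := by
  have hdenom : ∀ᶠ z in cobounded ℂ, q.denom.eval z ≠ 0 :=
    (Polynomial.eventually_cofinite_not_isRoot q.denom_ne_zero).filter_mono (le_cofinite ℂ)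
  rw [boundedNearInfinity_iff_isBoundedUnder]
  simp only [val_eq]
  rw [← isBigO_iff_div_isBoundedUnder (hdenom.mono fun z hz h => (hz h).elim)]
  refine ⟨fun h => ?_, fun h => Polynomial.isBigO_cobounded_of_degree_le ?_⟩
  · by_contra! hlt
    refine isLittleO_irrefl hdenom.frequently <|
      (Polynomial.isLittleO_cobounded_of_degree_lt ?_).trans_isBigO h
    exact Polynomial.degree_lt_degree hlt
  · rw [Polynomial.degree_eq_natDegree q.denom_ne_zero]
    exact Polynomial.degree_le_of_natDegree_le h

theorem ordGE_laurentInfty_iff :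
    OrdGE 0 (laurentInfty q) ↔ q.num.natDegree ≤ q.denom.natDegree := by
  have hdenom := ordGE_laurentInfty_algebraMap (p := q.denom) le_rfl
  have hlead : (laurentInfty (algebraMap ℂ[X] (RatFunc ℂ) q.denom)).coeff
      (-q.denom.natDegree) ≠ 0 := by
    rw [coeff_laurentInfty_algebraMap]
    exact Polynomial.leadingCoeff_ne_zero.2 q.denom_ne_zero
  have hmul : laurentInfty q * laurentInfty (algebraMap ℂ[X] (RatFunc ℂ) q.denom) =
      laurentInfty (algebraMap ℂ[X] (RatFunc ℂ) q.num) := by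
    rw [← map_mul, (eq_div_iff (RatFunc.algebraMap_ne_zero q.denom_ne_zero)).1
      (RatFunc.num_div_denom q).symm]
  constructor
  · intro h
    refine Polynomial.natDegree_le_iff_coeff_eq_zero.2 fun n hn => ?_
    rw [← coeff_laurentInfty_algebraMap, ← hmul]
    exact h.mul hdenom _ (by omega)
  · intro hle
    refine hdenom.of_mul hlead ?_
    rw [mul_comm, hmul, add_zero]
    exact ordGE_laurentInfty_algebraMap hle

end Infinity

theorem IsHalphenPotential.exists_isLocusData {q : RatFunc ℂ} (hq : ∀ c : ℂ, q ≠ RatFunc.C c)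
    (h : IsHalphenPotential q) :
    ∃ (M : ℕ) (s : Fin M → ℕ) (qInf : ℂ) (ζ : Fin M → ℂ), IsLocusData q qInf s ζ :=
  exists_isLocusData_of_localCond hq (exists_localCond_of_hasMeromorphicFundamentalSystem h.2)
    (ordGE_laurentInfty_iff.2 (boundedNearInfinity_iff.1 h.1))

theorem IsLocusData.boundedNearInfinity {q : RatFunc ℂ} {qInf : ℂ} {M : ℕ} {s : Fin M → ℕ}
    {ζ : Fin M → ℂ} (h : IsLocusData q qInf s ζ) : BoundedNearInfinity q := by
  rw [boundedNearInfinity_iff, ← ordGE_laurentInfty_iff]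
  have hsum := (h.laurentInfty_sub_C.1.mono (by norm_num : (0 : ℤ) ≤ 2)).add (OrdGE.const qInf)
  rwa [map_sub, laurentInfty_C, sub_add_cancel] at hsum

/-! ### Operators lowering a filtration -/

section DegreeLowering

open Module

variable {K V : Type*} [Field K] [AddCommGroup V] [Module K V]

theorem finrank_map_add_finrank_inf_ker {W : Type*} [AddCommGroup W] [Module K W] (f : V →ₗ[K] W)
    (F : Submodule K V) [FiniteDimensional K F] :
    finrank K (F.map f) + finrank K (F ⊓ LinearMap.ker f : Submodule K V) = finrank K F := by
  have h := (f.domRestrict F).finrank_range_add_finrank_ker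
  rw [LinearMap.range_domRestrict, LinearMap.ker_domRestrict] at h
  rw [← h, ← Submodule.map_comap_subtype, Submodule.finrank_map_subtype_eq]

theorem exists_le_finrank_inf_ker {A : ℕ → Submodule K V} [∀ n, FiniteDimensional K (A n)]
    {C r : ℕ} (hA : ∀ n, n ≤ finrank K (A n) + C) {f : End K V}
    (hf : ∀ n, (A (n + r)).map f ≤ A n) :
    ∃ n, r ≤ finrank K (A n ⊓ LinearMap.ker f : Submodule K V) := by
  by_contra! hlt
  have hstep (n : ℕ) : finrank K (A (n + r)) + 1 ≤ finrank K (A n) + r := by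
    have hrank := finrank_map_add_finrank_inf_ker f (A (n + r))
    have hle := Submodule.finrank_mono (hf n)
    have hker := hlt (n + r)
    omega
  have hslow (m : ℕ) : finrank K (A (m * r)) + m ≤ finrank K (A 0) + m * r := by
    induction m with
    | zero => rw [Nat.zero_mul]
    | succ m ih =>
      have hm := hstep (m * r)
      rw [Nat.succ_mul]
      omega
  have hupper := hslow (finrank K (A 0) + C + 1)
  have hlower := hA ((finrank K (A 0) + C + 1) * r)
  omega

theorem le_finrank_degreeLT_inf_ker {W : Type*} [AddCommGroup W] [Module K W]
    [FiniteDimensional K W] (c : K[X] →ₗ[K] W) (n : ℕ) :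
    n ≤ finrank K (Polynomial.degreeLT K n ⊓ LinearMap.ker c : Submodule K K[X]) +
      finrank K W := by
  have := (Polynomial.degreeLTEquiv K n).symm.finiteDimensional
  have hdim : finrank K (Polynomial.degreeLT K n) = n := by
    rw [(Polynomial.degreeLTEquiv K n).finrank_eq, finrank_fin_fun]
  have hrank := finrank_map_add_finrank_inf_ker c (Polynomial.degreeLT K n)
  have hle := Submodule.finrank_le ((Polynomial.degreeLT K n).map c)
  omega

end DegreeLowering

/-! ### Exponential-rational solutions -/

/-- The Taylor series at `α` of `exp (k z)`. -/
def expSeries (α k : ℂ) : ℂ⸨X⸩ := taylorSeries α fun z => Complex.exp (k * z)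

theorem analyticAt_exp_mul (k α : ℂ) : AnalyticAt ℂ (fun z => Complex.exp (k * z)) α := by
  fun_prop

theorem ordGE_expSeries (α k : ℂ) : OrdGE 0 (expSeries α k) := ordGE_taylorSeries α _

theorem laurentDeriv_expSeries (α k : ℂ) :
    laurentDeriv ℂ (expSeries α k) = k • expSeries α k := by
  have hderiv : deriv (fun z => Complex.exp (k * z)) = fun z => k * Complex.exp (k * z) :=
    funext fun z => by
      simpa [mul_comm] using ((hasDerivAt_id z).const_mul k).cexp.deriv
  rw [expSeries, ← taylorSeries_deriv, hderiv, taylorSeries_mul analyticAt_const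
    (analyticAt_exp_mul k α), taylorSeries_const, HahnSeries.C_mul_eq_smul]

theorem expSeries_neg_mul_expSeries (α k : ℂ) : expSeries α (-k) * expSeries α k = 1 := by
  rw [expSeries, expSeries, ← taylorSeries_mul (analyticAt_exp_mul _ _) (analyticAt_exp_mul _ _)]
  simp only [neg_mul, ← Complex.exp_add, neg_add_cancel, Complex.exp_zero, taylorSeries_const,
    map_one]

theorem expSeries_ne_zero (α k : ℂ) : expSeries α k ≠ 0 :=
  right_ne_zero_of_mul_eq_one (expSeries_neg_mul_expSeries α k)

/-- The operator `R'' + 2 k R' + u R`, which is `y'' + u y - k ^ 2 y` conjugated by `exp (k z)`. -/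
def conjOp (u : RatFunc ℂ) (k : ℂ) : RatFunc ℂ →ₗ[ℂ] RatFunc ℂ :=
  ratDerivation.toLinearMap ∘ₗ ratDerivation.toLinearMap + (2 * k) • ratDerivation.toLinearMap +
    LinearMap.mulLeft ℂ u

theorem conjOp_apply (u : RatFunc ℂ) (k : ℂ) (R : RatFunc ℂ) :
    conjOp u k R = ratDerivation (ratDerivation R) + (2 * k) • ratDerivation R + u * R := rfl

theorem laurentDeriv_expSeries_mul (α k : ℂ) (F : ℂ⸨X⸩) :
    laurentDeriv ℂ (expSeries α k * F) = expSeries α k * (k • F + laurentDeriv ℂ F) := by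
  rw [Derivation.leibniz, laurentDeriv_expSeries, smul_eq_mul, smul_eq_mul,
    ← HahnSeries.C_mul_eq_smul, ← HahnSeries.C_mul_eq_smul]
  ring

theorem expSeries_mul_laurentAt_conjOp (u : RatFunc ℂ) (k α : ℂ) (R : RatFunc ℂ) :
    expSeries α k * laurentAt α (conjOp u k R) =
      laurentDeriv ℂ (laurentDeriv ℂ (expSeries α k * laurentAt α R)) +
        laurentAt α u * (expSeries α k * laurentAt α R) +
        (-k ^ 2) • (expSeries α k * laurentAt α R) := by
  rw [laurentDeriv_expSeries_mul, laurentDeriv_expSeries_mul, conjOp_apply]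
  simp only [map_add, map_mul (laurentAt α), map_smul, laurentAt_ratDerivation,
    Derivation.map_smul]
  simp only [← HahnSeries.C_mul_eq_smul, map_neg, map_pow, map_mul, map_ofNat]
  ring

theorem expSeries_mul_laurentAt_smul (α k c : ℂ) (R : RatFunc ℂ) :
    expSeries α k * laurentAt α (c • R) = c • (expSeries α k * laurentAt α R) := by
  rw [map_smul, ← HahnSeries.C_mul_eq_smul, ← HahnSeries.C_mul_eq_smul, mul_left_comm]

theorem ordGE_laurentAt_conjOp {u R : RatFunc ℂ} {α : ℂ} (hu : OrdGE 0 (laurentAt α u))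
    (hR : OrdGE 0 (laurentAt α R)) (k : ℂ) : OrdGE 0 (laurentAt α (conjOp u k R)) := by
  simp only [conjOp_apply, map_add, map_mul (laurentAt α), map_smul, laurentAt_ratDerivation]
  exact (hR.laurentDeriv_of_zero.laurentDeriv_of_zero.add
    (hR.laurentDeriv_of_zero.smul _)).add (hu.mul hR)

theorem ordGE_laurentInfty_conjOp_zero {u R : RatFunc ℂ} {m : ℤ} (hu : OrdGE 2 (laurentInfty u))
    (hR : OrdGE m (laurentInfty R)) : OrdGE (m + 2) (laurentInfty (conjOp u 0 R)) := by
  simp only [conjOp_apply, mul_zero, zero_smul, add_zero, map_add, map_mul,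
    laurentInfty_ratDerivation]
  exact (hR.inftyDeriv.inftyDeriv.mono (by omega)).add ((hu.mul hR).mono (by omega))

theorem ordGE_laurentInfty_conjOp {u R : RatFunc ℂ} {m : ℤ} (hu : OrdGE 2 (laurentInfty u))
    (k : ℂ) (hR : OrdGE m (laurentInfty R)) : OrdGE (m + 1) (laurentInfty (conjOp u k R)) := by
  have hsplit : conjOp u k R = conjOp u 0 R + (2 * k) • ratDerivation R := by
    simp only [conjOp_apply, mul_zero, zero_smul]
    ring
  rw [hsplit, map_add, map_smul, laurentInfty_ratDerivation]
  exact ((ordGE_laurentInfty_conjOp_zero hu hR).mono (by omega)).add (hR.inftyDeriv.smul _)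

section ExpRational

variable {u : RatFunc ℂ} {M : ℕ} {s : Fin M → ℕ} {ζ : Fin M → ℂ} {k : ℂ} {n : ℕ}

/-- The rational functions `R` for which `exp (k z) R` is quasi-invariant at each `ζ l`, regular
elsewhere, and such that `R` times the locus polynomial has degree less than `n`. -/
def quasiInvSpace (s : Fin M → ℕ) (ζ : Fin M → ℂ) (k : ℂ) (n : ℕ) : Submodule ℂ (RatFunc ℂ) where
  carrier := {R | (∀ l, QuasiInv (s l) (expSeries (ζ l) k * laurentAt (ζ l) R)) ∧
    (∀ α, (∀ l, ζ l ≠ α) → OrdGE 0 (laurentAt α R)) ∧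
    OrdGE ((∑ l, s l : ℕ) - n + 1) (laurentInfty R)}
  zero_mem' := by
    refine ⟨fun l => ?_, fun α _ => ?_, ?_⟩
    · rw [map_zero, mul_zero]
      exact QuasiInv.zero _
    · rw [map_zero]
      exact OrdGE.zero _
    · rw [map_zero]
      exact OrdGE.zero _
  add_mem' := by
    rintro R R' ⟨hR, hR', hR''⟩ ⟨hT, hT', hT''⟩
    refine ⟨fun l => ?_, fun α hα => ?_, ?_⟩
    · rw [map_add, mul_add]
      exact (hR l).add (hT l)
    · rw [map_add]
      exact (hR' α hα).add (hT' α hα)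
    · rw [map_add]
      exact hR''.add hT''
  smul_mem' := by
    rintro c R ⟨hR, hR', hR''⟩
    refine ⟨fun l => ?_, fun α hα => ?_, ?_⟩
    · rw [expSeries_mul_laurentAt_smul]
      exact (hR l).smul c
    · rw [map_smul]
      exact (hR' α hα).smul c
    · rw [map_smul]
      exact hR''.smul c

theorem IsLocusData.map_conjOp_quasiInvSpace_le (h : IsLocusData u 0 s ζ) {r : ℕ}
    (hlower : ∀ (m : ℤ) (R : RatFunc ℂ), OrdGE m (laurentInfty R) →
      OrdGE (m + r) (laurentInfty (conjOp u k R))) :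
    (quasiInvSpace s ζ k (n + r)).map (conjOp u k) ≤ quasiInvSpace s ζ k n := by
  rintro _ ⟨R, ⟨hquasi, hreg, hinfty⟩, rfl⟩
  refine ⟨fun l => ?_, fun α hα => ?_, (hlower _ R hinfty).mono (by omega)⟩
  · rw [expSeries_mul_laurentAt_conjOp]
    exact ((h.localCond l).quasiInv (hquasi l)).add ((hquasi l).smul _)
  · exact ordGE_laurentAt_conjOp (h.ordGE_laurentAt hα) (hreg α hα) k

theorem eval_prod_X_sub_C_pow_ne_zero {K : Type*} [Field K] {ι : Type*} {T : Finset ι} (s : ι → ℕ)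
    {ζ : ι → K} {α : K} (hα : ∀ l ∈ T, ζ l ≠ α) :
    (∏ l ∈ T, (Polynomial.X - Polynomial.C (ζ l)) ^ s l).eval α ≠ 0 := by
  rw [Polynomial.eval_prod, Finset.prod_ne_zero_iff]
  intro l hl
  rw [Polynomial.eval_pow, Polynomial.eval_sub, Polynomial.eval_X, Polynomial.eval_C]
  exact pow_ne_zero _ (sub_ne_zero.2 (hα l hl).symm)

theorem coeff_laurentAt_locusPoly_ne_zero (s : Fin M → ℕ) (hζ : Function.Injective ζ)
    (l : Fin M) :
    (laurentAt (ζ l) (algebraMap ℂ[X] (RatFunc ℂ) (locusPoly s ζ))).coeff (s l) ≠ 0 := by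
  rw [laurentAt_locusPoly, HahnSeries.coeff_single_mul, one_mul, sub_self,
    coeff_zero_laurentAt_algebraMap]
  exact eval_prod_X_sub_C_pow_ne_zero s fun l' hl' => hζ.ne (Finset.ne_of_mem_erase hl')

/-- Division by the locus polynomial. -/
def divLocusPoly (s : Fin M → ℕ) (ζ : Fin M → ℂ) : ℂ[X] →ₗ[ℂ] RatFunc ℂ :=
  LinearMap.mulLeft ℂ (algebraMap ℂ[X] (RatFunc ℂ) (locusPoly s ζ))⁻¹ ∘ₗ
    (IsScalarTower.toAlgHom ℂ ℂ[X] (RatFunc ℂ)).toLinearMap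

theorem algebraMap_locusPoly_ne_zero (s : Fin M → ℕ) (ζ : Fin M → ℂ) :
    algebraMap ℂ[X] (RatFunc ℂ) (locusPoly s ζ) ≠ 0 :=
  RatFunc.algebraMap_ne_zero (monic_locusPoly s ζ).ne_zero

theorem divLocusPoly_eq_iff {p : ℂ[X]} {R : RatFunc ℂ} :
    divLocusPoly s ζ p = R ↔
      algebraMap ℂ[X] (RatFunc ℂ) (locusPoly s ζ) * R = algebraMap ℂ[X] (RatFunc ℂ) p := by
  change (algebraMap ℂ[X] (RatFunc ℂ) (locusPoly s ζ))⁻¹ * algebraMap ℂ[X] (RatFunc ℂ) p = R ↔ _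
  rw [inv_mul_eq_iff_eq_mul₀ (algebraMap_locusPoly_ne_zero s ζ), eq_comm]

theorem locusPoly_mul_divLocusPoly (s : Fin M → ℕ) (ζ : Fin M → ℂ) (p : ℂ[X]) :
    algebraMap ℂ[X] (RatFunc ℂ) (locusPoly s ζ) * divLocusPoly s ζ p =
      algebraMap ℂ[X] (RatFunc ℂ) p :=
  divLocusPoly_eq_iff.1 rfl

theorem divLocusPoly_injective (s : Fin M → ℕ) (ζ : Fin M → ℂ) :
    Function.Injective (divLocusPoly s ζ) := fun p p' h =>
  RatFunc.algebraMap_injective ℂ <| by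
    rw [← locusPoly_mul_divLocusPoly s ζ, h, locusPoly_mul_divLocusPoly]

theorem ordGE_laurentAt_divLocusPoly (hζ : Function.Injective ζ) (l : Fin M) (p : ℂ[X]) :
    OrdGE (-s l) (laurentAt (ζ l) (divLocusPoly s ζ p)) := by
  refine (ordGE_laurentAt_locusPoly s ζ l).of_mul (coeff_laurentAt_locusPoly_ne_zero s hζ l) ?_
  rw [← map_mul, locusPoly_mul_divLocusPoly, add_neg_cancel]
  exact ordGE_laurentAt_algebraMap _ p

theorem ordGE_laurentAt_divLocusPoly_of_ne {α : ℂ} (hα : ∀ l, ζ l ≠ α) (p : ℂ[X]) :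
    OrdGE 0 (laurentAt α (divLocusPoly s ζ p)) := by
  refine (ordGE_laurentAt_algebraMap α (locusPoly s ζ)).of_mul ?_ ?_
  · rw [coeff_zero_laurentAt_algebraMap]
    exact eval_prod_X_sub_C_pow_ne_zero s fun l _ => hα l
  · rw [← map_mul, locusPoly_mul_divLocusPoly, add_zero]
    exact ordGE_laurentAt_algebraMap _ p

theorem ordGE_laurentInfty_iff_mem_degreeLT {K : Type*} [Field K] {p : K[X]} {n : ℕ} :
    OrdGE (-n + 1) (laurentInfty (algebraMap K[X] (RatFunc K) p)) ↔
      p ∈ Polynomial.degreeLT K n := by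
  rw [Polynomial.mem_degreeLT]
  constructor
  · intro h
    rw [Polynomial.degree_lt_iff_coeff_zero]
    intro j hj
    rw [← coeff_laurentInfty_algebraMap]
    exact h _ (by omega)
  · intro hp
    rcases eq_or_ne p 0 with rfl | hp0
    · rw [map_zero, map_zero]
      exact OrdGE.zero _
    · have hdeg := (Polynomial.natDegree_lt_iff_degree_lt hp0).2 hp
      exact (ordGE_laurentInfty_algebraMap le_rfl).mono (by omega)

theorem ordGE_laurentInfty_divLocusPoly_iff {p : ℂ[X]} :
    OrdGE ((∑ l, s l : ℕ) - n + 1) (laurentInfty (divLocusPoly s ζ p)) ↔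
      p ∈ Polynomial.degreeLT ℂ n := by
  rw [← ordGE_laurentInfty_iff_mem_degreeLT, ← locusPoly_mul_divLocusPoly s ζ p, map_mul]
  have hQ := ordGE_laurentInfty_algebraMap (natDegree_locusPoly s ζ).le
  have hlead : (laurentInfty (algebraMap ℂ[X] (RatFunc ℂ) (locusPoly s ζ))).coeff
      (-(∑ l, s l : ℕ)) ≠ 0 := by
    rw [coeff_laurentInfty_algebraMap, ← natDegree_locusPoly s ζ]
    exact Polynomial.leadingCoeff_ne_zero.2 (monic_locusPoly s ζ).ne_zero
  exact ⟨fun h => (hQ.mul h).mono (by omega), fun h => hQ.of_mul hlead (h.mono (by omega))⟩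

/-- The coefficients whose vanishing makes `exp (k z)` times the quotient of a polynomial by the
locus polynomial quasi-invariant at every `ζ l`. -/
def quasiInvCoeffs (s : Fin M → ℕ) (ζ : Fin M → ℂ) (k : ℂ) :
    ℂ[X] →ₗ[ℂ] ((Σ l, Fin (s l)) → ℂ) where
  toFun p i := (expSeries (ζ i.1) k * laurentAt (ζ i.1) (divLocusPoly s ζ p)).coeff
    (-s i.1 + 1 + 2 * (i.2 : ℕ))
  map_add' p p' := by
    funext i
    rw [map_add, map_add, mul_add, HahnSeries.coeff_add, Pi.add_apply]
  map_smul' c p := by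
    funext i
    rw [map_smul, expSeries_mul_laurentAt_smul, HahnSeries.coeff_smul, RingHom.id_apply,
      Pi.smul_apply]

theorem quasiInvCoeffs_eq_zero_iff (hζ : Function.Injective ζ) (k : ℂ) (p : ℂ[X]) :
    quasiInvCoeffs s ζ k p = 0 ↔
      ∀ l, QuasiInv (s l) (expSeries (ζ l) k * laurentAt (ζ l) (divLocusPoly s ζ p)) := by
  constructor
  · intro h l
    refine ⟨?_, fun i hi => congrFun h ⟨l, i, hi⟩⟩
    exact ((ordGE_expSeries _ k).mul (ordGE_laurentAt_divLocusPoly hζ l p)).mono (by omega)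
  · intro h
    funext ⟨l, i⟩
    exact (h l).2 i i.2

theorem exists_divLocusPoly_eq {R : RatFunc ℂ} (hR : R ∈ quasiInvSpace s ζ k n) :
    ∃ p, divLocusPoly s ζ p = R := by
  simp only [divLocusPoly_eq_iff]
  refine exists_polynomial_of_ordGE fun α => ?_
  rw [map_mul]
  by_cases hα : ∃ l, ζ l = α
  · obtain ⟨l, rfl⟩ := hα
    have hord := (ordGE_expSeries (ζ l) (-k)).mul (hR.1 l).1
    rw [← mul_assoc, expSeries_neg_mul_expSeries, one_mul] at hord
    exact ((ordGE_laurentAt_locusPoly s ζ l).mul hord).mono (by omega)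
  · push Not at hα
    exact (ordGE_laurentAt_algebraMap α _).mul (hR.2.1 α hα)

theorem quasiInvSpace_eq_map (hζ : Function.Injective ζ) (k : ℂ) (n : ℕ) :
    quasiInvSpace s ζ k n =
      (Polynomial.degreeLT ℂ n ⊓ LinearMap.ker (quasiInvCoeffs s ζ k)).map (divLocusPoly s ζ) := by
  ext R
  constructor
  · intro hR
    obtain ⟨p, rfl⟩ := exists_divLocusPoly_eq hR
    exact ⟨p, ⟨ordGE_laurentInfty_divLocusPoly_iff.1 hR.2.2,
      (quasiInvCoeffs_eq_zero_iff hζ k p).2 hR.1⟩, rfl⟩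
  · rintro ⟨p, ⟨hdeg, hcoeff⟩, rfl⟩
    exact ⟨(quasiInvCoeffs_eq_zero_iff hζ k p).1 hcoeff,
      fun α hα => ordGE_laurentAt_divLocusPoly_of_ne hα p,
      ordGE_laurentInfty_divLocusPoly_iff.2 hdeg⟩

theorem finiteDimensional_quasiInvSpace (hζ : Function.Injective ζ) (k : ℂ) (n : ℕ) :
    FiniteDimensional ℂ (quasiInvSpace s ζ k n) := by
  have := (Polynomial.degreeLTEquiv ℂ n).symm.finiteDimensional
  rw [quasiInvSpace_eq_map hζ]
  infer_instance

theorem le_finrank_quasiInvSpace (hζ : Function.Injective ζ) (k : ℂ) (n : ℕ) :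
    n ≤ Module.finrank ℂ (quasiInvSpace s ζ k n) +
      Module.finrank ℂ ((Σ l, Fin (s l)) → ℂ) := by
  rw [quasiInvSpace_eq_map hζ,
    ← (Submodule.equivMapOfInjective _ (divLocusPoly_injective s ζ) _).finrank_eq]
  exact le_finrank_degreeLT_inf_ker (quasiInvCoeffs s ζ k) n

theorem IsLocusData.exists_conjOp_eq_zero (h : IsLocusData u 0 s ζ) {r : ℕ}
    (hlower : ∀ (m : ℤ) (R : RatFunc ℂ), OrdGE m (laurentInfty R) →
      OrdGE (m + r) (laurentInfty (conjOp u k R))) :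
    ∃ R : Fin r → RatFunc ℂ, LinearIndependent ℂ R ∧ ∀ i, conjOp u k (R i) = 0 := by
  have := finiteDimensional_quasiInvSpace (s := s) h.distinct k
  obtain ⟨n, hn⟩ := exists_le_finrank_inf_ker (le_finrank_quasiInvSpace h.distinct k)
    fun n => h.map_conjOp_quasiInvSpace_le hlower
  obtain ⟨R, hR⟩ := exists_linearIndependent_of_le_finrank hn
  exact ⟨fun i => R i, hR.map' (Submodule.subtype _) (Submodule.ker_subtype _),
    fun i => (R i).2.2⟩

end ExpRational

theorem HasLaurentSeriesAt.exp_mul_val (k α : ℂ) (R : RatFunc ℂ) :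
    HasLaurentSeriesAt (fun z => Complex.exp (k * z) * val R z) α
      (expSeries α k * laurentAt α R) :=
  (hasLaurentSeriesAt_of_analyticAt (analyticAt_exp_mul k α)).mul (hasLaurentSeriesAt_val R α)

theorem meromorphic_exp_mul_val (k : ℂ) (R : RatFunc ℂ) :
    Meromorphic fun z => Complex.exp (k * z) * val R z := fun α =>
  (HasLaurentSeriesAt.exp_mul_val k α R).meromorphicAt

theorem isMeromorphicSolution_exp_mul_val {q R : RatFunc ℂ} {qInf k E : ℂ}
    (hk : k ^ 2 = E - qInf) (hR : conjOp (q - RatFunc.C qInf) k R = 0) :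
    IsMeromorphicSolution q E fun z => Complex.exp (k * z) * val R z := by
  refine isMeromorphicSolution_iff.2 fun α =>
    ⟨expSeries α k * laurentAt α R, .exp_mul_val k α R, ?_⟩
  have hconj := expSeries_mul_laurentAt_conjOp (q - RatFunc.C qInf) k α R
  rw [hR, map_zero, mul_zero, map_sub, laurentAt_C, hk] at hconj
  rw [IsFormalSolution]
  simp only [← HahnSeries.C_mul_eq_smul, map_neg, map_sub] at hconj ⊢
  linear_combination -hconj

theorem eventually_exp_mul_val_linearCombination_eq_zero_iff (k k' : ℂ) (R R' : RatFunc ℂ)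
    (a b : ℂ) :
    (∀ᶠ z in Filter.codiscrete ℂ,
      a * (Complex.exp (k * z) * val R z) + b * (Complex.exp (k' * z) * val R' z) = 0) ↔
    expSeries 0 k * laurentAt 0 (a • R) + expSeries 0 k' * laurentAt 0 (b • R') = 0 := by
  rw [eventually_codiscrete_linearCombination_eq_zero_iff (meromorphic_exp_mul_val k R)
    (meromorphic_exp_mul_val k' R') (.exp_mul_val k 0 R) (.exp_mul_val k' 0 R'),
    expSeries_mul_laurentAt_smul, expSeries_mul_laurentAt_smul]

theorem mul_eq_zero_of_wronskian_eq_smul {f g : RatFunc ℂ} {c : ℂ} (hc : c ≠ 0)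
    (h : f * ratDerivation g - g * ratDerivation f = c • (f * g)) : f * g = 0 := by
  by_contra hfg
  obtain ⟨m, hm, hm0⟩ :=
    exists_ordGE_coeff_ne_zero ((map_ne_zero laurentInfty).2 (left_ne_zero_of_mul hfg))
  obtain ⟨n, hn, hn0⟩ :=
    exists_ordGE_coeff_ne_zero ((map_ne_zero laurentInfty).2 (right_ne_zero_of_mul hfg))
  have hwronskian : OrdGE (m + n + 1) (c • (laurentInfty f * laurentInfty g)) := by
    rw [← map_mul, ← map_smul, ← h, map_sub, map_mul, map_mul, laurentInfty_ratDerivation,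
      laurentInfty_ratDerivation]
    exact ((hm.mul hn.inftyDeriv).mono (by omega)).sub ((hn.mul hm.inftyDeriv).mono (by omega))
  have hlead := hwronskian (m + n) (by omega)
  rw [HahnSeries.coeff_smul, hm.coeff_mul hn] at hlead
  exact mul_ne_zero hc (mul_ne_zero hm0 hn0) hlead

theorem eq_zero_of_expSeries_add_eq_zero {k α : ℂ} (hk : k ≠ 0) {f g : RatFunc ℂ}
    (h : expSeries α k * laurentAt α f + expSeries α (-k) * laurentAt α g = 0) :
    f = 0 ∧ g = 0 := by
  have hderiv := congrArg (laurentDeriv ℂ) h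
  rw [map_add, map_zero, laurentDeriv_expSeries_mul, laurentDeriv_expSeries_mul] at hderiv
  have hwronskian : f * ratDerivation g - g * ratDerivation f = (2 * k) • (f * g) := by
    refine laurentAt_injective α (mul_left_cancel₀ (expSeries_ne_zero α k) ?_)
    simp only [map_sub, map_mul (laurentAt α), map_smul, laurentAt_ratDerivation]
    simp only [← HahnSeries.C_mul_eq_smul, map_neg, map_mul, map_ofNat] at hderiv ⊢
    linear_combination (laurentDeriv ℂ (laurentAt α g) - HahnSeries.C k * laurentAt α g) * h -
      laurentAt α g * hderiv
  have hexp {k : ℂ} {f : RatFunc ℂ} (h : expSeries α k * laurentAt α f = 0) : f = 0 :=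
    (map_eq_zero (laurentAt α)).1 ((mul_eq_zero.1 h).resolve_left (expSeries_ne_zero α k))
  rcases mul_eq_zero.1 (mul_eq_zero_of_wronskian_eq_smul (mul_ne_zero two_ne_zero hk) hwronskian)
    with rfl | rfl
  · rw [map_zero, mul_zero, zero_add] at h
    exact ⟨rfl, hexp h⟩
  · rw [map_zero, mul_zero, add_zero] at h
    exact ⟨hexp h, rfl⟩

section LocusPotential

variable {q : RatFunc ℂ} {qInf : ℂ} {M : ℕ} {s : Fin M → ℕ} {ζ : Fin M → ℂ}

theorem IsLocusData.hasMeromorphicFundamentalSystem_self (h : IsLocusData q qInf s ζ) :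
    HasMeromorphicFundamentalSystem q qInf := by
  have hu : OrdGE 2 (laurentInfty (q - RatFunc.C qInf)) := h.laurentInfty_sub_C.1
  obtain ⟨R, hR, hR0⟩ := h.sub_C.exists_conjOp_eq_zero (k := 0) (r := 2)
    fun _ _ hR => ordGE_laurentInfty_conjOp_zero hu hR
  refine ⟨_, _, isMeromorphicSolution_exp_mul_val (by ring) (hR0 0),
    isMeromorphicSolution_exp_mul_val (by ring) (hR0 1), fun a b hab => ?_⟩
  rw [eventually_exp_mul_val_linearCombination_eq_zero_iff, ← mul_add, ← map_add] at hab
  rw [← show ![R 0, R 1] = R from List.ofFn_inj.1 rfl, LinearIndependent.pair_iff] at hR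
  exact hR a b ((map_eq_zero (laurentAt 0)).1
    ((mul_eq_zero.1 hab).resolve_left (expSeries_ne_zero 0 0)))

theorem IsLocusData.hasMeromorphicFundamentalSystem_of_ne (h : IsLocusData q qInf s ζ) {E : ℂ}
    (hE : E ≠ qInf) : HasMeromorphicFundamentalSystem q E := by
  obtain ⟨k, hk⟩ := IsAlgClosed.exists_pow_nat_eq (E - qInf) zero_lt_two
  have hk0 : k ≠ 0 := by
    rintro rfl
    exact hE (sub_eq_zero.1 (hk.symm.trans (zero_pow two_ne_zero)))
  have hu : OrdGE 2 (laurentInfty (q - RatFunc.C qInf)) := h.laurentInfty_sub_C.1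
  have hexists (k : ℂ) : ∃ R : RatFunc ℂ, R ≠ 0 ∧ conjOp (q - RatFunc.C qInf) k R = 0 := by
    obtain ⟨R, hR, hR0⟩ := h.sub_C.exists_conjOp_eq_zero (k := k) (r := 1)
      fun _ _ hR => ordGE_laurentInfty_conjOp hu k hR
    exact ⟨R 0, hR.ne_zero 0, hR0 0⟩
  obtain ⟨R, hR, hRsol⟩ := hexists k
  obtain ⟨R', hR', hRsol'⟩ := hexists (-k)
  refine ⟨_, _, isMeromorphicSolution_exp_mul_val hk hRsol,
    isMeromorphicSolution_exp_mul_val ((neg_sq k).trans hk) hRsol', fun a b hab => ?_⟩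
  rw [eventually_exp_mul_val_linearCombination_eq_zero_iff] at hab
  obtain ⟨ha, hb⟩ := eq_zero_of_expSeries_add_eq_zero hk0 hab
  exact ⟨(smul_eq_zero.1 ha).resolve_right hR, (smul_eq_zero.1 hb).resolve_right hR'⟩

theorem IsLocusData.hasMeromorphicFundamentalSystem (h : IsLocusData q qInf s ζ) (E : ℂ) :
    HasMeromorphicFundamentalSystem q E := by
  rcases eq_or_ne E qInf with rfl | hE
  · exact h.hasMeromorphicFundamentalSystem_self
  · exact h.hasMeromorphicFundamentalSystem_of_ne hE

end LocusPotential

theorem isHalphenPotential_iff {q : RatFunc ℂ} (hq : ∀ c : ℂ, q ≠ RatFunc.C c) :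
    IsHalphenPotential q ↔
      ∃ (M : ℕ) (s : Fin M → ℕ) (qInf : ℂ) (ζ : Fin M → ℂ), IsLocusData q qInf s ζ :=
  ⟨fun h => h.exists_isLocusData hq, fun ⟨_, _, _, _, h⟩ =>
    ⟨h.boundedNearInfinity, h.hasMeromorphicFundamentalSystem⟩⟩

theorem isKdVPotential_iff {q : RatFunc ℂ} (hq : ∀ c : ℂ, q ≠ RatFunc.C c) :
    IsKdVPotential q ↔
      ∃ (M : ℕ) (s : Fin M → ℕ) (qInf : ℂ) (ζ : Fin M → ℂ), IsLocusData q qInf s ζ := by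
  refine ⟨fun h => h.exists_isLocusData hq, fun ⟨_, _, _, _, h⟩ => ?_⟩
  obtain ⟨g, -, -, ⟨f, hf, -⟩, -⟩ := h.exists_hasSpectralCurve
  exact ⟨g, f, hf⟩

end HalphenKdV

end

theorem theorem3p6 (q : RatFunc ℂ) (hq : ∀ c : ℂ, q ≠ RatFunc.C c) :
    -- Halphen potentials
    (HalphenKdV.IsHalphenPotential q ↔
      ∃ (M : ℕ) (s : Fin M → ℕ) (qInf : ℂ) (ζ : Fin M → ℂ),
        HalphenKdV.IsLocusData q qInf s ζ) ∧
    -- rational KdV potentials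
    (HalphenKdV.IsKdVPotential q ↔
      ∃ (M : ℕ) (s : Fin M → ℕ) (qInf : ℂ) (ζ : Fin M → ℂ),
        HalphenKdV.IsLocusData q qInf s ζ) ∧
    -- the isospectral class of the curve `y² = (E - q∞) ^ (2g+1)`
    (∀ (g : ℕ) (qInf : ℂ),
      HalphenKdV.HasSpectralCurve q g ((Polynomial.X - Polynomial.C qInf) ^ (2 * g + 1)) ↔
        ∃ (M : ℕ) (s : Fin M → ℕ) (ζ : Fin M → ℂ),
          HalphenKdV.IsLocusData q qInf s ζ ∧ ∑ l, s l * (s l + 1) = g * (g + 1)) ∧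
    -- every choice of data on the locus belongs to one of these classes
    (∀ (M : ℕ) (s : Fin M → ℕ) (qInf : ℂ) (ζ : Fin M → ℂ),
      HalphenKdV.IsLocusData q qInf s ζ →
        ∃ g : ℕ, 1 ≤ g ∧ ∑ l, s l * (s l + 1) = g * (g + 1)) := by
  refine ⟨HalphenKdV.isHalphenPotential_iff hq, HalphenKdV.isKdVPotential_iff hq,
    HalphenKdV.hasSpectralCurve_iff hq, fun M s qInf ζ h => ?_⟩
  obtain ⟨g, hg, hsum, -⟩ := h.exists_hasSpectralCurve
  exact ⟨g, hg, hsum⟩
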